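/- Let $M$ be a compact smooth surface without boundary with a smooth Riemannian metric, and let $|\xi|$ be the induced norm of covectors. Let $p\in C^\infty(T^*M\setminus 0;\mathbb R)$ be homogeneous of degree $0$ in $\xi$. Let $\overline T^*M$ be the fiber-radially compactified cotangent bundle and $\kappa:\overline T^*M\setminus 0\to\partial\overline T^*M$ the quotient map of the dilations $(x,\xi)\mapsto(x,t\xi)$, $t>0$. Let $H_p$ be the Hamiltonian vector field of $p$ and $X:=\kappa_*(|\xi|H_p)$. Let $\omega\in\mathbb R$ be a regular value of $p$ with $\Sigma(\omega):=\kappa(p^{-1}(\omega))\neq\emptyset$, and assume that the flow of $X$ on the surface $\Sigma(\omega)$ is a Morse--Smale flow without fixed points: $X$ has no zeros on $\Sigma(\omega)$, it has finitely many closed orbits on $\Sigma(\omega)$, all of them hyperbolic limit cycles, and for every other trajectory the $\alpha$-limit set and the $\omega$-limit set are each one of these cycles. Let $L^+_\omega$ (respectively $L^-_\omega$) be the union of the attracting (respectively repelling) limit cycles. Then $L^+_\omega$ is a radial sink and $L^-_\omega$ is a radial source for the Hamiltonian flow of $|\xi|(p-\omega)$ on $T^*M\setminus 0$, and $\Lambda^\pm_\omega:=\kappa^{-1}(L^\pm_\omega)\subset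 T^*M\setminus 0$ are conic Lagrangian submanifolds. Here, for $f\in C^\infty(T^*M\setminus 0;\mathbb R)$ homogeneous of degree $1$ in $\xi$ with Hamiltonian flow $\varphi_t$ (extended continuously to $\overline T^*M\setminus 0$), a nonempty compact $\varphi_t$-invariant set $L\subset\partial\overline T^*M\cap\{|\xi|^{-1}f=0\}$ is a radial source if there are a neighbourhood $U$ of $L$ in $\overline T^*M$ and constants $C,\theta>0$ such that $\kappa(\varphi_t(x,\xi))\to L$ as $t\to-\infty$ uniformly in $(x,\xi)\in U$, and $|\varphi_t(x,\xi)|\ge C^{-1}e^{\theta|t|}|\xi|$ for all $(x,\xi)\in U\cap T^*M$ and $t\le 0$. A radial sink for $f$ is a radial source for $-f$. -/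

import Mathlib

open Set Filter Topology
open scoped Manifold ContDiff

namespace CotangentFlow

noncomputable section

/-- The model space of surfaces. -/
abbrev Plane : Type := EuclideanSpace ℝ (Fin 2)

/-- The space of covectors of the model space. -/
abbrev CoPlane : Type := Plane →L[ℝ] ℝ

/-- The cotangent bundle `T*M` of a surface `M`: a point is a pair `v = ⟨x, ξ⟩` with
`ξ : T_x M →L[ℝ] ℝ`. Topology and charts are the ones of Mathlib's vector bundle of continuous
linear maps from `TM` to the trivial line bundle; the charts are the canonical coordinates
`(x, ξ)` induced by the charts of `M`. -/
abbrev Cotangent (M : Type*) [TopologicalSpace M] [ChartedSpace Plane M]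
    [IsManifold (𝓡 2) ∞ M] : Type _ :=
  Bundle.TotalSpace CoPlane
    (fun x : M => TangentSpace (𝓡 2) x →L[ℝ] Bundle.Trivial M ℝ x)

/-- The model with corners of `T*M`. -/
abbrev cotModel : ModelWithCorners ℝ (Plane × CoPlane) (ModelProd Plane CoPlane) :=
  (𝓡 2).prod 𝓘(ℝ, CoPlane)

/-- A smooth Riemannian metric on the surface `M`. -/
abbrev Metric (M : Type*) [TopologicalSpace M] [ChartedSpace Plane M]
    [IsManifold (𝓡 2) ∞ M] : Type _ :=
  Bundle.ContMDiffRiemannianMetric (𝓡 2) ∞ Plane (fun x : M => TangentSpace (𝓡 2) x)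

variable {M : Type*} [TopologicalSpace M] [ChartedSpace Plane M] [IsManifold (𝓡 2) ∞ M]

/-! ### Symplectic structure and Hamiltonian fields -/

/-- The canonical symplectic form `σ = ∑ dξ_j ∧ dx_j` of `T*M` at `v`. The tangent space of `T*M`
at `v` is `Plane × CoPlane`, read in the preferred chart at `v`, which is a system of canonical
coordinates `(x, ξ)`. -/
def symplectic (v : Cotangent M) (a b : TangentSpace cotModel v) : ℝ :=
  let a' : Plane × CoPlane := a
  let b' : Plane × CoPlane := b
  a'.2 b'.1 - b'.2 a'.1

/-- The Hamiltonian vector field `H_f = ∑ ∂_{ξ_j} f ∂_{x_j} - ∂_{x_j} f ∂_{ξ_j}` on `T*M`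
(in the canonical coordinates of the preferred chart). -/
def hamiltonianField (f : Cotangent M → ℝ) (v : Cotangent M) : TangentSpace cotModel v :=
  let D : Plane × CoPlane →L[ℝ] ℝ := mfderiv cotModel 𝓘(ℝ, ℝ) f v
  ((∑ j : Fin 2, D (0, EuclideanSpace.proj j) • EuclideanSpace.single j (1 : ℝ),
    -(D.comp (ContinuousLinearMap.inl ℝ Plane CoPlane))) : Plane × CoPlane)

/-- The Hamiltonian vector field satisfies `σ(w, H_f) = df(w)`. -/
theorem symplectic_hamiltonianField (f : Cotangent M → ℝ) (v : Cotangent M)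
    (w : TangentSpace cotModel v) :
    symplectic v w (hamiltonianField f v) = mfderiv cotModel 𝓘(ℝ, ℝ) f v w := by
  obtain ⟨a, α⟩ : Plane × CoPlane := w
  let D : Plane × CoPlane →L[ℝ] ℝ := mfderiv cotModel 𝓘(ℝ, ℝ) f v
  change α (∑ j : Fin 2, D (0, EuclideanSpace.proj j) • EuclideanSpace.single j (1 : ℝ))
    - (-(D.comp (ContinuousLinearMap.inl ℝ Plane CoPlane))) a = D (a, α)
  have hα : α = ∑ j : Fin 2, α (EuclideanSpace.single j (1 : ℝ)) •
      (EuclideanSpace.proj j : CoPlane) := by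
    ext u
    have hu : u = ∑ j : Fin 2, u j • EuclideanSpace.single j (1 : ℝ) := by
      ext i
      fin_cases i <;> simp [Fin.sum_univ_two]
    conv_lhs => rw [hu]
    simp [Fin.sum_univ_two, mul_comm]
  have h1 : D (0, α) = ∑ j : Fin 2, α (EuclideanSpace.single j (1 : ℝ)) *
      D (0, EuclideanSpace.proj j) := by
    conv_lhs => rw [hα]
    have := map_sum (D.comp (ContinuousLinearMap.inr ℝ Plane CoPlane))
      (fun j : Fin 2 => α (EuclideanSpace.single j (1 : ℝ)) •
        (EuclideanSpace.proj j : CoPlane)) Finset.univ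
    simpa only [ContinuousLinearMap.comp_apply, ContinuousLinearMap.inr_apply, map_smul,
      smul_eq_mul] using this
  have h2 : D (a, α) = D (a, 0) + D (0, α) := by
    rw [← map_add]; simp
  rw [h2, h1]
  simp [Fin.sum_univ_two]
  ring

/-! ### The fiber-radial compactification -/

/-- Multiplication of a covector by a real number, `(x, ξ) ↦ (x, t ξ)`. -/
def scale (t : ℝ) (v : Cotangent M) : Cotangent M := ⟨v.1, t • v.2⟩

/-- The complement `T*M \ 0` of the zero section. -/
def nonzero (M : Type*) [TopologicalSpace M] [ChartedSpace Plane M]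
    [IsManifold (𝓡 2) ∞ M] : Set (Cotangent M) := {v | v.2 ≠ 0}

/-- The norm `|ξ|` of a covector with respect to the metric `g`, that is the supremum of `ξ u`
over the tangent vectors `u` with `g(u, u) ≤ 1`. -/
def conorm (g : Metric M) (v : Cotangent M) : ℝ :=
  sSup ((fun u : TangentSpace (𝓡 2) v.1 => (v.2 u : ℝ)) '' {u | g.inner v.1 u u ≤ 1})

theorem conorm_scale (g : Metric M) {t : ℝ} (ht : 0 ≤ t) (v : Cotangent M) :
    conorm g (scale t v) = t * conorm g v := by
  have h := Real.sSup_smul_of_nonneg ht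
    ((fun u : TangentSpace (𝓡 2) v.1 => (v.2 u : ℝ)) '' {u | g.inner v.1 u u ≤ 1})
  rw [smul_eq_mul] at h
  unfold conorm
  rw [← h, ← image_smul, image_image]
  rfl

/-- The map `κ : (x, ξ) ↦ (x, ξ / |ξ|)`. The boundary `∂T̄*M`, the quotient of `T*M \ 0` by the
dilations, is represented by the unit cosphere bundle `{|ξ| = 1}` and then `κ` is the quotient
map. -/
def kappa (g : Metric M) (v : Cotangent M) : Cotangent M := scale (conorm g v)⁻¹ v

/-- The fiber-radially compactified cotangent bundle `T̄*M` as a topological space: the closed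
unit ball bundle. Its interior is identified with `T*M` by `Compactified.embed`, its boundary
is the unit cosphere bundle. -/
def Compactified (g : Metric M) : Type _ := {v : Cotangent M // conorm g v ≤ 1}

instance (g : Metric M) : TopologicalSpace (Compactified g) :=
  inferInstanceAs (TopologicalSpace {v : Cotangent M // conorm g v ≤ 1})

/-- The inclusion `T*M → T̄*M`, `(x, ξ) ↦ (x, ξ / ⟨ξ⟩)` with `⟨ξ⟩ = (1 + |ξ|²)^{1/2}`. -/
def Compactified.embed (g : Metric M) (v : Cotangent M) : Compactified g :=
  ⟨scale (Real.sqrt (1 + conorm g v ^ 2))⁻¹ v, by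
    rw [conorm_scale g (inv_nonneg.2 (Real.sqrt_nonneg _)), inv_mul_le_iff₀ (by positivity),
      mul_one]
    exact Real.le_sqrt_of_sq_le (by linarith)⟩

/-- A subset of the unit cosphere bundle (or of the unit ball bundle) as a subset of `T̄*M`. -/
def Compactified.lift (g : Metric M) (L : Set (Cotangent M)) : Set (Compactified g) :=
  {z | z.1 ∈ L}

/-- The points of `T̄*M` off the zero section. -/
def Compactified.nonzero (g : Metric M) : Set (Compactified g) := {z | z.1.2 ≠ 0}

/-- `φ` is the flow on `T*M \ 0` of the vector field `Y`, and `Φ` is its continuous extension to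
`T̄*M \ 0`. -/
structure IsCompactifiedFlow (g : Metric M) (Y : (v : Cotangent M) → TangentSpace cotModel v)
    (φ : ℝ → Cotangent M → Cotangent M) (Φ : ℝ → Compactified g → Compactified g) : Prop where
  zero : ∀ v ∈ nonzero M, φ 0 v = v
  mem : ∀ v ∈ nonzero M, ∀ t, φ t v ∈ nonzero M
  integralCurve : ∀ v ∈ nonzero M, IsMIntegralCurve (I := cotModel) (fun t => φ t v) Y
  embed : ∀ v ∈ nonzero M, ∀ t, Φ t (Compactified.embed g v) = Compactified.embed g (φ t v)
  continuousOn : ContinuousOn (fun q : ℝ × Compactified g => Φ q.1 q.2)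
    {q | q.2 ∈ Compactified.nonzero g}

/-! ### Radial sources and sinks -/

/-- `L ⊆ ∂T̄*M` is a radial source for the Hamiltonian flow `φ_t = exp(t H_f)` of a function `f`
on `T*M \ 0` which is homogeneous of degree one: `L` is nonempty, compact, contained in the
characteristic set of `f` and invariant under the flow, and there is a neighbourhood `U` of `L`
in `T̄*M` such that `κ(φ_t(x, ξ)) → L` as `t → -∞`, uniformly for `(x, ξ) ∈ U`, and
`|φ_t(x, ξ)| ≥ C⁻¹ exp(θ |t|) |ξ|` for `(x, ξ) ∈ U ∩ T*M`, `t ≤ 0`. -/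
def IsRadialSource (g : Metric M) (f : Cotangent M → ℝ) (L : Set (Cotangent M)) : Prop :=
  L.Nonempty ∧ IsCompact L ∧ (∀ v ∈ L, conorm g v = 1 ∧ f v = 0) ∧
  ∃ (φ : ℝ → Cotangent M → Cotangent M) (Φ : ℝ → Compactified g → Compactified g),
    IsCompactifiedFlow g (hamiltonianField f) φ Φ ∧
    (∀ t, Φ t '' Compactified.lift g L = Compactified.lift g L) ∧
    ∃ U ∈ 𝓝ˢ (Compactified.lift g L), U ⊆ Compactified.nonzero g ∧
      (∀ V ∈ 𝓝ˢ L, ∃ T : ℝ, ∀ t ≤ T, ∀ z ∈ U, kappa g (Φ t z).1 ∈ V) ∧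
      ∃ C > 0, ∃ θ > 0, ∀ v ∈ nonzero M, Compactified.embed g v ∈ U → ∀ t ≤ 0,
        C⁻¹ * Real.exp (θ * |t|) * conorm g v ≤ conorm g (φ t v)

/-- A radial sink for `f` is a radial source for `-f`. -/
def IsRadialSink (g : Metric M) (f : Cotangent M → ℝ) (L : Set (Cotangent M)) : Prop :=
  IsRadialSource g (fun v => -f v) L

/-! ### The flow of `X` on the energy surface -/

/-- The surface `Σ(ν) = κ(p⁻¹(ν))` in the unit cosphere bundle. -/
def energySurface (g : Metric M) (p : Cotangent M → ℝ) (ν : ℝ) : Set (Cotangent M) :=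
  kappa g '' {v | v ∈ nonzero M ∧ p v = ν}

/-- The vector field `X = κ_*(|ξ| H_p)`. Only its values at points `v` of the unit cosphere
bundle matter; there `κ(v) = v`, and `X(v) = dκ(v) (|ξ| H_p(v))` is tangent to it. -/
def projectedField (g : Metric M) (p : Cotangent M → ℝ) (v : Cotangent M) :
    TangentSpace cotModel v :=
  (mfderiv cotModel cotModel (kappa g) v (conorm g v • hamiltonianField p v) :
    TangentSpace cotModel (kappa g v))

/-- `γ` is a trajectory of `X` on `Σ(ν)`. -/
def IsTrajectory (g : Metric M) (p : Cotangent M → ℝ) (ν : ℝ) (γ : ℝ → Cotangent M) : Prop :=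
  IsMIntegralCurve (I := cotModel) γ (projectedField g p) ∧ ∀ t, γ t ∈ energySurface g p ν

/-- `ψ t` is the flow `exp(tX)` on `Σ(ν)`. -/
def IsFlow (g : Metric M) (p : Cotangent M → ℝ) (ν : ℝ)
    (ψ : ℝ → Cotangent M → Cotangent M) : Prop :=
  ∀ z ∈ energySurface g p ν, ψ 0 z = z ∧ IsTrajectory g p ν (fun t => ψ t z)

/-- `C` is a closed orbit of `X` on `Σ(ν)` (not a fixed point), with prime period `T`, traced by
the trajectory `γ`. -/
structure IsClosedOrbitOf (g : Metric M) (p : Cotangent M → ℝ) (ν : ℝ) (C : Set (Cotangent M))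
    (γ : ℝ → Cotangent M) (T : ℝ) : Prop where
  trajectory : IsTrajectory g p ν γ
  pos : 0 < T
  periodic : Function.Periodic γ T
  prime : ∀ t, 0 < t → t < T → γ t ≠ γ 0
  range_eq : range γ = C

/-- `C` is a closed orbit of `X` on `Σ(ν)`. -/
def IsClosedOrbit (g : Metric M) (p : Cotangent M → ℝ) (ν : ℝ) (C : Set (Cotangent M)) : Prop :=
  ∃ γ T, IsClosedOrbitOf g p ν C γ T

/-- The linearized Poincaré map of the closed orbit `C` is multiplication by `c`: with `T` the
period and `z` a point of `C`, the differential of `exp(TX) : Σ(ν) → Σ(ν)` at `z` acts on the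
line `T_z Σ(ν) / ℝ X(z)` as multiplication by `c`. Tangent vectors `w` of `Σ(ν)` at `z` are
velocities of curves `s ↦ η s` in `Σ(ν)` with `η 0 = z`. -/
def HasMultiplier (g : Metric M) (p : Cotangent M → ℝ) (ν : ℝ) (C : Set (Cotangent M))
    (c : ℝ) : Prop :=
  ∃ γ T ψ, IsClosedOrbitOf g p ν C γ T ∧ IsFlow g p ν ψ ∧
    ∀ η : ℝ → Cotangent M, (∀ s, η s ∈ energySurface g p ν) → η 0 = γ 0 →
      ∀ w : TangentSpace cotModel (γ 0),
        HasMFDerivAt 𝓘(ℝ, ℝ) cotModel η 0 ((1 : ℝ →L[ℝ] ℝ).smulRight w) →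
        ∃ a : ℝ, HasMFDerivAt 𝓘(ℝ, ℝ) cotModel (fun s => ψ T (η s)) 0
          ((1 : ℝ →L[ℝ] ℝ).smulRight
            (c • w + a • projectedField g p (γ 0)))

/-- `C` is an attracting hyperbolic limit cycle of `X` on `Σ(ν)`. -/
def IsAttractingCycle (g : Metric M) (p : Cotangent M → ℝ) (ν : ℝ)
    (C : Set (Cotangent M)) : Prop :=
  IsClosedOrbit g p ν C ∧ ∃ c : ℝ, |c| < 1 ∧ HasMultiplier g p ν C c

/-- `C` is a repelling hyperbolic limit cycle of `X` on `Σ(ν)`. -/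
def IsRepellingCycle (g : Metric M) (p : Cotangent M → ℝ) (ν : ℝ)
    (C : Set (Cotangent M)) : Prop :=
  IsClosedOrbit g p ν C ∧ ∃ c : ℝ, 1 < |c| ∧ HasMultiplier g p ν C c

/-- The set of limit points of `γ t` as `t` tends to `l` (`l = atTop` gives the ω-limit set,
`l = atBot` the α-limit set). -/
def limitSet (l : Filter ℝ) (γ : ℝ → Cotangent M) : Set (Cotangent M) :=
  {z | MapClusterPt z l γ}

/-- The flow of `X` on `Σ(ν)` is a Morse–Smale flow without fixed points: `X` does not vanish on
`Σ(ν)`; there are finitely many closed orbits, all of them hyperbolic limit cycles; and the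
α- and ω-limit set of every other trajectory are each one of these cycles. (The condition on
separatrices of saddle points is void.) -/
structure IsMorseSmale (g : Metric M) (p : Cotangent M → ℝ) (ν : ℝ) : Prop where
  no_fixed_point : ∀ z ∈ energySurface g p ν, projectedField g p z ≠ 0
  finite : {C | IsClosedOrbit g p ν C}.Finite
  hyperbolic : ∀ C, IsClosedOrbit g p ν C →
    IsAttractingCycle g p ν C ∨ IsRepellingCycle g p ν C
  limit : ∀ γ, IsTrajectory g p ν γ → ¬ IsClosedOrbit g p ν (range γ) →
    IsClosedOrbit g p ν (limitSet atBot γ) ∧ IsClosedOrbit g p ν (limitSet atTop γ)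

/-- `L⁺_ν`: the union of the attracting limit cycles of `X` on `Σ(ν)`. -/
def attractor (g : Metric M) (p : Cotangent M → ℝ) (ν : ℝ) : Set (Cotangent M) :=
  ⋃₀ {C | IsAttractingCycle g p ν C}

/-- `L⁻_ν`: the union of the repelling limit cycles of `X` on `Σ(ν)`. -/
def repeller (g : Metric M) (p : Cotangent M → ℝ) (ν : ℝ) : Set (Cotangent M) :=
  ⋃₀ {C | IsRepellingCycle g p ν C}

/-- The cone `κ⁻¹(L)` in `T*M \ 0`. -/
def cone (g : Metric M) (L : Set (Cotangent M)) : Set (Cotangent M) :=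
  {v | v ∈ nonzero M ∧ kappa g v ∈ L}

/-! ### Conic Lagrangian submanifolds -/

/-- `Λ` is a conic Lagrangian submanifold of `T*M \ 0`: it is invariant under positive dilations,
and near each of its points it is the image of a smooth embedding of the plane (a smooth map
with injective differentials which is a homeomorphism onto its image) on whose tangent spaces
the symplectic form vanishes. -/
structure IsConicLagrangian (Λ : Set (Cotangent M)) : Prop where
  subset : Λ ⊆ nonzero M
  conic : ∀ v ∈ Λ, ∀ t : ℝ, 0 < t → scale t v ∈ Λ
  lagrangian : ∀ v ∈ Λ, ∃ (U : Set (Cotangent M)) (f : Plane → Cotangent M),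
    IsOpen U ∧ v ∈ U ∧ ContMDiff 𝓘(ℝ, Plane) cotModel ∞ f ∧
    (∀ y, Function.Injective (mfderiv 𝓘(ℝ, Plane) cotModel f y)) ∧ IsEmbedding f ∧
    range f = Λ ∩ U ∧
    ∀ y (a b : Plane), symplectic (f y) (mfderiv 𝓘(ℝ, Plane) cotModel f y a)
      (mfderiv 𝓘(ℝ, Plane) cotModel f y b) = 0

end

end CotangentFlow

open CotangentFlow

/-!
The proof follows the canonical one-form `λ = ξ dx`. Put `P = p - ν` and `f = |ξ| P`. Since `f` is
homogeneous of degree one, `λ(H_f) = f`, and the Hamiltonian flow of `f` preserves `λ`. Projected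
along the radial field to the unit cosphere bundle, `H_f` becomes a field `Y` (`normField`), which
agrees with `X` on `Σ(ν) = {P = 0}`; its flow multiplies both `λ` and `P` by `exp (-G_t)`, where
`G_t` (`logGrowth`) is the logarithm of the growth of `|ξ|` along the Hamiltonian flow. Everything
rests on this conformal invariance (`IsNormCurve.symbol_mul_exp`, `exists_action_estimate`)
together with the fact that `λ` vanishes on `X` and, by the nondegeneracy of the symplectic form,
on no other direction of `Σ(ν)` (`bijective_der_transCoord`).

*Multipliers.* On `TΣ(ν) / ℝX` the one-form `λ` is injective, so the multiplier of a closed orbit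
of period `T` is `exp (-G_T)` (`HasMultiplier.exists_cycle`): the repelling cycles are exactly
those with `G_T < 0`, along which `|ξ|` grows backwards in time.

*Radial sources.* Near a closed orbit, the distance to it is controlled by the `λ`-action and by
`P` (`IsCycle.exists_infDist_le`). If `G_T < 0`, both contract by the factor `exp (G_{nT})`
under the backward flow, which yields the exponential growth of `|ξ|` and the uniform attraction
(`IsCycle.exists_contraction`, `IsCycle.isBackwardAttracting`). The attracting cycles are treated
by replacing `p` with `-p` and reversing time.

*Existence of the cycles.* The sets `L^±` are nonempty: finitely many closed orbits cannot cover
`Σ(ν)`, and the ω-limit (α-limit) cycle of a trajectory that is not closed is attracting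
(repelling); see `exists_limit_cycles`.

*Lagrangian cones.* The form `λ` vanishes on `X` and on the radial field, hence so does `dλ` on
the cone over an orbit (`symplectic_conePatch`).

To have global estimates without comparing charts, `T*M` is embedded into `W × W*`, for a finite
dimensional space `W`, in such a way that `λ` is the pullback of the canonical one-form of `W ×
W*` (`ExactEmbedding`, `exists_exactEmbedding`). Flows are solved, and distances measured, in this
space; the values of `λ` are replaced there by the finite differences `ExactEmbedding.action`. The
flow on the compactification is written down explicitly in terms of the flow of `Y` and `G_t`
(`isCompactifiedFlow`).
-/

namespace CotangentFlow

noncomputable section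

variable {M : Type*} [TopologicalSpace M] [ChartedSpace Plane M] [IsManifold (𝓡 2) ∞ M]
variable {V : Type*} [NormedAddCommGroup V] [NormedSpace ℝ V]
variable {W : Type*} [NormedAddCommGroup W] [NormedSpace ℝ W]

section

/-! ### Canonical coordinates on the cotangent bundle -/

/-- The model of the tangent spaces of `T*M`, with its points written `(x, ξ)`. -/
abbrev Phase : Type := Plane × CoPlane

/-- The fibre coordinate `ξ` of a covector in the canonical coordinates given by the chart of `M`
at `x₀`. -/
def fiberCoord (x₀ : M) (v : Cotangent M) : CoPlane :=
  (trivializationAt CoPlane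
    (fun x : M => TangentSpace (𝓡 2) x →L[ℝ] Bundle.Trivial M ℝ x) x₀ v).2

theorem fiberCoord_mfderiv (x₀ : M) (v : Cotangent M) (hv : v.1 ∈ (chartAt Plane x₀).source)
    (w : TangentSpace (𝓡 2) v.1) :
    fiberCoord x₀ v (mfderiv (𝓡 2) 𝓘(ℝ, Plane) (extChartAt (𝓡 2) x₀) v.1 w) = v.2 w := by
  rw [fiberCoord, hom_trivializationAt_apply,
    ← TangentBundle.continuousLinearMapAt_trivializationAt (I := 𝓡 2) hv]
  simp only [ContinuousLinearMap.inCoordinates, Bundle.Trivial.fiberBundle_trivializationAt',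
    Bundle.Trivial.continuousLinearMapAt_trivialization, ContinuousLinearMap.id_comp]
  change v.2 ((trivializationAt Plane (TangentSpace (𝓡 2)) x₀).symmL ℝ v.1
    ((trivializationAt Plane (TangentSpace (𝓡 2)) x₀).continuousLinearMapAt ℝ v.1 w)) = v.2 w
  rw [Bundle.Trivialization.symmL_continuousLinearMapAt]
  simpa using hv

theorem contMDiffAt_fiberCoord (x₀ : M) {v : Cotangent M}
    (hv : v.1 ∈ (chartAt Plane x₀).source) :
    ContMDiffAt cotModel 𝓘(ℝ, CoPlane) ∞ (fiberCoord x₀) v := by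
  let e := trivializationAt CoPlane
    (fun x : M => TangentSpace (𝓡 2) x →L[ℝ] Bundle.Trivial M ℝ x) x₀
  have hmem : v ∈ e.source := by
    rw [e.mem_source]
    simpa [e] using hv
  exact ((e.contMDiffOn (IB := 𝓡 2) (n := ∞) v hmem).contMDiffAt
    (e.open_source.mem_nhds hmem)).snd

theorem extChartAt_cotangent (v u : Cotangent M) :
    extChartAt cotModel v u =
      (extChartAt (𝓡 2) v.1 (trivializationAt CoPlane
        (fun x : M => TangentSpace (𝓡 2) x →L[ℝ] Bundle.Trivial M ℝ x) v.1 u).1,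
        fiberCoord v.1 u) := by
  rw [FiberBundle.extChartAt]
  rfl

theorem extChartAt_cotangent_fst (v u : Cotangent M) :
    (extChartAt cotModel v u).1 = extChartAt (𝓡 2) v.1 u.1 := by
  rw [extChartAt_cotangent]
  rfl

theorem extChartAt_cotangent_snd (v u : Cotangent M) :
    (extChartAt cotModel v u).2 = fiberCoord v.1 u := by
  rw [extChartAt_cotangent]

theorem extChartAt_cotangent_symm_proj (v : Cotangent M) {y : Phase}
    (hy : y ∈ (extChartAt cotModel v).target) :
    ((extChartAt cotModel v).symm y).1 = (extChartAt (𝓡 2) v.1).symm y.1 := by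
  rw [FiberBundle.extChartAt] at hy ⊢
  exact (trivializationAt CoPlane
    (fun x : M => TangentSpace (𝓡 2) x →L[ℝ] Bundle.Trivial M ℝ x) v.1).proj_symm_apply hy.2

theorem mem_extChartAt_cotangent_source (v u : Cotangent M) :
    u ∈ (extChartAt cotModel v).source ↔ u.1 ∈ (chartAt Plane v.1).source := by
  rw [FiberBundle.extChartAt]
  simp only [mfld_simps]
  aesop

/-- The differential of a function on `T*M`, on the model of the tangent space. -/
def der (h : Cotangent M → V) (v : Cotangent M) : Phase →L[ℝ] V :=
  mfderiv cotModel 𝓘(ℝ, V) h v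

/-- A function on `T*M` read in the canonical coordinates centred at `v`. -/
def loc (v : Cotangent M) (h : Cotangent M → V) : Phase → V :=
  h ∘ (extChartAt cotModel v).symm

/-- The differential at `u` of the canonical coordinates centred at `v`. -/
def coordDer (v u : Cotangent M) : Phase →L[ℝ] Phase :=
  mfderiv cotModel 𝓘(ℝ, Phase) (extChartAt cotModel v) u

theorem coordDer_surjective {v u : Cotangent M} (hu : u ∈ (extChartAt cotModel v).source) :
    Function.Surjective (coordDer v u) := by
  have := (isInvertible_mfderiv_extChartAt (I := cotModel) hu).bijective
  exact this.2

theorem contDiffAt_loc {n : ℕ∞} {v u : Cotangent M} (hu : u ∈ (extChartAt cotModel v).source)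
    {h : Cotangent M → V} (hh : ContMDiffAt cotModel 𝓘(ℝ, V) n h u) :
    ContDiffAt ℝ n (loc v h) (extChartAt cotModel v u) := by
  have h1 : ContMDiffAt 𝓘(ℝ, Phase) cotModel ∞ (extChartAt cotModel v).symm
      (extChartAt cotModel v u) := by
    have := contMDiffOn_extChartAt_symm (I := cotModel) (n := ∞) v
    exact this.contMDiffAt ((isOpen_extChartAt_target v).mem_nhds
      ((extChartAt cotModel v).map_source hu))
  have h2 : ContMDiffAt cotModel 𝓘(ℝ, V) n h
      ((extChartAt cotModel v).symm (extChartAt cotModel v u)) := by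
    rwa [(extChartAt cotModel v).left_inv hu]
  exact (h2.comp _ (h1.of_le (by exact_mod_cast le_top))).contDiffAt

omit [NormedAddCommGroup V] [NormedSpace ℝ V] in
theorem loc_extChartAt {v u : Cotangent M} (hu : u ∈ (extChartAt cotModel v).source)
    (h : Cotangent M → V) : loc v h (extChartAt cotModel v u) = h u := by
  simp only [loc, Function.comp_apply, (extChartAt cotModel v).left_inv hu]

theorem extChartAt_cotangent_source_mem_nhds {v u : Cotangent M}
    (hu : u ∈ (extChartAt cotModel v).source) : (extChartAt cotModel v).source ∈ 𝓝 u :=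
  (isOpen_extChartAt_source v).mem_nhds hu

theorem der_eq_comp {v u : Cotangent M} (hu : u ∈ (extChartAt cotModel v).source)
    {h : Cotangent M → V} (hh : ContMDiffAt cotModel 𝓘(ℝ, V) 1 h u) :
    der h u = (fderiv ℝ (loc v h) (extChartAt cotModel v u)).comp (coordDer v u) := by
  have h1 : HasMFDerivAt cotModel 𝓘(ℝ, Phase) (extChartAt cotModel v) u (coordDer v u) :=
    (mdifferentiableAt_extChartAt (by simpa using hu)).hasMFDerivAt
  have h2 : HasFDerivAt (loc v h) (fderiv ℝ (loc v h) (extChartAt cotModel v u))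
      (extChartAt cotModel v u) :=
    ((contDiffAt_loc (n := 1) hu hh).differentiableAt (by simp)).hasFDerivAt
  have h3 := h2.hasMFDerivAt.comp u h1
  have h4 : (loc v h) ∘ (extChartAt cotModel v) =ᶠ[𝓝 u] h := by
    filter_upwards [extChartAt_cotangent_source_mem_nhds hu] with z hz
    exact loc_extChartAt hz h
  exact (h3.congr_of_eventuallyEq h4.symm).mfderiv

theorem coordDer_self (v : Cotangent M) (w : Phase) : coordDer v v w = w := by
  have h := tangentCoordChange_self (I := cotModel) (x := v) (z := v)
    (v := w) (mem_extChartAt_source v)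
  have h2 := TangentBundle.continuousLinearMapAt_trivializationAt (I := cotModel) (x₀ := v)
    (x := v) (mem_chart_source _ v)
  have h3 := TangentBundle.continuousLinearMapAt_trivializationAt_eq_core (I := cotModel) (b₀ := v)
    (b := v) (mem_chart_source _ v)
  have h4 := (h2.symm.trans h3)
  change (mfderiv cotModel 𝓘(ℝ, Phase) (extChartAt cotModel v) v : Phase →L[ℝ] Phase) w = w
  exact (congrArg (fun L : Phase →L[ℝ] Phase => L w) h4).trans h

theorem der_eq_fderiv_loc (v : Cotangent M)
    {h : Cotangent M → V} (hh : ContMDiffAt cotModel 𝓘(ℝ, V) 1 h v) :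
    der h v = fderiv ℝ (loc v h) (extChartAt cotModel v v) := by
  rw [der_eq_comp (mem_extChartAt_source v) hh]
  exact ContinuousLinearMap.ext fun w => by rw [ContinuousLinearMap.comp_apply, coordDer_self]

theorem hasFDerivAt_loc (v : Cotangent M)
    {h : Cotangent M → V} (hh : ContMDiffAt cotModel 𝓘(ℝ, V) 1 h v) :
    HasFDerivAt (loc v h) (der h v) (extChartAt cotModel v v) := by
  rw [der_eq_fderiv_loc v hh]
  exact ((contDiffAt_loc (n := 1) (mem_extChartAt_source v) hh).differentiableAt
    (by simp)).hasFDerivAt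

theorem der_eq_of_hasFDerivAt_loc {v : Cotangent M}
    {h : Cotangent M → V} (hh : ContMDiffAt cotModel 𝓘(ℝ, V) 1 h v) {L : Phase →L[ℝ] V}
    (hL : HasFDerivAt (loc v h) L (extChartAt cotModel v v)) : der h v = L :=
  (hasFDerivAt_loc v hh).unique hL

omit [NormedAddCommGroup V] [NormedSpace ℝ V] in
theorem loc_self (v : Cotangent M) (h : Cotangent M → V) :
    loc v h (extChartAt cotModel v v) = h v :=
  loc_extChartAt (mem_extChartAt_source v) h

theorem der_prodMk {V' : Type*} [NormedAddCommGroup V'] [NormedSpace ℝ V'] {v : Cotangent M}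
    {h : Cotangent M → V} {h' : Cotangent M → V'}
    (hh : ContMDiffAt cotModel 𝓘(ℝ, V) 1 h v) (hh' : ContMDiffAt cotModel 𝓘(ℝ, V') 1 h' v) :
    der (fun u => (h u, h' u)) v = (der h v).prod (der h' v) :=
  der_eq_of_hasFDerivAt_loc (hh.prodMk_space hh')
    ((hasFDerivAt_loc v hh).prodMk (hasFDerivAt_loc v hh'))

end

section

/-! ### Exact embeddings into a linear symplectic space -/

/-- An exact embedding of `T*M` into `W × W*`: an injective smooth map `pos : M → W` and a smooth,
fibrewise homogeneous map `mom : T*M → W*` with `mom(x, ξ) ∘ d pos = ξ`. The last condition says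
that the canonical one-form `ξ dx` of `T*M` is the pullback of the canonical one-form of
`W × W* = T*W` by the map `emb = (pos, mom)`. -/
structure ExactEmbedding (M : Type*) [TopologicalSpace M] [ChartedSpace Plane M]
    [IsManifold (𝓡 2) ∞ M] (W : Type*) [NormedAddCommGroup W] [NormedSpace ℝ W] where
  pos : M → W
  mom : Cotangent M → W →L[ℝ] ℝ
  contMDiff_pos : ContMDiff (𝓡 2) 𝓘(ℝ, W) ∞ pos
  injective_pos : Function.Injective pos
  contMDiff_mom : ContMDiff cotModel 𝓘(ℝ, W →L[ℝ] ℝ) ∞ mom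
  mom_scale : ∀ (t : ℝ) (v : Cotangent M), mom (scale t v) = t • mom v
  mom_mfderiv : ∀ (v : Cotangent M) (w : TangentSpace (𝓡 2) v.1),
    mom v (mfderiv (𝓡 2) 𝓘(ℝ, W) pos v.1 w) = v.2 w

namespace ExactEmbedding

variable (J : ExactEmbedding M W)

/-- The position component of an exact embedding, as a function on `T*M`. -/
def base (v : Cotangent M) : W := J.pos v.1

/-- The embedding `T*M → W × W*`. -/
def emb (v : Cotangent M) : W × (W →L[ℝ] ℝ) := (J.base v, J.mom v)

theorem contMDiff_base : ContMDiff cotModel 𝓘(ℝ, W) ∞ J.base :=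
  J.contMDiff_pos.comp (Bundle.contMDiff_proj _)

theorem contMDiff_emb : ContMDiff cotModel 𝓘(ℝ, W × (W →L[ℝ] ℝ)) ∞ J.emb :=
  J.contMDiff_base.prodMk_space J.contMDiff_mom

theorem loc_base (v : Cotangent M) {y : Phase} (hy : y ∈ (extChartAt cotModel v).target) :
    loc v J.base y = (J.pos ∘ (extChartAt (𝓡 2) v.1).symm) y.1 := by
  simp only [loc, base, Function.comp_apply, extChartAt_cotangent_symm_proj v hy]

theorem contDiffAt_pos (v : Cotangent M) {y : Phase} (hy : y ∈ (extChartAt cotModel v).target) :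
    ContDiffAt ℝ ∞ (J.pos ∘ (extChartAt (𝓡 2) v.1).symm) y.1 := by
  have hy1 : y.1 ∈ (extChartAt (𝓡 2) v.1).target := by
    rw [FiberBundle.extChartAt_target] at hy
    exact hy.1.1
  have h1 : ContMDiffAt 𝓘(ℝ, Plane) (𝓡 2) ∞ (extChartAt (𝓡 2) v.1).symm y.1 :=
    (contMDiffOn_extChartAt_symm (I := 𝓡 2) (n := ∞) v.1).contMDiffAt
      ((isOpen_extChartAt_target v.1).mem_nhds hy1)
  exact ((J.contMDiff_pos _).comp _ h1).contDiffAt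

theorem loc_mom (v : Cotangent M) {y : Phase} (hy : y ∈ (extChartAt cotModel v).target)
    (b : Plane) :
    loc v J.mom y (fderiv ℝ (J.pos ∘ (extChartAt (𝓡 2) v.1).symm) y.1 b) = y.2 b := by
  obtain ⟨u, hu, rfl⟩ : ∃ u ∈ (extChartAt cotModel v).source, extChartAt cotModel v u = y :=
    ⟨_, (extChartAt cotModel v).map_target hy, (extChartAt cotModel v).right_inv hy⟩
  have hu1 : u.1 ∈ (chartAt Plane v.1).source := (mem_extChartAt_cotangent_source v u).1 hu
  have hu2 : u.1 ∈ (extChartAt (𝓡 2) v.1).source := by rwa [extChartAt_source]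
  rw [loc_extChartAt hu, extChartAt_cotangent_snd]
  have hpos := (J.contDiffAt_pos v hy).differentiableAt (by simp)
  rw [extChartAt_cotangent_fst] at hpos ⊢
  have h1 : HasMFDerivAt (𝓡 2) 𝓘(ℝ, Plane) (extChartAt (𝓡 2) v.1) u.1
      (mfderiv (𝓡 2) 𝓘(ℝ, Plane) (extChartAt (𝓡 2) v.1) u.1) :=
    (mdifferentiableAt_extChartAt hu1).hasMFDerivAt
  have h3 := hpos.hasFDerivAt.hasMFDerivAt.comp u.1 h1
  have h4 : (J.pos ∘ (extChartAt (𝓡 2) v.1).symm) ∘ (extChartAt (𝓡 2) v.1) =ᶠ[𝓝 u.1] J.pos := by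
    filter_upwards [(isOpen_extChartAt_source (I := 𝓡 2) v.1).mem_nhds hu2] with z hz
    simp only [Function.comp_apply, (extChartAt (𝓡 2) v.1).left_inv hz]
  have h5 := (h3.congr_of_eventuallyEq h4.symm).mfderiv
  obtain ⟨w, rfl⟩ := (isInvertible_mfderiv_extChartAt (I := 𝓡 2) hu2).bijective.2 b
  have h6 := congrArg (fun L : Plane →L[ℝ] W => J.mom u (L w)) h5
  exact (h6.symm.trans (J.mom_mfderiv u w)).trans (fiberCoord_mfderiv v.1 u hu1 w).symm

/-- In canonical coordinates the standard symplectic form of `W × W*` pulls back to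
`∑ dξ_j ∧ dx_j`. -/
theorem symplectic_loc (v : Cotangent M) {y : Phase} (hy : y ∈ (extChartAt cotModel v).target)
    (w w' : Phase) :
    fderiv ℝ (loc v J.mom) y w (fderiv ℝ (loc v J.base) y w') -
      fderiv ℝ (loc v J.mom) y w' (fderiv ℝ (loc v J.base) y w) = w.2 w'.1 - w'.2 w.1 := by
  set e := J.pos ∘ (extChartAt (𝓡 2) v.1).symm with he
  have hnhds : (extChartAt cotModel v).target ∈ 𝓝 y := (isOpen_extChartAt_target v).mem_nhds hy
  obtain ⟨u, hu, rfl⟩ : ∃ u ∈ (extChartAt cotModel v).source, extChartAt cotModel v u = y :=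
    ⟨_, (extChartAt cotModel v).map_target hy, (extChartAt cotModel v).right_inv hy⟩
  set y := extChartAt cotModel v u
  have hmom : DifferentiableAt ℝ (loc v J.mom) y :=
    (contDiffAt_loc (n := 1) hu ((J.contMDiff_mom u).of_le (by simp))).differentiableAt (by simp)
  have hec : ContDiffAt ℝ ∞ e y.1 := J.contDiffAt_pos v hy
  have hed : DifferentiableAt ℝ (fderiv ℝ e) y.1 :=
    (hec.fderiv_right (m := 1) (by norm_cast)).differentiableAt (by simp)
  have hbase : ∀ z : Phase, fderiv ℝ (loc v J.base) y z = fderiv ℝ e y.1 z.1 := by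
    intro z
    have h1 : loc v J.base =ᶠ[𝓝 y] e ∘ Prod.fst := by
      filter_upwards [hnhds] with z hz using J.loc_base v hz
    have h2 : HasFDerivAt (e ∘ Prod.fst)
        ((fderiv ℝ e y.1).comp (ContinuousLinearMap.fst ℝ Plane CoPlane)) y :=
      (hec.differentiableAt (by simp)).hasFDerivAt.comp y hasFDerivAt_fst
    rw [h1.fderiv_eq, h2.fderiv]
    rfl
  have hid : ∀ z : Phase, ∀ b : Plane, fderiv ℝ (loc v J.mom) y z (fderiv ℝ e y.1 b) +
      loc v J.mom y (fderiv ℝ (fderiv ℝ e) y.1 z.1 b) = z.2 b := by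
    intro z b
    have h1 : HasFDerivAt (fun y : Phase => fderiv ℝ e y.1 b)
        (((ContinuousLinearMap.apply ℝ W b).comp (fderiv ℝ (fderiv ℝ e) y.1)).comp
          (ContinuousLinearMap.fst ℝ Plane CoPlane)) y := by
      have := (ContinuousLinearMap.apply ℝ W b).hasFDerivAt.comp y
        (hed.hasFDerivAt.comp y (hasFDerivAt_fst (𝕜 := ℝ) (p := y)))
      exact this
    have h2 := hmom.hasFDerivAt.clm_apply h1
    have h3 : (fun y => loc v J.mom y (fderiv ℝ e y.1 b)) =ᶠ[𝓝 y] fun y : Phase => y.2 b := by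
      filter_upwards [hnhds] with z hz using J.loc_mom v hz b
    have h4 : HasFDerivAt (fun y : Phase => y.2 b) ((ContinuousLinearMap.apply ℝ ℝ b).comp
        (ContinuousLinearMap.snd ℝ Plane CoPlane)) y :=
      (ContinuousLinearMap.apply ℝ ℝ b).hasFDerivAt.comp y hasFDerivAt_snd
    have h5 := congrArg (fun L : Phase →L[ℝ] ℝ => L z)
      ((h2.congr_of_eventuallyEq h3.symm).unique h4)
    simp only [add_apply, ContinuousLinearMap.comp_apply,
      ContinuousLinearMap.flip_apply, ContinuousLinearMap.apply_apply,
      ContinuousLinearMap.coe_fst', ContinuousLinearMap.coe_snd'] at h5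
    linarith
  have hsymm : fderiv ℝ (fderiv ℝ e) y.1 w.1 w'.1 = fderiv ℝ (fderiv ℝ e) y.1 w'.1 w.1 :=
    (hec.isSymmSndFDerivAt (by simp; norm_cast)) w.1 w'.1
  have e1 := hid w w'.1
  have e2 := hid w' w.1
  rw [hbase, hbase]
  rw [hsymm] at e1
  linarith

theorem symplectic_eq (v : Cotangent M) (w w' : Phase) :
    w.2 w'.1 - w'.2 w.1 = der J.mom v w (der J.base v w') - der J.mom v w' (der J.base v w) := by
  rw [der_eq_fderiv_loc v ((J.contMDiff_mom v).of_le (by simp)),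
    der_eq_fderiv_loc v ((J.contMDiff_base v).of_le (by simp))]
  exact (J.symplectic_loc v (mem_extChartAt_target v) w w').symm

end ExactEmbedding

/-- The Hamiltonian vector of a covector of the model `Plane × CoPlane`. -/
def flatHam : (Phase →L[ℝ] ℝ) →L[ℝ] Phase :=
  LinearMap.toContinuousLinearMap
  { toFun := fun D : Phase →L[ℝ] ℝ =>
      ((∑ j : Fin 2, D (0, EuclideanSpace.proj j) • EuclideanSpace.single j (1 : ℝ),
      -(D.comp (ContinuousLinearMap.inl ℝ Plane CoPlane))) : Phase)
    map_add' := fun D D' => by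
      ext : 1
      · simp [add_smul, Finset.sum_add_distrib]
      · simp [ContinuousLinearMap.add_comp]; abel
    map_smul' := fun c D => by
      ext : 1
      · simp [mul_smul]
      · simp [ContinuousLinearMap.smul_comp] }

theorem hamiltonianField_eq (f : Cotangent M → ℝ) (v : Cotangent M) :
    hamiltonianField f v = flatHam (der f v) := rfl

theorem flatHam_spec (D : Phase →L[ℝ] ℝ) (w : Phase) :
    w.2 (flatHam D).1 - (flatHam D).2 w.1 = D w := by
  obtain ⟨a, α⟩ := w
  change α (∑ j : Fin 2, D (0, EuclideanSpace.proj j) • EuclideanSpace.single j (1 : ℝ))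
    - (-(D.comp (ContinuousLinearMap.inl ℝ Plane CoPlane))) a = D (a, α)
  have hα : α = ∑ j : Fin 2, α (EuclideanSpace.single j (1 : ℝ)) •
      (EuclideanSpace.proj j : CoPlane) := by
    ext u
    have hu : u = ∑ j : Fin 2, u j • EuclideanSpace.single j (1 : ℝ) := by
      ext i
      fin_cases i <;> simp [Fin.sum_univ_two]
    conv_lhs => rw [hu]
    simp [Fin.sum_univ_two, mul_comm]
  have h1 : D (0, α) = ∑ j : Fin 2, α (EuclideanSpace.single j (1 : ℝ)) *
      D (0, EuclideanSpace.proj j) := by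
    conv_lhs => rw [hα]
    have := map_sum (D.comp (ContinuousLinearMap.inr ℝ Plane CoPlane))
      (fun j : Fin 2 => α (EuclideanSpace.single j (1 : ℝ)) •
        (EuclideanSpace.proj j : CoPlane)) Finset.univ
    simpa only [ContinuousLinearMap.comp_apply, ContinuousLinearMap.inr_apply, map_smul,
      smul_eq_mul] using this
  have h2 : D (a, α) = D (a, 0) + D (0, α) := by
    rw [← map_add]; simp
  rw [h2, h1]
  simp [Fin.sum_univ_two]
  ring

theorem phase_ext {z z' : Phase} (h : ∀ w : Phase, w.2 z.1 - z.2 w.1 = w.2 z'.1 - z'.2 w.1) :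
    z = z' := by
  have h1 : z.1 = z'.1 := by
    ext j
    simpa using h (0, EuclideanSpace.proj j)
  have h2 : z.2 = z'.2 := by
    ext b
    simpa using h (b, 0)
  exact Prod.ext h1 h2

namespace ExactEmbedding

variable (J : ExactEmbedding M W)

include J in
/-- Changes of canonical coordinates are symplectic: the Hamiltonian field of `f` is given by the
Hamiltonian vector of `df` in all canonical coordinates. -/
theorem coordDer_hamiltonianField {v u : Cotangent M} (hu : u ∈ (extChartAt cotModel v).source)
    {f : Cotangent M → ℝ} (hf : ContMDiffAt cotModel 𝓘(ℝ, ℝ) 1 f u) :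
    coordDer v u (hamiltonianField f u) =
      flatHam (fderiv ℝ (loc v f) (extChartAt cotModel v u)) := by
  apply phase_ext
  intro w'
  obtain ⟨w, rfl⟩ := coordDer_surjective hu w'
  rw [flatHam_spec, ← ContinuousLinearMap.comp_apply, ← der_eq_comp hu hf]
  have hm := der_eq_comp hu ((J.contMDiff_mom u).of_le (by simp))
  have hb := der_eq_comp hu ((J.contMDiff_base u).of_le (by simp))
  rw [← J.symplectic_loc v ((extChartAt cotModel v).map_source hu)]
  have h1 := J.symplectic_eq u w (flatHam (der f u))
  rw [hm, hb] at h1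
  exact h1.symm.trans (flatHam_spec (der f u) w)

theorem injective_der_emb (v : Cotangent M) : Function.Injective (der J.emb v) := by
  have hd : ∀ w, der J.emb v w = (der J.base v w, der J.mom v w) := by
    intro w
    exact congrArg (fun L : Phase →L[ℝ] W × (W →L[ℝ] ℝ) => L w)
      (der_prodMk ((J.contMDiff_base v).of_le (by simp)) ((J.contMDiff_mom v).of_le (by simp)))
  rw [injective_iff_map_eq_zero]
  intro w hw
  rw [hd] at hw
  have h0 : ∀ w' : Phase, w'.2 w.1 - w.2 w'.1 = 0 := by
    intro w'
    rw [J.symplectic_eq v, show der J.base v w = 0 from (Prod.ext_iff.1 hw).1,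
      show der J.mom v w = 0 from (Prod.ext_iff.1 hw).2]
    simp
  apply phase_ext (z := w) (z' := 0)
  intro w'
  rw [h0 w']
  simp

theorem injective_emb : Function.Injective J.emb := by
  intro v u h
  obtain ⟨h1, h2⟩ := Prod.ext_iff.1 h
  obtain ⟨x, ξ⟩ := v
  obtain ⟨x', ξ'⟩ := u
  obtain rfl : x = x' := J.injective_pos h1
  have h3 : ξ = ξ' := by
    refine ContinuousLinearMap.ext fun w => ?_
    have e1 := J.mom_mfderiv ⟨x, ξ⟩ w
    have e2 := J.mom_mfderiv ⟨x, ξ'⟩ w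
    exact (e1.symm.trans (congrArg (fun L : W →L[ℝ] ℝ =>
      L (mfderiv (𝓡 2) 𝓘(ℝ, W) J.pos x w)) h2)).trans e2
  rw [h3]

end ExactEmbedding

end

section

/-! ### Poisson brackets -/

theorem contMDiffAt_of_loc {n : ℕ∞} {v u : Cotangent M} (hu : u ∈ (extChartAt cotModel v).source)
    {h : Cotangent M → V} {H : Phase → V} (hH : ContDiffAt ℝ n H (extChartAt cotModel v u))
    (he : ∀ᶠ z in 𝓝 u, h z = H (extChartAt cotModel v z)) :
    ContMDiffAt cotModel 𝓘(ℝ, V) n h u := by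
  have h1 : ContMDiffAt cotModel 𝓘(ℝ, Phase) n (extChartAt cotModel v) u :=
    (contMDiffAt_extChartAt' (n := ∞) (by simpa using hu)).of_le (by exact_mod_cast le_top)
  exact ((hH.contMDiffAt).comp u h1).congr_of_eventuallyEq he

theorem eventually_contMDiffAt_one {h : Cotangent M → V} {u : Cotangent M}
    (hh : ContMDiffAt cotModel 𝓘(ℝ, V) ∞ h u) :
    ∀ᶠ z in 𝓝 u, ContMDiffAt cotModel 𝓘(ℝ, V) 1 h z :=
  (contMDiffAt_iff_contMDiffAt_nhds (by simp)).1 (hh.of_le (by simp))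

/-- The derivative of `h` along the Hamiltonian field of `f`. -/
def bracket (f : Cotangent M → ℝ) (h : Cotangent M → V) (v : Cotangent M) : V :=
  der h v (flatHam (der f v))

namespace ExactEmbedding

variable (J : ExactEmbedding M W)

include J in
theorem bracket_eq_loc {v u : Cotangent M} (hu : u ∈ (extChartAt cotModel v).source)
    {f : Cotangent M → ℝ} {h : Cotangent M → V} (hf : ContMDiffAt cotModel 𝓘(ℝ, ℝ) 1 f u)
    (hh : ContMDiffAt cotModel 𝓘(ℝ, V) 1 h u) :
    bracket f h u = fderiv ℝ (loc v h) (extChartAt cotModel v u)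
      (flatHam (fderiv ℝ (loc v f) (extChartAt cotModel v u))) := by
  rw [← J.coordDer_hamiltonianField hu hf, bracket, der_eq_comp hu hh]
  rfl

include J in
theorem contMDiffAt_bracket {u : Cotangent M} {f : Cotangent M → ℝ} {h : Cotangent M → V}
    (hf : ContMDiffAt cotModel 𝓘(ℝ, ℝ) ∞ f u) (hh : ContMDiffAt cotModel 𝓘(ℝ, V) ∞ h u) :
    ContMDiffAt cotModel 𝓘(ℝ, V) ∞ (bracket f h) u := by
  have hu := mem_extChartAt_source (I := cotModel) u
  have h1 := (contDiffAt_loc (n := ⊤) hu hf).fderiv_right (m := ∞) (by simp)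
  have h2 := (contDiffAt_loc (n := ⊤) hu hh).fderiv_right (m := ∞) (by simp)
  have h3 : ContDiff ℝ ∞ (fun D : Phase →L[ℝ] ℝ => flatHam D) := by fun_prop
  refine contMDiffAt_of_loc (n := ⊤) hu (H := fun y => fderiv ℝ (loc u h) y
      (flatHam (fderiv ℝ (loc u f) y)))
    (h2.clm_apply (h3.contDiffAt.comp _ h1)) ?_
  filter_upwards [eventually_contMDiffAt_one hf, eventually_contMDiffAt_one hh,
    extChartAt_cotangent_source_mem_nhds hu] with z hz1 hz2 hz
  exact J.bracket_eq_loc hz hz1 hz2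

end ExactEmbedding

/-! ### Immersions -/

section Immersion

variable {Y : Type*} [NormedAddCommGroup Y] [NormedSpace ℝ Y]

/-- An immersion has a smooth local left inverse, here with values in a chart. -/
theorem exists_retraction [FiniteDimensional ℝ Y] {G : Cotangent M → Y} {z₀ : Cotangent M}
    (hG : ContMDiffAt cotModel 𝓘(ℝ, Y) ∞ G z₀) (hinj : Function.Injective (der G z₀)) :
    ∃ r : Y → Phase, ContDiffAt ℝ ∞ r (G z₀) ∧
      ∀ᶠ u in 𝓝 z₀, r (G u) = extChartAt cotModel z₀ u := by
  have hz := mem_extChartAt_source (I := cotModel) z₀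
  obtain ⟨P, hP⟩ := ContinuousLinearMap.HasLeftInverse.of_injective_of_finiteDimensional hinj
  have hd := hasFDerivAt_loc z₀ (hG.of_le (m := 1) (by simp))
  have hc : ContDiffAt ℝ ∞ (P ∘ loc z₀ G) (extChartAt cotModel z₀ z₀) :=
    P.contDiff.contDiffAt.comp _ (contDiffAt_loc (n := ⊤) hz hG)
  have hd2 : HasFDerivAt (P ∘ loc z₀ G)
      ((ContinuousLinearEquiv.refl ℝ Phase : Phase ≃L[ℝ] Phase) : Phase →L[ℝ] Phase)
      (extChartAt cotModel z₀ z₀) := by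
    have h1 := P.hasFDerivAt.comp _ hd
    have h2 : P.comp (der G z₀) =
        ((ContinuousLinearEquiv.refl ℝ Phase : Phase ≃L[ℝ] Phase) : Phase →L[ℝ] Phase) :=
      ContinuousLinearMap.ext hP
    rwa [h2] at h1
  have hinv := hc.to_localInverse hd2 (by simp)
  have hstrict := hc.hasStrictFDerivAt' hd2 (by simp)
  refine ⟨hc.localInverse hd2 (by simp) ∘ P, ?_, ?_⟩
  · refine ContDiffAt.comp _ ?_ P.contDiff.contDiffAt
    simpa only [Function.comp_apply, loc_self] using hinv
  · have h1 : ∀ᶠ y in 𝓝 (extChartAt cotModel z₀ z₀),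
        hc.localInverse hd2 (by simp) ((P ∘ loc z₀ G) y) = y := hstrict.eventually_left_inverse
    have h2 := (continuousAt_extChartAt (I := cotModel) z₀).eventually h1
    filter_upwards [h2, extChartAt_cotangent_source_mem_nhds hz] with u hu1 hu2
    simpa only [Function.comp_apply, loc_extChartAt hu2] using hu1

/-- A local diffeomorphism has a smooth local inverse, here with values in a chart. -/
theorem exists_inverse [CompleteSpace Y] {G : Cotangent M → Y} {z₀ : Cotangent M}
    (hG : ContMDiffAt cotModel 𝓘(ℝ, Y) ∞ G z₀) (L : Phase ≃L[ℝ] Y)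
    (hL : der G z₀ = L) :
    ∃ r : Y → Phase, HasFDerivAt r (L.symm : Y →L[ℝ] Phase) (G z₀) ∧
      r (G z₀) = extChartAt cotModel z₀ z₀ ∧
      ∀ᶠ y in 𝓝 (G z₀), G ((extChartAt cotModel z₀).symm (r y)) = y := by
  have hz := mem_extChartAt_source (I := cotModel) z₀
  have hd := hasFDerivAt_loc z₀ (hG.of_le (m := 1) (by simp))
  rw [hL] at hd
  have hs : HasStrictFDerivAt (loc z₀ G) (L : Phase →L[ℝ] Y) (extChartAt cotModel z₀ z₀) :=
    (contDiffAt_loc (n := ⊤) hz hG).hasStrictFDerivAt' hd (by simp)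
  have h1 := hs.to_localInverse.hasFDerivAt
  have h2 := hs.eventually_right_inverse
  have h3 := hs.localInverse_apply_image
  rw [loc_self] at h1 h2 h3
  exact ⟨_, h1, h3, h2⟩

theorem eventually_norm_sub_le_of_immersion [FiniteDimensional ℝ Y] {G : Cotangent M → Y}
    {z₀ : Cotangent M} (hG : ContMDiffAt cotModel 𝓘(ℝ, Y) ∞ G z₀)
    (hinj : Function.Injective (der G z₀)) :
    ∃ K : ℝ, 0 ≤ K ∧ ∀ᶠ p : Cotangent M × Cotangent M in 𝓝 (z₀, z₀),
      ‖extChartAt cotModel z₀ p.1 - extChartAt cotModel z₀ p.2‖ ≤ K * ‖G p.1 - G p.2‖ := by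
  obtain ⟨r, hr, hrG⟩ := exists_retraction hG hinj
  obtain ⟨K, s, hs, hK⟩ := (hr.of_le (m := 1) (by simp)).exists_lipschitzOnWith
  have h1 : ∀ᶠ u in 𝓝 z₀, G u ∈ s := hG.continuousAt hs
  have h2 := hrG.and h1
  refine ⟨K, K.2, ?_⟩
  rw [nhds_prod_eq]
  filter_upwards [h2.prod_mk h2] with p hp
  rw [← hp.1.1, ← hp.2.1]
  exact hK.norm_sub_le hp.1.2 hp.2.2

theorem eventually_norm_sub_le {h : Cotangent M → V} {z₀ : Cotangent M}
    (hh : ContMDiffAt cotModel 𝓘(ℝ, V) ∞ h z₀) :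
    ∃ K : ℝ, 0 ≤ K ∧ ∀ᶠ p : Cotangent M × Cotangent M in 𝓝 (z₀, z₀),
      ‖h p.1 - h p.2‖ ≤ K * ‖extChartAt cotModel z₀ p.1 - extChartAt cotModel z₀ p.2‖ := by
  have hz := mem_extChartAt_source (I := cotModel) z₀
  obtain ⟨K, s, hs, hK⟩ :=
    ((contDiffAt_loc (n := ⊤) hz hh).of_le (m := 1) (by simp)).exists_lipschitzOnWith
  have h1 : ∀ᶠ u in 𝓝 z₀, extChartAt cotModel z₀ u ∈ s := continuousAt_extChartAt z₀ hs
  have h2 := h1.and (extChartAt_cotangent_source_mem_nhds hz)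
  refine ⟨K, K.2, ?_⟩
  rw [nhds_prod_eq]
  filter_upwards [h2.prod_mk h2] with p hp
  rw [← loc_extChartAt hp.1.2 h, ← loc_extChartAt hp.2.2 h]
  exact hK.norm_sub_le hp.1.1 hp.2.1

theorem eventually_taylor_le {E : Type*} [NormedAddCommGroup E] [NormedSpace ℝ E] {F : E → V}
    {y₀ : E} (hF : ContDiffAt ℝ 2 F y₀) :
    ∃ K : ℝ, 0 ≤ K ∧ ∀ᶠ p : E × E in 𝓝 (y₀, y₀),
      ‖F p.2 - F p.1 - fderiv ℝ F p.1 (p.2 - p.1)‖ ≤ K * ‖p.2 - p.1‖ ^ 2 := by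
  obtain ⟨K, s, hs, hK⟩ := (hF.fderiv_right (m := 1) (by norm_num)).exists_lipschitzOnWith
  have hd : ∀ᶠ y in 𝓝 y₀, DifferentiableAt ℝ F y :=
    (hF.of_le (m := 1) (by norm_num)).eventually (by simp) |>.mono
      fun y hy => hy.differentiableAt (by simp)
  obtain ⟨ε, hε, hball⟩ := Metric.mem_nhds_iff.1 (inter_mem hs hd)
  refine ⟨K, K.2, ?_⟩
  rw [nhds_prod_eq]
  filter_upwards [prod_mem_prod (Metric.ball_mem_nhds y₀ hε) (Metric.ball_mem_nhds y₀ hε)]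
    with p hp
  have hseg : segment ℝ p.1 p.2 ⊆ Metric.ball y₀ ε :=
    (convex_ball y₀ ε).segment_subset hp.1 hp.2
  have := (convex_segment p.1 p.2).norm_image_sub_le_of_norm_fderiv_le' (𝕜 := ℝ) (f := F)
    (φ := fderiv ℝ F p.1) (C := K * ‖p.2 - p.1‖) (fun y hy => (hball (hseg hy)).2)
    (fun y hy => ?_) (left_mem_segment ℝ p.1 p.2) (right_mem_segment ℝ p.1 p.2)
  · calc _ ≤ K * ‖p.2 - p.1‖ * ‖p.2 - p.1‖ := this
      _ = _ := by ring
  · refine (hK.norm_sub_le (hball (hseg hy)).1 (hball hp.1).1).trans ?_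
    gcongr
    exact norm_sub_le_of_mem_segment hy

/-- If `β` annihilates the differential of `h` at `z`, then `β (h u - h z)` is quadratically
small, uniformly for `z` and `u` close to `z₀`. -/
theorem eventually_abs_le_sq {h : Cotangent M → V} {z₀ : Cotangent M}
    (hh : ContMDiffAt cotModel 𝓘(ℝ, V) ∞ h z₀) :
    ∃ K : ℝ, 0 ≤ K ∧ ∀ᶠ p : Cotangent M × Cotangent M in 𝓝 (z₀, z₀),
      ∀ β : V →L[ℝ] ℝ, (∀ w, β (der h p.1 w) = 0) → |β (h p.2 - h p.1)| ≤
        K * ‖β‖ * ‖extChartAt cotModel z₀ p.1 - extChartAt cotModel z₀ p.2‖ ^ 2 := by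
  have hz := mem_extChartAt_source (I := cotModel) z₀
  obtain ⟨K, hK0, hK⟩ := eventually_taylor_le
    ((contDiffAt_loc (n := ⊤) hz hh).of_le (m := 2) (by norm_cast))
  have h1 : Tendsto (fun p : Cotangent M × Cotangent M =>
      (extChartAt cotModel z₀ p.1, extChartAt cotModel z₀ p.2)) (𝓝 (z₀, z₀))
      (𝓝 (extChartAt cotModel z₀ z₀, extChartAt cotModel z₀ z₀)) := by
    rw [nhds_prod_eq, nhds_prod_eq]
    exact (continuousAt_extChartAt z₀).tendsto.prodMap (continuousAt_extChartAt z₀).tendsto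
  have h2 := (eventually_contMDiffAt_one hh).and (extChartAt_cotangent_source_mem_nhds hz)
  refine ⟨K, hK0, ?_⟩
  have h3 := h2.prod_mk h2
  rw [← nhds_prod_eq] at h3
  filter_upwards [h3, h1.eventually hK] with p hp hp2 β hβ
  rw [loc_extChartAt hp.1.2 h, loc_extChartAt hp.2.2 h] at hp2
  have h4 : β (fderiv ℝ (loc z₀ h) (extChartAt cotModel z₀ p.1)
      (extChartAt cotModel z₀ p.2 - extChartAt cotModel z₀ p.1)) = 0 := by
    obtain ⟨w, hw⟩ := coordDer_surjective hp.1.2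
      (extChartAt cotModel z₀ p.2 - extChartAt cotModel z₀ p.1)
    have := hβ w
    rw [der_eq_comp hp.1.2 hp.1.1, ContinuousLinearMap.comp_apply, hw] at this
    exact this
  have h5 : β (h p.2 - h p.1) = β (h p.2 - h p.1 - fderiv ℝ (loc z₀ h) (extChartAt cotModel z₀ p.1)
      (extChartAt cotModel z₀ p.2 - extChartAt cotModel z₀ p.1)) := by
    rw [map_sub β (h p.2 - h p.1), h4, sub_zero]
  rw [h5, norm_sub_rev (extChartAt cotModel z₀ p.1)]
  calc |β _| ≤ ‖β‖ * _ := β.le_opNorm _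
    _ ≤ ‖β‖ * (K * _) := by gcongr
    _ = _ := by ring

end Immersion

/-! ### Curves in the cotangent bundle -/

theorem hasDerivAt_comp_curve {h : Cotangent M → V} {γ : ℝ → Cotangent M} {t : ℝ} {w : Phase}
    (hh : ContMDiffAt cotModel 𝓘(ℝ, V) 1 h (γ t))
    (hγ : HasMFDerivAt 𝓘(ℝ, ℝ) cotModel γ t
      ((1 : ℝ →L[ℝ] ℝ).smulRight (show TangentSpace cotModel (γ t) from w))) :
    HasDerivAt (h ∘ γ) (der h (γ t) w) t := by
  have h1 : HasFDerivAt (h ∘ γ) ((der h (γ t)).comp ((1 : ℝ →L[ℝ] ℝ).smulRight w)) t :=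
    ((hh.mdifferentiableAt (by simp)).hasMFDerivAt.comp t hγ).hasFDerivAt
  simpa using h1.hasDerivAt

namespace ExactEmbedding

variable [FiniteDimensional ℝ W] (J : ExactEmbedding M W)

theorem hasMFDerivAt_curve {γ : ℝ → Cotangent M} {t : ℝ} {w : Phase} (hc : ContinuousAt γ t)
    (hγ : HasDerivAt (J.emb ∘ γ) (der J.emb (γ t) w) t) :
    HasMFDerivAt 𝓘(ℝ, ℝ) cotModel γ t
      ((1 : ℝ →L[ℝ] ℝ).smulRight (show TangentSpace cotModel (γ t) from w)) := by
  have hJ := J.contMDiff_emb (γ t)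
  obtain ⟨r, hr, hrJ⟩ := exists_retraction hJ (J.injective_der_emb (γ t))
  refine ⟨hc, ?_⟩
  have h1 : HasDerivAt (r ∘ (J.emb ∘ γ)) (fderiv ℝ r (J.emb (γ t)) (der J.emb (γ t) w)) t :=
    (hr.differentiableAt (by simp)).hasFDerivAt.comp_hasDerivAt t hγ
  have h2 : fderiv ℝ r (J.emb (γ t)) (der J.emb (γ t) w) = w := by
    have h3 : HasFDerivAt (r ∘ loc (γ t) J.emb) ((fderiv ℝ r (J.emb (γ t))).comp
        (der J.emb (γ t))) (extChartAt cotModel (γ t) (γ t)) := by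
      refine HasFDerivAt.comp _ ?_ (hasFDerivAt_loc _ (hJ.of_le (by simp)))
      rw [loc_self]
      exact (hr.differentiableAt (by simp)).hasFDerivAt
    have h4 : r ∘ loc (γ t) J.emb =ᶠ[𝓝 (extChartAt cotModel (γ t) (γ t))] id := by
      have h5 : ContinuousAt (extChartAt cotModel (γ t)).symm
          (extChartAt cotModel (γ t) (γ t)) := continuousAt_extChartAt_symm _
      have h6 : Tendsto (extChartAt cotModel (γ t)).symm
          (𝓝 (extChartAt cotModel (γ t) (γ t))) (𝓝 (γ t)) := by
        have h7 := h5.tendsto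
        rwa [extChartAt_to_inv] at h7
      filter_upwards [h6.eventually hrJ, extChartAt_target_mem_nhds (I := cotModel) (γ t)]
        with y hy hy2
      simp only [Function.comp_apply, loc, id]
      rw [hy, (extChartAt cotModel (γ t)).right_inv hy2]
    have h7 := h3.unique ((hasFDerivAt_id _).congr_of_eventuallyEq h4)
    exact congrArg (fun L : Phase →L[ℝ] Phase => L w) h7
  rw [h2] at h1
  have h3 : extChartAt cotModel (γ t) ∘ γ =ᶠ[𝓝 t] r ∘ (J.emb ∘ γ) := by
    filter_upwards [hc.eventually hrJ] with s hs using hs.symm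
  have h4 := (h1.congr_of_eventuallyEq h3).hasFDerivAt.hasFDerivWithinAt
    (s := range (𝓘(ℝ, ℝ) : ModelWithCorners ℝ ℝ ℝ))
  convert! h4 using 1


theorem contMDiffAt_of_emb {E : Type*} [NormedAddCommGroup E] [NormedSpace ℝ E]
    {f : E → Cotangent M} {y : E} {n : ℕ∞} (hc : ContinuousAt f y)
    (hf : ContDiffAt ℝ n (J.emb ∘ f) y) : ContMDiffAt 𝓘(ℝ, E) cotModel n f y := by
  obtain ⟨r, hr, hrJ⟩ := exists_retraction (J.contMDiff_emb (f y)) (J.injective_der_emb (f y))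
  rw [contMDiffAt_iff_target]
  refine ⟨hc, ?_⟩
  have h1 : ContDiffAt ℝ n (r ∘ (J.emb ∘ f)) y :=
    (hr.of_le (by exact_mod_cast le_top)).comp y hf
  exact (h1.contMDiffAt).congr_of_eventuallyEq (by
    filter_upwards [hc.eventually hrJ] with s hs using hs.symm)

end ExactEmbedding

/-! ### The radial field -/

/-- The radial vector field `ξ ∂_ξ`. -/
def radial (v : Cotangent M) : Phase := (0, fiberCoord v.1 v)

theorem fiberCoord_scale (x₀ : M) (t : ℝ) (v : Cotangent M) :
    fiberCoord x₀ (scale t v) = t • fiberCoord x₀ v := by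
  simp only [fiberCoord, hom_trivializationAt_apply, ContinuousLinearMap.inCoordinates, scale]
  rw [ContinuousLinearMap.smul_comp, ContinuousLinearMap.comp_smul]

theorem hasDerivAt_scale {h : Cotangent M → V} {v : Cotangent M}
    (hh : ContMDiffAt cotModel 𝓘(ℝ, V) 1 h v) :
    HasDerivAt (fun s : ℝ => h (scale s v)) (der h v (radial v)) 1 := by
  have h1 := hasFDerivAt_loc v hh
  let c : ℝ → Phase := fun s => ((extChartAt cotModel v v).1, s • fiberCoord v.1 v)
  have hc : ∀ s, extChartAt cotModel v (scale s v) = c s := by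
    intro s
    refine Prod.ext ?_ ?_
    · rw [extChartAt_cotangent_fst]
      exact (extChartAt_cotangent_fst v v).symm
    · rw [extChartAt_cotangent_snd, fiberCoord_scale]
  have hs1 : scale 1 v = v := by
    simp [scale]
  have h2 : HasDerivAt c (radial v) 1 := by
    refine (hasDerivAt_const _ _).prodMk ?_
    simpa using (hasDerivAt_id (1 : ℝ)).smul_const (fiberCoord v.1 v)
  have h3 : HasFDerivAt (loc v h) (der h v) (c 1) := by
    rw [← hc, hs1]
    exact h1
  have h4 := h3.comp_hasDerivAt 1 h2
  convert! h4 using 1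
  ext s
  have hmem : scale s v ∈ (extChartAt cotModel v).source := by
    rw [mem_extChartAt_cotangent_source]
    exact mem_chart_source _ v.1
  rw [Function.comp_apply, ← hc, loc_extChartAt hmem]

end

section

/-! ### The norm of covectors -/

section Conorm

variable (g : Metric M)

theorem inner_self_nonneg (x : M) (u : TangentSpace (𝓡 2) x) : 0 ≤ g.inner x u u := by
  by_cases hu : u = 0
  · simp [hu]
  · exact (g.pos x u hu).le

theorem inner_mul_inner_le (x : M) (u w : TangentSpace (𝓡 2) x) :
    g.inner x u w ^ 2 ≤ g.inner x u u * g.inner x w w := by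
  by_cases hw : w = 0
  · simp [hw]
  have hc := g.pos x w hw
  have h := inner_self_nonneg g x (g.inner x w w • u - g.inner x u w • w)
  simp only [map_sub, map_smul, sub_apply, smul_apply, smul_eq_mul] at h
  rw [g.symm x w u] at h
  by_contra hlt
  push Not at hlt
  nlinarith [mul_pos hc (sub_pos.2 hlt)]

/-- The norm of a covector is the norm of the vector that represents it. -/
theorem conorm_eq_sqrt {v : Cotangent M} {u₀ : TangentSpace (𝓡 2) v.1}
    (h : ∀ w, v.2 w = g.inner v.1 u₀ w) : conorm g v = √(g.inner v.1 u₀ u₀) := by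
  refine IsGreatest.csSup_eq ⟨?_, ?_⟩
  · by_cases hu : u₀ = 0
    · exact ⟨0, by simp, by simp [h, hu]⟩
    · have hp := g.pos v.1 u₀ hu
      have hs := Real.sqrt_pos.2 hp
      have hss := Real.mul_self_sqrt hp.le
      refine ⟨(√(g.inner v.1 u₀ u₀))⁻¹ • u₀, ?_, ?_⟩
      · simp only [mem_ofPred_eq, map_smul, smul_apply, smul_eq_mul]
        field_simp
        nlinarith
      · change v.2 _ = _
        rw [h]
        simp only [map_smul, smul_eq_mul]
        field_simp
        nlinarith
  · rintro _ ⟨u, hu, rfl⟩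
    change v.2 u ≤ _
    rw [h]
    refine Real.le_sqrt_of_sq_le ((inner_mul_inner_le g v.1 u₀ u).trans ?_)
    exact mul_le_of_le_one_right (inner_self_nonneg g _ _) hu

/-- The local frame of `TM` given by the chart at `x₀`. -/
def frame (x₀ : M) (i : Fin 2) (x : M) : TangentSpace (𝓡 2) x :=
  (trivializationAt Plane (TangentSpace (𝓡 2)) x₀).localFrame
    (EuclideanSpace.basisFun (Fin 2) ℝ).toBasis i x

theorem exists_eq_frame {x₀ x : M} (hx : x ∈ (chartAt Plane x₀).source)
    (w : TangentSpace (𝓡 2) x) :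
    ∃ a b : ℝ, w = a • frame x₀ 0 x + b • frame x₀ 1 x := by
  have hx' : x ∈ (trivializationAt Plane (TangentSpace (𝓡 2)) x₀).baseSet := by simpa using hx
  let B := (trivializationAt Plane (TangentSpace (𝓡 2)) x₀).basisAt
    (EuclideanSpace.basisFun (Fin 2) ℝ).toBasis hx'
  have hB : ∀ i, frame x₀ i x = B i := fun i =>
    Bundle.Trivialization.localFrame_apply_of_mem_baseSet _ _ hx'
  refine ⟨B.repr w 0, B.repr w 1, ?_⟩
  rw [hB, hB]
  have := B.sum_repr w
  rw [Fin.sum_univ_two] at this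
  exact this.symm

theorem frame_independent {x₀ x : M} (hx : x ∈ (chartAt Plane x₀).source) {a b : ℝ}
    (h : a • frame x₀ 0 x + b • frame x₀ 1 x = 0) : a = 0 ∧ b = 0 := by
  have hx' : x ∈ (trivializationAt Plane (TangentSpace (𝓡 2)) x₀).baseSet := by simpa using hx
  let B := (trivializationAt Plane (TangentSpace (𝓡 2)) x₀).basisAt
    (EuclideanSpace.basisFun (Fin 2) ℝ).toBasis hx'
  have hB : ∀ i, frame x₀ i x = B i := fun i =>
    Bundle.Trivialization.localFrame_apply_of_mem_baseSet _ _ hx'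
  rw [hB, hB] at h
  have h1 := Fintype.linearIndependent_iff.1 B.linearIndependent ![a, b]
    (by rw [Fin.sum_univ_two]; exact h)
  exact ⟨h1 0, h1 1⟩

/-- The coefficients of the metric in the frame given by the chart at `x₀`. -/
def gram (x₀ : M) (i j : Fin 2) (x : M) : ℝ := g.inner x (frame x₀ i x) (frame x₀ j x)

theorem contMDiffAt_frame {x₀ x : M} (hx : x ∈ (chartAt Plane x₀).source) (i : Fin 2) :
    ContMDiffAt (𝓡 2) ((𝓡 2).prod 𝓘(ℝ, Plane)) ∞
      (fun x : M => Bundle.TotalSpace.mk' Plane x (frame x₀ i x)) x :=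
  contMDiffAt_localFrame_of_mem _ _ _ i (by simpa using hx)

theorem contMDiffAt_gram {x₀ x : M} (hx : x ∈ (chartAt Plane x₀).source) (i j : Fin 2) :
    ContMDiffAt (𝓡 2) 𝓘(ℝ, ℝ) ∞ (gram g x₀ i j) x := by
  have h : ContMDiffAt (𝓡 2) ((𝓡 2).prod 𝓘(ℝ, ℝ)) ∞
      (fun m ↦ Bundle.TotalSpace.mk' ℝ (E := Bundle.Trivial M ℝ) m
        (g.inner m (frame x₀ i m) (frame x₀ j m))) x :=
    ContMDiffAt.clm_bundle_apply₂ (F₁ := Plane) (F₂ := Plane) (g.contMDiff x)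
      (contMDiffAt_frame hx i) (contMDiffAt_frame hx j)
  rw [Bundle.contMDiffAt_totalSpace] at h
  exact h.2

theorem gram_det_pos {x₀ x : M} (hx : x ∈ (chartAt Plane x₀).source) :
    0 < gram g x₀ 0 0 x * gram g x₀ 1 1 x - gram g x₀ 0 1 x ^ 2 := by
  have h0 : frame x₀ 1 x ≠ 0 := by
    intro h
    have := frame_independent hx (a := 0) (b := 1) (by simp [h])
    simp at this
  have hc : 0 < gram g x₀ 1 1 x := g.pos x _ h0
  have hne : gram g x₀ 1 1 x • frame x₀ 0 x + (-gram g x₀ 0 1 x) • frame x₀ 1 x ≠ 0 := by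
    intro h
    exact hc.ne' (frame_independent hx h).1
  have h := g.pos x _ hne
  simp only [map_add, map_smul, add_apply, smul_apply, smul_eq_mul] at h
  rw [g.symm x (frame x₀ 1 x) (frame x₀ 0 x)] at h
  change 0 < gram g x₀ 1 1 x * (gram g x₀ 1 1 x * gram g x₀ 0 0 x +
    -gram g x₀ 0 1 x * gram g x₀ 0 1 x) + -gram g x₀ 0 1 x * (gram g x₀ 1 1 x * gram g x₀ 0 1 x +
    -gram g x₀ 0 1 x * gram g x₀ 1 1 x) at h
  by_contra hle
  push Not at hle
  nlinarith [mul_nonneg hc.le (sub_nonneg.2 (show _ ≤ (0 : ℝ) from hle))]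

/-- The components of a covector in the frame given by the chart at `x₀`. -/
def comps (x₀ : M) (i : Fin 2) (v : Cotangent M) : ℝ := v.2 (frame x₀ i v.1)

theorem comps_eq {x₀ : M} {v : Cotangent M} (hv : v.1 ∈ (chartAt Plane x₀).source) (i : Fin 2) :
    comps x₀ i v = fiberCoord x₀ v (EuclideanSpace.single i 1) := by
  have hv' : v.1 ∈ (trivializationAt Plane (TangentSpace (𝓡 2)) x₀).baseSet := by simpa using hv
  have h := fiberCoord_mfderiv x₀ v hv (frame x₀ i v.1)
  rw [← TangentBundle.continuousLinearMapAt_trivializationAt (I := 𝓡 2) hv] at h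
  refine h.symm.trans ?_
  congr 1
  rw [frame, Bundle.Trivialization.localFrame_apply_of_mem_baseSet _ _ hv']
  have h2 := (trivializationAt Plane (TangentSpace (𝓡 2)) x₀).continuousLinearMapAt_symmL
    (R := ℝ) hv' (EuclideanSpace.single i 1)
  rw [Bundle.Trivialization.symmL_apply _ hv'] at h2
  simp only [Bundle.Trivialization.basisAt, Module.Basis.map_apply,
    OrthonormalBasis.coe_toBasis, EuclideanSpace.basisFun_apply,
    Bundle.Trivialization.linearEquivAt_symm_apply]
  exact h2

theorem contMDiffAt_comps {x₀ : M} {v : Cotangent M} (hv : v.1 ∈ (chartAt Plane x₀).source)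
    (i : Fin 2) : ContMDiffAt cotModel 𝓘(ℝ, ℝ) ∞ (comps x₀ i) v := by
  have h1 : ContMDiffAt cotModel 𝓘(ℝ, ℝ) ∞
      (fun u => fiberCoord x₀ u (EuclideanSpace.single i 1)) v :=
    (contMDiffAt_fiberCoord x₀ hv).clm_apply contMDiffAt_const
  refine h1.congr_of_eventuallyEq ?_
  have : {u : Cotangent M | u.1 ∈ (chartAt Plane x₀).source} ∈ 𝓝 v :=
    (Bundle.contMDiff_proj (IB := 𝓡 2) (n := ∞) _).continuous.continuousAt.preimage_mem_nhds
      ((chartAt Plane x₀).open_source.mem_nhds hv)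
  filter_upwards [this] with u hu using comps_eq hu i

/-- The vector that represents a covector, and the square of the norm of the covector, in the
frame given by the chart at `x₀`. -/
theorem exists_riesz {x₀ : M} {v : Cotangent M} (hv : v.1 ∈ (chartAt Plane x₀).source) :
    ∃ u₀ : TangentSpace (𝓡 2) v.1, (∀ w, v.2 w = g.inner v.1 u₀ w) ∧
      g.inner v.1 u₀ u₀ = (gram g x₀ 1 1 v.1 * comps x₀ 0 v ^ 2 -
        2 * gram g x₀ 0 1 v.1 * comps x₀ 0 v * comps x₀ 1 v +
        gram g x₀ 0 0 v.1 * comps x₀ 1 v ^ 2) /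
        (gram g x₀ 0 0 v.1 * gram g x₀ 1 1 v.1 - gram g x₀ 0 1 v.1 ^ 2) := by
  have hd := (gram_det_pos g hv).ne'
  set D := gram g x₀ 0 0 v.1 * gram g x₀ 1 1 v.1 - gram g x₀ 0 1 v.1 ^ 2 with hD
  set a : ℝ := (gram g x₀ 1 1 v.1 * comps x₀ 0 v - gram g x₀ 0 1 v.1 * comps x₀ 1 v) / D
  set b : ℝ := (gram g x₀ 0 0 v.1 * comps x₀ 1 v - gram g x₀ 0 1 v.1 * comps x₀ 0 v) / D
  have key : ∀ w, v.2 w = g.inner v.1 (a • frame x₀ 0 v.1 + b • frame x₀ 1 v.1) w := by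
    intro w
    obtain ⟨α, β, rfl⟩ := exists_eq_frame hv w
    rw [map_add, map_smul, map_smul]
    simp only [map_add, map_smul, add_apply, smul_apply, smul_eq_mul]
    rw [g.symm v.1 (frame x₀ 1 v.1) (frame x₀ 0 v.1)]
    change α * comps x₀ 0 v + β * comps x₀ 1 v = α * (a * gram g x₀ 0 0 v.1 + b * gram g x₀ 0 1 v.1)
      + β * (a * gram g x₀ 0 1 v.1 + b * gram g x₀ 1 1 v.1)
    simp only [a, b]
    field_simp
    rw [hD]
    ring
  refine ⟨_, key, ?_⟩
  rw [← key, map_add, map_smul, map_smul]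
  change a * comps x₀ 0 v + b * comps x₀ 1 v = _
  simp only [a, b]
  field_simp
  ring

theorem conorm_sq {x₀ : M} {v : Cotangent M} (hv : v.1 ∈ (chartAt Plane x₀).source) :
    conorm g v ^ 2 = (gram g x₀ 1 1 v.1 * comps x₀ 0 v ^ 2 -
        2 * gram g x₀ 0 1 v.1 * comps x₀ 0 v * comps x₀ 1 v +
        gram g x₀ 0 0 v.1 * comps x₀ 1 v ^ 2) /
        (gram g x₀ 0 0 v.1 * gram g x₀ 1 1 v.1 - gram g x₀ 0 1 v.1 ^ 2) := by
  obtain ⟨u₀, h1, h2⟩ := exists_riesz g hv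
  rw [conorm_eq_sqrt g h1, Real.sq_sqrt (inner_self_nonneg g _ _), h2]

theorem conorm_nonneg (v : Cotangent M) : 0 ≤ conorm g v := by
  obtain ⟨u₀, h1, -⟩ := exists_riesz g (x₀ := v.1) (v := v) (mem_chart_source _ _)
  rw [conorm_eq_sqrt g h1]
  positivity

theorem conorm_pos {v : Cotangent M} (hv : v ∈ nonzero M) : 0 < conorm g v := by
  obtain ⟨u₀, h1, -⟩ := exists_riesz g (x₀ := v.1) (v := v) (mem_chart_source _ _)
  rw [conorm_eq_sqrt g h1]
  refine Real.sqrt_pos.2 (g.pos _ _ ?_)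
  rintro rfl
  exact hv (ContinuousLinearMap.ext fun w => by rw [h1]; simp)

theorem mem_nonzero_of_conorm_pos {v : Cotangent M} (hv : 0 < conorm g v) : v ∈ nonzero M := by
  intro h
  have h1 : ∀ w, v.2 w = g.inner v.1 0 w := by
    intro w
    rw [h]
    simp
  rw [conorm_eq_sqrt g h1] at hv
  simp at hv

theorem abs_apply_le (v : Cotangent M) (w : TangentSpace (𝓡 2) v.1) :
    |(v.2 w : ℝ)| ≤ conorm g v * √(g.inner v.1 w w) := by
  obtain ⟨u₀, h1, -⟩ := exists_riesz g (x₀ := v.1) (v := v) (mem_chart_source _ _)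
  have h2 : (v.2 w : ℝ) = g.inner v.1 u₀ w := h1 w
  rw [conorm_eq_sqrt g h1, h2, ← Real.sqrt_mul (inner_self_nonneg g _ _)]
  exact Real.abs_le_sqrt (inner_mul_inner_le g v.1 u₀ w)

theorem contMDiff_conorm_sq : ContMDiff cotModel 𝓘(ℝ, ℝ) ∞ (fun v => conorm g v ^ 2) := by
  intro v
  have hv := mem_chart_source Plane v.1
  have hg : ∀ i j, ContMDiffAt cotModel 𝓘(ℝ, ℝ) ∞ (fun u : Cotangent M => gram g v.1 i j u.1) v :=
    fun i j => (contMDiffAt_gram g hv i j).comp v (Bundle.contMDiffAt_proj _)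
  have hc := contMDiffAt_comps (v := v) hv
  have hnum := (((hg 1 1).mul ((hc 0).pow 2)).sub (((contMDiffAt_const (c := (2 : ℝ))).mul
    (hg 0 1)).mul (hc 0) |>.mul (hc 1))).add ((hg 0 0).mul ((hc 1).pow 2))
  have hden := ((hg 0 0).mul (hg 1 1)).sub ((hg 0 1).pow 2)
  have hq := hnum.mul (hden.inv₀ (gram_det_pos g hv).ne')
  refine hq.congr_of_eventuallyEq ?_
  have hn : {u : Cotangent M | u.1 ∈ (chartAt Plane v.1).source} ∈ 𝓝 v :=
    (Bundle.contMDiff_proj (IB := 𝓡 2) (n := ∞) _).continuous.continuousAt.preimage_mem_nhds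
      ((chartAt Plane v.1).open_source.mem_nhds hv)
  filter_upwards [hn] with u hu
  rw [conorm_sq g hu, div_eq_mul_inv]
  rfl

theorem conorm_eq_sqrt_sq : conorm g = fun v => √(conorm g v ^ 2) := by
  ext v
  rw [Real.sqrt_sq (conorm_nonneg g v)]

theorem continuous_conorm : Continuous (conorm g) := by
  rw [conorm_eq_sqrt_sq]
  exact (contMDiff_conorm_sq g).continuous.sqrt

theorem contMDiffAt_conorm {v : Cotangent M} (hv : v ∈ nonzero M) :
    ContMDiffAt cotModel 𝓘(ℝ, ℝ) ∞ (conorm g) v := by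
  rw [conorm_eq_sqrt_sq]
  have h : ContDiffAt ℝ ∞ Real.sqrt (conorm g v ^ 2) :=
    Real.contDiffAt_sqrt (pow_pos (conorm_pos g hv) 2).ne'
  exact h.contMDiffAt.comp v (contMDiff_conorm_sq g v)

include g in
theorem isOpen_nonzero : IsOpen (nonzero M) := by
  have : nonzero M = conorm g ⁻¹' Ioi 0 :=
    ext fun v => ⟨conorm_pos g, mem_nonzero_of_conorm_pos g⟩
  rw [this]
  exact isOpen_Ioi.preimage (continuous_conorm g)

/-- The unit cosphere bundle. -/
def cosphere : Set (Cotangent M) := {v | conorm g v = 1}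

theorem cosphere_subset_nonzero : cosphere g ⊆ nonzero M := fun v hv =>
  mem_nonzero_of_conorm_pos g (by rw [show conorm g v = 1 from hv]; exact one_pos)

theorem isCompact_cosphere [CompactSpace M] : IsCompact (cosphere g) := by
  rw [isCompact_iff_ultrafilter_le_nhds']
  intro F hF
  obtain ⟨x₀, -, hx₀⟩ := isCompact_univ.ultrafilter_le_nhds (F.map Bundle.TotalSpace.proj)
    (by simp : ((F.map Bundle.TotalSpace.proj : Ultrafilter M) : Filter M) ≤ 𝓟 univ)
  have hx₀' : Tendsto (fun v : Cotangent M => v.1) F (𝓝 x₀) := hx₀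
  have hsrc := mem_chart_source Plane x₀
  have hmem : ∀ᶠ v in (F : Filter (Cotangent M)), v.1 ∈ (chartAt Plane x₀).source :=
    hx₀'.eventually ((chartAt Plane x₀).open_source.mem_nhds hsrc)
  have hlim : ∀ i, ∃ c : ℝ, Tendsto (comps x₀ i) F (𝓝 c) := by
    intro i
    have h1 : ∀ᶠ v in (F : Filter (Cotangent M)), gram g x₀ i i v.1 < gram g x₀ i i x₀ + 1 :=
      hx₀'.eventually (((contMDiffAt_gram g hsrc i i).continuousAt).eventually_lt_const
        (by linarith))
    have h2 : ∀ᶠ v in (F : Filter (Cotangent M)), comps x₀ i v ∈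
        Icc (-√(gram g x₀ i i x₀ + 1)) (√(gram g x₀ i i x₀ + 1)) := by
      filter_upwards [h1, hF] with v hv hvS
      refine mem_Icc.2 (abs_le.1 ?_)
      refine (abs_apply_le g v (frame x₀ i v.1)).trans ?_
      rw [show conorm g v = 1 from hvS, one_mul]
      exact Real.sqrt_le_sqrt hv.le
    obtain ⟨c, -, hc⟩ := isCompact_Icc.ultrafilter_le_nhds (F.map (comps x₀ i))
      (le_principal_iff.2 h2)
    exact ⟨c, hc⟩
  obtain ⟨c₀, hc₀⟩ := hlim 0
  obtain ⟨c₁, hc₁⟩ := hlim 1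
  let e := trivializationAt CoPlane
    (fun x : M => TangentSpace (𝓡 2) x →L[ℝ] Bundle.Trivial M ℝ x) x₀
  let pr : Fin 2 → CoPlane := fun i => EuclideanSpace.proj i
  have hfib : Tendsto (fiberCoord x₀) F (𝓝 (c₀ • pr 0 + c₁ • pr 1)) := by
    have h1 : Tendsto (fun v => comps x₀ 0 v • pr 0 + comps x₀ 1 v • pr 1) F
        (𝓝 (c₀ • pr 0 + c₁ • pr 1)) := (hc₀.smul_const _).add (hc₁.smul_const _)
    refine h1.congr' ?_
    filter_upwards [hmem] with v hv
    rw [comps_eq hv, comps_eq hv]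
    ext b
    have hb : b =
        b 0 • EuclideanSpace.single 0 (1 : ℝ) + b 1 • EuclideanSpace.single 1 (1 : ℝ) := by
      ext i
      fin_cases i <;> simp
    conv_rhs => rw [hb]
    simp [pr, mul_comm]
  let v₀ : Cotangent M := e.toOpenPartialHomeomorph.symm (x₀, c₀ • pr 0 + c₁ • pr 1)
  have htar : (x₀, c₀ • pr 0 + c₁ • pr 1) ∈ e.target := by
    rw [e.mem_target]
    simp [e]
  have hconv : Tendsto
      (fun v : Cotangent M => e.toOpenPartialHomeomorph.symm (v.1, fiberCoord x₀ v))
      F (𝓝 v₀) :=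
    (e.toOpenPartialHomeomorph.continuousAt_symm htar).tendsto.comp (hx₀'.prodMk_nhds hfib)
  have hle : (F : Filter (Cotangent M)) ≤ 𝓝 v₀ := by
    refine Tendsto.mono_right (f := id) ?_ le_rfl
    refine hconv.congr' ?_
    filter_upwards [hmem] with v hv
    have hvs : v ∈ e.source := by
      rw [e.mem_source]
      simpa [e] using hv
    have h1 : e v = (v.1, fiberCoord x₀ v) := Prod.ext (e.coe_fst hvs) rfl
    rw [← h1]
    exact e.toOpenPartialHomeomorph.left_inv hvs
  refine ⟨v₀, ?_, hle⟩
  have h1 : Tendsto (conorm g) F (𝓝 (conorm g v₀)) :=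
    (continuous_conorm g).continuousAt.mono_left hle
  have h2 : Tendsto (conorm g) F (𝓝 1) :=
    tendsto_const_nhds.congr'
      (by filter_upwards [hF] with v hv using (show conorm g v = 1 from hv).symm)
  exact tendsto_nhds_unique h1 h2

end Conorm

end

section

/-! ### Existence of exact embeddings -/

section Existence

variable [T2Space M] {ι : Type*} [Fintype ι] (f : SmoothBumpCovering ι (𝓡 2) M)

/-- The normalisation `∑ χ_i²` of the bump functions. -/
def bumpSum (x : M) : ℝ := ∑ i, f i x ^ 2

omit [IsManifold (𝓡 2) ∞ M] [T2Space M] in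
theorem bumpSum_pos (x : M) : 0 < bumpSum f x := by
  refine Finset.sum_pos' (fun i _ => sq_nonneg _) ⟨f.ind x (mem_univ x), Finset.mem_univ _, ?_⟩
  rw [f.apply_ind x (mem_univ x)]
  norm_num

theorem contMDiff_bumpSum : ContMDiff (𝓡 2) 𝓘(ℝ, ℝ) ∞ (bumpSum f) :=
  contMDiff_finsetSum fun i _ => ((f i).contMDiff).pow 2

/-- A covector in the coordinates of one chart, as a covector of `ι → Plane × ℝ`. -/
def chartMom (i : ι) (ξ : CoPlane) (y : Plane) : (ι → Plane × ℝ) →L[ℝ] ℝ :=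
  (ξ.comp (ContinuousLinearMap.fst ℝ Plane ℝ) - ξ y • ContinuousLinearMap.snd ℝ Plane ℝ).comp
    (ContinuousLinearMap.proj (R := ℝ) (φ := fun _ : ι => Plane × ℝ) i)

omit [Fintype ι] in
theorem chartMom_apply (i : ι) (ξ : CoPlane) (y : Plane) (w : ι → Plane × ℝ) :
    chartMom i ξ y w = ξ (w i).1 - ξ y * (w i).2 := by
  simp [chartMom]

theorem contDiff_chartMom (i : ι) :
    ContDiff ℝ ∞ (fun q : CoPlane × Plane => chartMom i q.1 q.2) := by
  have h1 : ContDiff ℝ ∞ (fun q : CoPlane × Plane =>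
      q.1.comp (ContinuousLinearMap.fst ℝ Plane ℝ)) :=
    contDiff_fst.clm_comp contDiff_const
  have h2 : ContDiff ℝ ∞ (fun q : CoPlane × Plane => q.1 q.2) :=
    contDiff_fst.clm_apply contDiff_snd
  have h3 : ContDiff ℝ ∞ (fun q : CoPlane × Plane =>
      q.1 q.2 • ContinuousLinearMap.snd ℝ Plane ℝ) := h2.smul contDiff_const
  exact (h1.sub h3).clm_comp contDiff_const

omit [T2Space M] in
theorem contMDiffAt_chartMom (i : ι) {a : Cotangent M → CoPlane} {b : Cotangent M → Plane}
    {v : Cotangent M} (ha : ContMDiffAt cotModel 𝓘(ℝ, CoPlane) ∞ a v)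
    (hb : ContMDiffAt cotModel 𝓘(ℝ, Plane) ∞ b v) :
    ContMDiffAt cotModel 𝓘(ℝ, (ι → Plane × ℝ) →L[ℝ] ℝ) ∞ (fun u => chartMom i (a u) (b u)) v := by
  have h1 : ContMDiffAt cotModel 𝓘(ℝ, CoPlane × Plane) ∞ (fun u => (a u, b u)) v :=
    ha.prodMk_space hb
  have h2 : ContMDiffAt 𝓘(ℝ, CoPlane × Plane) 𝓘(ℝ, (ι → Plane × ℝ) →L[ℝ] ℝ) ∞
      (fun q : CoPlane × Plane => chartMom i q.1 q.2) (a v, b v) :=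
    (contDiff_chartMom i).contDiffAt.contMDiffAt
  exact ContMDiffAt.comp (g := fun q : CoPlane × Plane => chartMom i q.1 q.2)
    (f := fun u => (a u, b u)) v h2 h1

/-- The position component of the exact embedding given by a covering by bump functions. -/
def bumpPos (x : M) : ι → Plane × ℝ := fun i => (f i x • extChartAt (𝓡 2) (f.c i) x, f i x)

theorem contMDiff_bumpPos : ContMDiff (𝓡 2) 𝓘(ℝ, ι → Plane × ℝ) ∞ (bumpPos f) :=
  contMDiff_pi_space.2 fun i =>
    ((f i).contMDiff_smul contMDiffOn_extChartAt).prodMk_space (f i).contMDiff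

omit [Fintype ι] [IsManifold (𝓡 2) ∞ M] [T2Space M] in
theorem injective_bumpPos : Function.Injective (bumpPos f) := by
  intro x y h
  have h1 : ∀ i, f i x • extChartAt (𝓡 2) (f.c i) x = f i y • extChartAt (𝓡 2) (f.c i) y :=
    fun i => congrArg Prod.fst (congrFun h i)
  have h2 : ∀ i, f i x = f i y := fun i => congrArg Prod.snd (congrFun h i)
  have h3 := f.apply_ind x (mem_univ x)
  have h4 := h1 (f.ind x (mem_univ x))
  rw [← h2, h3, one_smul, one_smul] at h4
  exact (extChartAt (𝓡 2) (f.c _)).injOn (f.mem_extChartAt_ind_source x (mem_univ x))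
    (f.mem_extChartAt_source_of_eq_one ((h2 _).symm.trans h3)) h4

/-- The momentum component of the exact embedding given by a covering by bump functions. With
`e = (χ_i φ_i, χ_i)_i` one has `χ_i dφ_i = d(χ_i φ_i) - φ_i dχ_i`, and these forms are averaged with
the weights `χ_i / ∑ χ_k²`. -/
def bumpMom (v : Cotangent M) : (ι → Plane × ℝ) →L[ℝ] ℝ :=
  ∑ i, (f i v.1 / bumpSum f v.1) •
    chartMom i (fiberCoord (f.c i) v) (extChartAt (𝓡 2) (f.c i) v.1)

theorem contMDiff_bumpMom : ContMDiff cotModel 𝓘(ℝ, (ι → Plane × ℝ) →L[ℝ] ℝ) ∞ (bumpMom f) := by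
  refine contMDiff_finsetSum fun i _ => ?_
  intro v
  have hχ : ContMDiff cotModel 𝓘(ℝ, ℝ) ∞ (fun v : Cotangent M => f i v.1 / bumpSum f v.1) := by
    have h1 : ContMDiff (𝓡 2) 𝓘(ℝ, ℝ) ∞ (fun x => f i x / bumpSum f x) :=
      ((f i).contMDiff).div₀ (contMDiff_bumpSum f) fun x => (bumpSum_pos f x).ne'
    exact h1.comp (Bundle.contMDiff_proj _)
  by_cases hv : v.1 ∈ (chartAt Plane (f.c i)).source
  · have h1 := contMDiffAt_fiberCoord (f.c i) hv
    have h2 : ContMDiffAt cotModel 𝓘(ℝ, Plane) ∞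
        (fun v : Cotangent M => extChartAt (𝓡 2) (f.c i) v.1) v :=
      ContMDiffAt.comp v (contMDiffAt_extChartAt' (I := 𝓡 2) (n := ∞) (by simpa using hv))
        (Bundle.contMDiffAt_proj _)
    have h3 : ContMDiffAt cotModel 𝓘(ℝ, (ι → Plane × ℝ) →L[ℝ] ℝ) ∞
        (fun v : Cotangent M => chartMom i (fiberCoord (f.c i) v)
          (extChartAt (𝓡 2) (f.c i) v.1)) v := by
      exact contMDiffAt_chartMom i h1 h2
    exact (hχ v).smul h3
  · have h0 : v.1 ∉ tsupport (f i) := fun h => hv ((f i).tsupport_subset_chartAt_source h)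
    have h1 : (fun x : M => f i x) =ᶠ[𝓝 v.1] 0 := notMem_tsupport_iff_eventuallyEq.1 h0
    have h2 : Tendsto (fun u : Cotangent M => u.1) (𝓝 v) (𝓝 v.1) :=
      (Bundle.contMDiff_proj (IB := 𝓡 2) (n := ∞) _).continuous.continuousAt
    refine (contMDiffAt_const (c := (0 : (ι → Plane × ℝ) →L[ℝ] ℝ))).congr_of_eventuallyEq ?_
    filter_upwards [h2.eventually h1] with u hu
    rw [hu]
    simp

theorem bumpMom_mfderiv (v : Cotangent M) (w : TangentSpace (𝓡 2) v.1) :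
    bumpMom f v (mfderiv (𝓡 2) 𝓘(ℝ, ι → Plane × ℝ) (bumpPos f) v.1 w) = v.2 w := by
  have hpos : HasMFDerivAt (𝓡 2) 𝓘(ℝ, ι → Plane × ℝ) (bumpPos f) v.1
      (mfderiv (𝓡 2) 𝓘(ℝ, ι → Plane × ℝ) (bumpPos f) v.1) :=
    ((contMDiff_bumpPos f).mdifferentiableAt (by simp)).hasMFDerivAt
  have hterm : ∀ i, f i v.1 * chartMom i (fiberCoord (f.c i) v) (extChartAt (𝓡 2) (f.c i) v.1)
      (mfderiv (𝓡 2) 𝓘(ℝ, ι → Plane × ℝ) (bumpPos f) v.1 w) = f i v.1 ^ 2 * v.2 w := by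
    intro i
    by_cases hχ : f i v.1 = 0
    · simp [hχ]
    have hv : v.1 ∈ (chartAt Plane (f.c i)).source :=
      (f i).tsupport_subset_chartAt_source (subset_tsupport _ hχ)
    set ξ := fiberCoord (f.c i) v
    set c : ℝ := ξ (extChartAt (𝓡 2) (f.c i) v.1)
    let L := chartMom i ξ (extChartAt (𝓡 2) (f.c i) v.1)
    have h1 := (L.hasFDerivAt (x := (bumpPos f) v.1)).hasMFDerivAt.comp v.1 hpos
    have hφ : HasMFDerivAt (𝓡 2) 𝓘(ℝ, Plane) (extChartAt (𝓡 2) (f.c i)) v.1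
        (mfderiv (𝓡 2) 𝓘(ℝ, Plane) (extChartAt (𝓡 2) (f.c i)) v.1) :=
      (mdifferentiableAt_extChartAt hv).hasMFDerivAt
    have hχd : HasMFDerivAt (𝓡 2) 𝓘(ℝ, ℝ) (f i) v.1 (mfderiv (𝓡 2) 𝓘(ℝ, ℝ) (f i) v.1) :=
      ((f i).contMDiff.mdifferentiableAt (by simp)).hasMFDerivAt
    let D : Plane →L[ℝ] ℝ := mfderiv (𝓡 2) 𝓘(ℝ, ℝ) (f i) v.1
    have hξ : HasFDerivAt (fun y : Plane => ξ y - c) ξ (extChartAt (𝓡 2) (f.c i) v.1) :=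
      (ξ.hasFDerivAt).sub_const c
    have h2 := hχd.mul (hξ.hasMFDerivAt.comp v.1 hφ)
    have h3 : (L ∘ (bumpPos f)) = (f i) * ((fun y : Plane => ξ y - c) ∘
        (extChartAt (𝓡 2) (f.c i))) := by
      ext x
      change chartMom i ξ _ (fun j => (f j x • extChartAt (𝓡 2) (f.c j) x, f j x)) =
        f i x * (ξ (extChartAt (𝓡 2) (f.c i) x) - c)
      rw [chartMom_apply, map_smul, smul_eq_mul]
      ring
    rw [h3] at h1
    have h4 := congrArg (fun T : Plane →L[ℝ] ℝ => T w) (hasMFDerivAt_unique h1 h2)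
    have h5 : L (mfderiv (𝓡 2) 𝓘(ℝ, ι → Plane × ℝ) (bumpPos f) v.1 w) =
        f i v.1 * ξ (mfderiv (𝓡 2) 𝓘(ℝ, Plane) (extChartAt (𝓡 2) (f.c i)) v.1 w) +
        (ξ (extChartAt (𝓡 2) (f.c i) v.1) - c) * D w := h4
    rw [fiberCoord_mfderiv (f.c i) v hv w, show ξ (extChartAt (𝓡 2) (f.c i) v.1) - c = 0 from
      sub_self _] at h5
    change f i v.1 * L _ = _
    rw [h5]
    ring
  have hsum := (bumpSum_pos f v.1).ne'
  have h6 : ∀ z, bumpMom f v z = (∑ i, f i v.1 * chartMom i (fiberCoord (f.c i) v)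
      (extChartAt (𝓡 2) (f.c i) v.1) z) / bumpSum f v.1 := by
    intro z
    simp only [bumpMom, sum_apply, smul_apply, smul_eq_mul, Finset.sum_div]
    exact Finset.sum_congr rfl fun i _ => by ring
  refine (h6 _).trans ?_
  rw [Finset.sum_congr rfl fun i _ => hterm i, ← Finset.sum_mul]
  change bumpSum f v.1 * (v.2 w : ℝ) / bumpSum f v.1 = v.2 w
  field_simp

/-- The exact embedding given by a finite covering by bump functions. -/
def bumpEmbedding : ExactEmbedding M (ι → Plane × ℝ) where
  pos := (bumpPos f)
  mom := bumpMom f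
  contMDiff_pos := (contMDiff_bumpPos f)
  injective_pos := injective_bumpPos f
  contMDiff_mom := contMDiff_bumpMom f
  mom_scale := fun t v => by
    simp only [bumpMom, Finset.smul_sum]
    refine Finset.sum_congr rfl fun i _ => ?_
    rw [fiberCoord_scale]
    ext w
    simp only [smul_apply, chartMom_apply, smul_eq_mul]
    change f i v.1 / bumpSum f v.1 * (t * fiberCoord (f.c i) v (w i).1 -
      t * fiberCoord (f.c i) v (extChartAt (𝓡 2) (f.c i) v.1) * (w i).2) = _
    ring
  mom_mfderiv := bumpMom_mfderiv f

end Existence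

universe u in
/-- Compact surfaces have exact embeddings into finite-dimensional spaces. -/
theorem exists_exactEmbedding (M : Type u) [TopologicalSpace M] [ChartedSpace Plane M]
    [IsManifold (𝓡 2) ∞ M] [T2Space M] [CompactSpace M] :
    ∃ (ι : Type u) (_ : Fintype ι), Nonempty (ExactEmbedding M (ι → Plane × ℝ)) := by
  obtain ⟨ι, f, -⟩ := SmoothBumpCovering.exists_isSubordinate (𝓡 2) (M := M) isClosed_univ
    (U := fun _ => univ) fun x _ => univ_mem
  have := f.fintype
  exact ⟨ι, this, ⟨bumpEmbedding f⟩⟩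

end

section

/-! ### Ordinary differential equations on embedded sets -/

section EmbeddedFlow

open NNReal

variable {X : Type*} {S : Set X} {j Y : X → V} {L : ℝ≥0}

/-- `γ` solves `(j ∘ γ)' = Y ∘ γ` in `S` on the set `I` of times. -/
def IsSolution (S : Set X) (j Y : X → V) (γ : ℝ → X) (I : Set ℝ) : Prop :=
  ∀ t ∈ I, γ t ∈ S ∧ HasDerivAt (j ∘ γ) (Y (γ t)) t

theorem IsSolution.shift {γ : ℝ → X} {a b : ℝ} (h : IsSolution S j Y γ (Ioo a b)) (s : ℝ) :
    IsSolution S j Y (fun t => γ (t + s)) (Ioo (a - s) (b - s)) := by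
  intro t ht
  have ht' : t + s ∈ Ioo a b := ⟨by linarith [ht.1], by linarith [ht.2]⟩
  exact ⟨(h _ ht').1, (h _ ht').2.comp_add_const t s⟩

theorem IsSolution.reverse {γ : ℝ → X} (h : IsSolution S j Y γ univ) :
    IsSolution S j (fun z => -Y z) (fun t => γ (-t)) univ := by
  intro t _
  refine ⟨(h _ trivial).1, ?_⟩
  have h1 := (h (-t) trivial).2.scomp t (hasDerivAt_neg t)
  rw [neg_one_smul] at h1
  exact h1

theorem IsSolution.congr {γ γ' : ℝ → X} {a b : ℝ} (h : IsSolution S j Y γ (Ioo a b))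
    (he : EqOn γ' γ (Ioo a b)) : IsSolution S j Y γ' (Ioo a b) := by
  intro t ht
  rw [he ht]
  refine ⟨(h t ht).1, (h t ht).2.congr_of_eventuallyEq ?_⟩
  filter_upwards [isOpen_Ioo.mem_nhds ht] with s hs
  rw [Function.comp_apply, Function.comp_apply, he hs]

omit [NormedSpace ℝ V] in
/-- The vector field `Y`, transported to the image of `S`. -/
theorem exists_lipschitz_field [Nonempty X] (hj : InjOn j S)
    (hY : ∀ u ∈ S, ∀ z ∈ S, ‖Y u - Y z‖ ≤ L * ‖j u - j z‖) :
    ∃ F : V → V, LipschitzOnWith L F (j '' S) ∧ ∀ u ∈ S, F (j u) = Y u := by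
  have h1 : ∀ u ∈ S, Y (Function.invFunOn j S (j u)) = Y u := fun u hu => by
    rw [hj.leftInvOn_invFunOn hu]
  refine ⟨fun y => Y (Function.invFunOn j S y), ?_, h1⟩
  refine LipschitzOnWith.of_dist_le_mul ?_
  rintro _ ⟨u, hu, rfl⟩ _ ⟨z, hz, rfl⟩
  rw [h1 u hu, h1 z hz, dist_eq_norm, dist_eq_norm]
  exact hY u hu z hz

theorem IsSolution.eqOn (hj : InjOn j S)
    (hY : ∀ u ∈ S, ∀ z ∈ S, ‖Y u - Y z‖ ≤ L * ‖j u - j z‖) {γ γ' : ℝ → X} {a b t₀ : ℝ}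
    (h : IsSolution S j Y γ (Ioo a b)) (h' : IsSolution S j Y γ' (Ioo a b))
    (ht₀ : t₀ ∈ Ioo a b) (he : γ t₀ = γ' t₀) : EqOn γ γ' (Ioo a b) := by
  have : Nonempty X := ⟨γ t₀⟩
  obtain ⟨F, hF, hFY⟩ := exists_lipschitz_field hj hY
  have h1 : EqOn (j ∘ γ) (j ∘ γ') (Ioo a b) := by
    refine ODE_solution_unique_of_mem_Ioo (v := fun _ => F) (s := fun _ => j '' S) (K := L)
      (fun _ _ => hF) ht₀ ?_ ?_ (congrArg j he)
    · intro t ht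
      rw [Function.comp_apply, hFY _ (h t ht).1]
      exact ⟨(h t ht).2, mem_image_of_mem j (h t ht).1⟩
    · intro t ht
      rw [Function.comp_apply, hFY _ (h' t ht).1]
      exact ⟨(h' t ht).2, mem_image_of_mem j (h' t ht).1⟩
  exact fun t ht => hj (h t ht).1 (h' t ht).1 (h1 ht)

theorem IsSolution.eq (hj : InjOn j S)
    (hY : ∀ u ∈ S, ∀ z ∈ S, ‖Y u - Y z‖ ≤ L * ‖j u - j z‖) {γ γ' : ℝ → X} {t₀ : ℝ}
    (h : IsSolution S j Y γ univ) (h' : IsSolution S j Y γ' univ)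
    (he : γ t₀ = γ' t₀) : γ = γ' := by
  ext t
  have ht : t ∈ Ioo (-(|t| + |t₀| + 1)) (|t| + |t₀| + 1) := by
    constructor <;> linarith [le_abs_self t, neg_abs_le t, abs_nonneg t₀]
  have ht₀ : t₀ ∈ Ioo (-(|t| + |t₀| + 1)) (|t| + |t₀| + 1) := by
    constructor <;> linarith [le_abs_self t₀, neg_abs_le t₀, abs_nonneg t]
  exact IsSolution.eqOn hj hY (fun s _ => h s trivial) (fun s _ => h' s trivial) ht₀ he ht

theorem IsSolution.norm_sub_le_of_nonneg (hj : InjOn j S)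
    (hY : ∀ u ∈ S, ∀ z ∈ S, ‖Y u - Y z‖ ≤ L * ‖j u - j z‖) {γ γ' : ℝ → X}
    (h : IsSolution S j Y γ univ) (h' : IsSolution S j Y γ' univ) {t : ℝ} (ht : 0 ≤ t) :
    ‖j (γ t) - j (γ' t)‖ ≤ ‖j (γ 0) - j (γ' 0)‖ * Real.exp (L * t) := by
  have : Nonempty X := ⟨γ 0⟩
  obtain ⟨F, hF, hFY⟩ := exists_lipschitz_field hj hY
  have key : ∀ {η : ℝ → X}, IsSolution S j Y η univ →
      ∀ s, HasDerivAt (j ∘ η) (F ((j ∘ η) s)) s := by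
    intro η hη s
    rw [Function.comp_apply, hFY _ (hη s trivial).1]
    exact (hη s trivial).2
  have hc : ∀ {η : ℝ → X}, IsSolution S j Y η univ → Continuous (j ∘ η) := fun hη =>
    continuous_iff_continuousAt.2 fun s => (hη s trivial).2.continuousAt
  have h1 := dist_le_of_trajectories_ODE_of_mem (v := fun _ => F) (s := fun _ => j '' S) (K := L)
    (f := j ∘ γ) (g := j ∘ γ') (a := 0) (b := t) (δ := ‖j (γ 0) - j (γ' 0)‖)
    (fun _ _ => hF) (hc h).continuousOn (fun s _ => (key h s).hasDerivWithinAt)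
    (fun s _ => mem_image_of_mem j (h s trivial).1)
    (hc h').continuousOn (fun s _ => (key h' s).hasDerivWithinAt)
    (fun s _ => mem_image_of_mem j (h' s trivial).1) (by rw [dist_eq_norm]; rfl) t ⟨ht, le_rfl⟩
  rw [dist_eq_norm, sub_zero] at h1
  exact h1

theorem IsSolution.norm_sub_le (hj : InjOn j S)
    (hY : ∀ u ∈ S, ∀ z ∈ S, ‖Y u - Y z‖ ≤ L * ‖j u - j z‖) {γ γ' : ℝ → X}
    (h : IsSolution S j Y γ univ) (h' : IsSolution S j Y γ' univ) (t : ℝ) :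
    ‖j (γ t) - j (γ' t)‖ ≤ ‖j (γ 0) - j (γ' 0)‖ * Real.exp (L * |t|) := by
  rcases le_total 0 t with ht | ht
  · rw [abs_of_nonneg ht]
    exact norm_sub_le_of_nonneg hj hY h h' ht
  · have h1 := norm_sub_le_of_nonneg (Y := fun z => -Y z) (t := -t) hj (fun u hu z hz => by
      rw [neg_sub_neg, norm_sub_rev]
      exact hY u hu z hz) h.reverse h'.reverse (by linarith)
    rw [abs_of_nonpos ht]
    simpa using h1

/-- Solutions which exist for a uniform time exist for all times. -/
theorem exists_global_flow (hj : InjOn j S)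
    (hY : ∀ u ∈ S, ∀ z ∈ S, ‖Y u - Y z‖ ≤ L * ‖j u - j z‖) {ε : ℝ} (hε : 0 < ε)
    (hloc : ∀ u ∈ S, ∃ γ : ℝ → X, γ 0 = u ∧ IsSolution S j Y γ (Ioo (-ε) ε)) :
    ∃ ψ : ℝ → X → X, ∀ u ∈ S, ψ 0 u = u ∧ IsSolution S j Y (fun t => ψ t u) univ := by
  suffices h : ∀ u ∈ S, ∃ γ : ℝ → X, γ 0 = u ∧ IsSolution S j Y γ univ by
    classical
    choose! Γ hΓ using h
    exact ⟨fun t u => Γ u t, hΓ⟩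
  intro u hu
  choose! Γ hΓ0 hΓ using hloc
  -- `x n` is the position at the time `n δ`
  set δ := ε / 2 with hδ
  have hδ0 : 0 < δ := by positivity
  have hεδ : ε = δ + δ := by rw [hδ]; ring
  have hmem : ∀ t ∈ Ioo (-ε) ε, ∀ v ∈ S, Γ v t ∈ S := fun t ht v hv => (hΓ v hv t ht).1
  have hδm : δ ∈ Ioo (-ε) ε := ⟨by linarith, by linarith⟩
  have hδm' : -δ ∈ Ioo (-ε) ε := ⟨by linarith, by linarith⟩
  let x : ℤ → X := fun n => Int.rec (fun k => (fun v => Γ v δ)^[k] u)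
    (fun k => (fun v => Γ v (-δ))^[k + 1] u) n
  have hx : ∀ n, x n ∈ S := by
    rintro (k | k)
    · change (fun v => Γ v δ)^[k] u ∈ S
      exact Function.Iterate.rec (· ∈ S) hu (fun v hv => hmem δ hδm v hv) k
    · change (fun v => Γ v (-δ))^[k + 1] u ∈ S
      exact Function.Iterate.rec (· ∈ S) hu (fun v hv => hmem _ hδm' v hv) (k + 1)
  have hback : ∀ v ∈ S, Γ (Γ v (-δ)) δ = v := by
    intro v hv
    have h1 := (hΓ v hv).shift (-δ)
    have h2 : IsSolution S j Y (fun t => Γ v (t + -δ)) (Ioo (-δ) ε) := fun t ht =>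
      h1 t ⟨by linarith [ht.1], by linarith [ht.2]⟩
    have h3 : IsSolution S j Y (Γ (Γ v (-δ))) (Ioo (-δ) ε) := fun t ht =>
      hΓ _ (hmem _ hδm' v hv) t ⟨by linarith [ht.1], ht.2⟩
    have h4 := h3.eqOn hj hY h2 (t₀ := 0) ⟨by linarith, hε⟩ (by
      rw [hΓ0 _ (hmem _ hδm' v hv), zero_add]) (show δ ∈ Ioo (-δ) ε from ⟨by linarith, hδm.2⟩)
    exact h4.trans (by simp only [add_neg_cancel, hΓ0 v hv])
  have hsucc : ∀ n, x (n + 1) = Γ (x n) δ := by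
    rintro (k | k)
    · change (fun v => Γ v δ)^[k + 1] u = Γ ((fun v => Γ v δ)^[k] u) δ
      rw [Function.iterate_succ_apply']
    · rcases k with _ | k
      · exact (hback u hu).symm
      · have h1 : x (Int.negSucc (k + 1)) = Γ (x (Int.negSucc k)) (-δ) := by
          change (fun v => Γ v (-δ))^[k + 1 + 1] u = Γ ((fun v => Γ v (-δ))^[k + 1] u) (-δ)
          rw [Function.iterate_succ_apply']
        rw [h1, hback _ (hx (Int.negSucc k))]
        congr 1
  have hglue : ∀ n, EqOn (fun t => Γ (x n) (t + δ)) (Γ (x (n + 1))) (Ioo (-δ) δ) := by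
    intro n
    have h1 : IsSolution S j Y (fun t => Γ (x n) (t + δ)) (Ioo (-δ) δ) := fun t ht =>
      (hΓ _ (hx n)).shift δ t ⟨by linarith [ht.1], by linarith [ht.2]⟩
    have h2 : IsSolution S j Y (Γ (x (n + 1))) (Ioo (-δ) δ) := fun t ht =>
      hΓ _ (hx _) t ⟨by linarith [ht.1], by linarith [ht.2]⟩
    exact h1.eqOn hj hY h2 (t₀ := 0) ⟨by linarith, hδ0⟩ (by
      rw [zero_add, hΓ0 _ (hx _), hsucc])
  let γ : ℝ → X := fun t => Γ (x ⌊t / δ⌋) (t - δ * ⌊t / δ⌋)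
  have hγ : ∀ n : ℤ, ∀ t ∈ Ioo (δ * n - δ) (δ * n + δ), γ t = Γ (x n) (t - δ * n) := by
    intro n t ht
    rcases le_or_gt (δ * n) t with h | h
    · have hfl : ⌊t / δ⌋ = n := by
        rw [Int.floor_eq_iff, le_div_iff₀ hδ0, div_lt_iff₀ hδ0]
        constructor <;> nlinarith [ht.2]
      simp only [γ, hfl]
    · have hfl : ⌊t / δ⌋ = n - 1 := by
        rw [Int.floor_eq_iff, le_div_iff₀ hδ0, div_lt_iff₀ hδ0]
        push_cast
        constructor <;> nlinarith [ht.1]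
      have h1 := hglue (n - 1) (show t - δ * n ∈ Ioo (-δ) δ from
        ⟨by linarith [ht.1], by linarith [ht.2]⟩)
      rw [sub_add_cancel] at h1
      rw [← h1]
      simp only [γ, hfl]
      congr 1
      push_cast
      ring
  refine ⟨γ, ?_, ?_⟩
  · have := hγ 0 0 ⟨by simpa using hδ0, by simpa using hδ0⟩
    rw [this, Int.cast_zero, mul_zero, sub_zero]
    exact hΓ0 u hu
  · intro t _
    set n := ⌊t / δ⌋
    have h1 : (n : ℝ) ≤ t / δ := Int.floor_le _
    have h2 : t / δ < n + 1 := Int.lt_floor_add_one _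
    rw [le_div_iff₀ hδ0] at h1
    rw [div_lt_iff₀ hδ0] at h2
    have ht : t ∈ Ioo (δ * n - δ) (δ * n + δ) := ⟨by nlinarith, by nlinarith⟩
    have h3 : IsSolution S j Y (fun s => Γ (x n) (s - δ * n)) (Ioo (δ * n - δ) (δ * n + δ)) := by
      intro s hs
      have h4 := (hΓ _ (hx n)).shift (-(δ * n)) s
        ⟨by linarith [hs.1], by linarith [hs.2]⟩
      simpa only [← sub_eq_add_neg] using h4
    exact h3.congr (fun s hs => hγ n s hs) t ht

end EmbeddedFlow

namespace ExactEmbedding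

variable [FiniteDimensional ℝ W] (J : ExactEmbedding M W)

include J in
/-- Near a point where `f` is smooth, the integral curves of `H_f` exist for a uniform time and stay
in a given neighbourhood. -/
theorem exists_local_integralCurves {f : Cotangent M → ℝ} {u₀ : Cotangent M}
    (hf : ContMDiffAt cotModel 𝓘(ℝ, ℝ) ∞ f u₀) {O : Set (Cotangent M)} (hO : O ∈ 𝓝 u₀) :
    ∃ ε > 0, ∀ᶠ u in 𝓝 u₀, ∃ γ : ℝ → Cotangent M, γ 0 = u ∧ ∀ t ∈ Ioo (-ε) ε, γ t ∈ O ∧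
      HasMFDerivAt 𝓘(ℝ, ℝ) cotModel γ t
        ((1 : ℝ →L[ℝ] ℝ).smulRight (hamiltonianField f (γ t))) := by
  have hu₀ := mem_extChartAt_source (I := cotModel) u₀
  set y₀ := extChartAt cotModel u₀ u₀ with hy₀
  have h1 := (contDiffAt_loc (n := ⊤) hu₀ hf).fderiv_right (m := 1) (by norm_cast)
  have h3 : ContDiff ℝ 1 (fun D : Phase →L[ℝ] ℝ => flatHam D) := by fun_prop
  have hF : ContDiffAt ℝ 1 (fun y => flatHam (fderiv ℝ (loc u₀ f) y)) y₀ :=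
    h3.contDiffAt.comp _ h1
  obtain ⟨ε, hε, a, r, L, K, hr, hpl⟩ := IsPicardLindelof.of_contDiffAt_one hF
  obtain ⟨α, hα, hαc⟩ := (hpl 0).exists_forall_mem_closedBall_eq_hasDerivWithinAt_continuousOn
  simp only [zero_sub, zero_add] at hα hαc
  have hgood : ∀ᶠ y in 𝓝 y₀, y ∈ (extChartAt cotModel u₀).target ∧
      ((extChartAt cotModel u₀).symm y ∈ O ∧
        ContMDiffAt cotModel 𝓘(ℝ, ℝ) 1 f ((extChartAt cotModel u₀).symm y)) := by
    refine Filter.Eventually.and (extChartAt_target_mem_nhds (I := cotModel) u₀) ?_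
    have h5 := (continuousAt_extChartAt_symm (I := cotModel) u₀).tendsto
    rw [extChartAt_to_inv] at h5
    exact h5.eventually ((show ∀ᶠ u in 𝓝 u₀, u ∈ O from hO).and (eventually_contMDiffAt_one hf))
  have hr0 : (0 : ℝ) < r := hr
  have hnhds : Metric.closedBall y₀ (r : ℝ) ×ˢ Icc (-ε) ε ∈ 𝓝 (y₀, (0 : ℝ)) :=
    prod_mem_nhds (Metric.closedBall_mem_nhds y₀ hr0) (Icc_mem_nhds (by linarith) hε)
  have hαc0 : Tendsto α (𝓝 (y₀, 0)) (𝓝 y₀) := by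
    have h6 := (hαc.continuousAt hnhds).tendsto
    rwa [(hα y₀ (Metric.mem_closedBall_self hr0.le)).1] at h6
  have h7 := (hαc0.eventually hgood).and hnhds
  rw [nhds_prod_eq] at h7
  obtain ⟨A, hA, B, hB, hAB⟩ := eventually_prod_iff.1 h7
  obtain ⟨δ, hδ, hδB⟩ := Metric.mem_nhds_iff.1 hB
  rw [Real.ball_eq_Ioo, zero_sub, zero_add] at hδB
  refine ⟨min δ ε, lt_min hδ hε, ?_⟩
  filter_upwards [(continuousAt_extChartAt (I := cotModel) u₀).eventually hA,
    extChartAt_cotangent_source_mem_nhds hu₀,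
    (continuousAt_extChartAt (I := cotModel) u₀).eventually
      (Metric.closedBall_mem_nhds y₀ hr0)] with u hu hus hur
  refine ⟨fun t => (extChartAt cotModel u₀).symm (α (extChartAt cotModel u₀ u, t)), ?_, ?_⟩
  · change (extChartAt cotModel u₀).symm (α (extChartAt cotModel u₀ u, 0)) = u
    have h8 := (hα _ hur).1
    exact (congrArg _ h8).trans ((extChartAt cotModel u₀).left_inv hus)
  · intro t ht
    have htδ : t ∈ Ioo (-δ) δ :=
      ⟨by linarith [ht.1, min_le_left δ ε], by linarith [ht.2, min_le_left δ ε]⟩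
    have htε : t ∈ Ioo (-ε) ε :=
      ⟨by linarith [ht.1, min_le_right δ ε], by linarith [ht.2, min_le_right δ ε]⟩
    obtain ⟨⟨htar, hmem, hsm⟩, -⟩ := hAB hu (hδB htδ)
    set c : ℝ → Phase := fun t => α (extChartAt cotModel u₀ u, t) with hc
    set z := (extChartAt cotModel u₀).symm (c t) with hz
    have hzs : z ∈ (extChartAt cotModel u₀).source := (extChartAt cotModel u₀).map_target htar
    have hzc : extChartAt cotModel u₀ z = c t := (extChartAt cotModel u₀).right_inv htar
    have hcd : HasDerivAt c (flatHam (fderiv ℝ (loc u₀ f) (c t))) t :=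
      ((hα _ hur).2 t ⟨htε.1.le, htε.2.le⟩).hasDerivAt (Icc_mem_nhds htε.1 htε.2)
    refine ⟨hmem, ?_⟩
    rw [hamiltonianField_eq]
    refine J.hasMFDerivAt_curve (w := flatHam (der f z)) ?_ ?_
    · have h9 : ContinuousAt (extChartAt cotModel u₀).symm (c t) :=
        continuousAt_extChartAt_symm'' htar
      exact ContinuousAt.comp (f := c) h9 hcd.continuousAt
    · have hJ : ContMDiffAt cotModel 𝓘(ℝ, W × (W →L[ℝ] ℝ)) 1 J.emb z :=
        (J.contMDiff_emb z).of_le (by simp)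
      have h10 := J.bracket_eq_loc hzs hsm hJ
      rw [bracket, hzc] at h10
      change HasDerivAt (loc u₀ J.emb ∘ c) (der J.emb z (flatHam (der f z))) t
      rw [h10]
      have h11 := contDiffAt_loc (n := 1) hzs hJ
      rw [hzc] at h11
      exact (h11.differentiableAt (by simp)).hasFDerivAt.comp_hasDerivAt t hcd

end ExactEmbedding

end

section

/-! ### Dilations and homogeneous functions -/

theorem contMDiffAt_scale {E H X : Type*} [NormedAddCommGroup E] [NormedSpace ℝ E]
    [TopologicalSpace H] {I : ModelWithCorners ℝ E H} [TopologicalSpace X] [ChartedSpace H X]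
    {c : X → ℝ} {f : X → Cotangent M} {x : X} (hc : ContMDiffAt I 𝓘(ℝ, ℝ) ∞ c x)
    (hf : ContMDiffAt I cotModel ∞ f x) :
    ContMDiffAt I cotModel ∞ (fun y => scale (c y) (f y)) x := by
  rw [Bundle.contMDiffAt_totalSpace] at hf ⊢
  refine ⟨hf.1, ?_⟩
  have h1 : ContMDiffAt I 𝓘(ℝ, CoPlane) ∞ (fun y => c y • fiberCoord (f x).1 (f y)) x :=
    hc.smul hf.2
  refine h1.congr_of_eventuallyEq (Eventually.of_forall fun y => ?_)
  exact fiberCoord_scale (f x).1 (c y) (f y)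

theorem continuous_scale : Continuous (fun q : ℝ × Cotangent M => scale q.1 q.2) := by
  rw [continuous_iff_continuousAt]
  intro q
  rw [FiberBundle.continuousAt_totalSpace]
  have h0 : ContinuousAt (fun q : ℝ × Cotangent M => q.2) q := continuousAt_snd
  rw [FiberBundle.continuousAt_totalSpace] at h0
  refine ⟨h0.1, ?_⟩
  have h1 : ContinuousAt (fun p : ℝ × Cotangent M => p.1 • fiberCoord q.2.1 p.2) q :=
    continuousAt_fst.smul h0.2
  exact h1.congr (Eventually.of_forall fun p => (fiberCoord_scale q.2.1 p.1 p.2).symm)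

theorem scale_one (v : Cotangent M) : scale 1 v = v := by
  simp [scale]

theorem scale_scale (s t : ℝ) (v : Cotangent M) : scale s (scale t v) = scale (s * t) v :=
  congrArg (fun η : TangentSpace (𝓡 2) v.1 →L[ℝ] ℝ => (⟨v.1, η⟩ : Cotangent M))
    (smul_smul s t (show TangentSpace (𝓡 2) v.1 →L[ℝ] ℝ from v.2))

theorem scale_mem_nonzero {t : ℝ} (ht : t ≠ 0) {v : Cotangent M} (hv : v ∈ nonzero M) :
    scale t v ∈ nonzero M := smul_ne_zero ht hv

theorem der_comp_scale {t : ℝ} {v : Cotangent M} {h : Cotangent M → V}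
    (hh : ContMDiffAt cotModel 𝓘(ℝ, V) 1 h (scale t v)) :
    der (fun u => h (scale t u)) v = (der h (scale t v)).comp
      (show Phase →L[ℝ] Phase from mfderiv cotModel cotModel (scale t) v) := by
  have h1 : ContMDiffAt cotModel cotModel ∞ (scale t : Cotangent M → Cotangent M) v :=
    contMDiffAt_scale contMDiffAt_const contMDiffAt_id
  exact mfderiv_comp v (hh.mdifferentiableAt (by simp)) (h1.mdifferentiableAt (by simp))

theorem der_congr {h h' : Cotangent M → V} {v : Cotangent M} (he : h =ᶠ[𝓝 v] h') :
    der h v = der h' v := he.mfderiv_eq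

theorem der_const_smul {h : Cotangent M → V} {v : Cotangent M} (c : ℝ)
    (hh : ContMDiffAt cotModel 𝓘(ℝ, V) 1 h v) : der (fun u => c • h u) v = c • der h v :=
  der_eq_of_hasFDerivAt_loc
    ((contMDiffAt_const (I := cotModel) (I' := 𝓘(ℝ, ℝ)) (c := c)).smul hh)
    ((hasFDerivAt_loc v hh).const_smul c)

theorem der_mul {h k : Cotangent M → ℝ} {v : Cotangent M}
    (hh : ContMDiffAt cotModel 𝓘(ℝ, ℝ) 1 h v) (hk : ContMDiffAt cotModel 𝓘(ℝ, ℝ) 1 k v) :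
    der (fun u => h u * k u) v = h v • der k v + k v • der h v := by
  have h1 := (hasFDerivAt_loc v hh).mul (hasFDerivAt_loc v hk)
  rw [loc_self, loc_self] at h1
  exact der_eq_of_hasFDerivAt_loc (hh.mul hk) h1

theorem der_clm_apply {h : Cotangent M → V →L[ℝ] ℝ} {k : Cotangent M → V} {v : Cotangent M}
    (hh : ContMDiffAt cotModel 𝓘(ℝ, V →L[ℝ] ℝ) 1 h v) (hk : ContMDiffAt cotModel 𝓘(ℝ, V) 1 k v)
    (w : Phase) : der (fun u => h u (k u)) v w = der h v w (k v) + h v (der k v w) := by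
  have h1 := (hasFDerivAt_loc v hh).clm_apply (hasFDerivAt_loc v hk)
  rw [loc_self, loc_self] at h1
  rw [der_eq_of_hasFDerivAt_loc (hh.clm_apply hk) h1]
  simp only [add_apply, ContinuousLinearMap.comp_apply, ContinuousLinearMap.flip_apply]
  ring

theorem der_clm_comp {V' : Type*} [NormedAddCommGroup V'] [NormedSpace ℝ V'] (l : V →L[ℝ] V')
    {k : Cotangent M → V} {v : Cotangent M} (hk : ContMDiffAt cotModel 𝓘(ℝ, V) 1 k v) :
    der (fun u => l (k u)) v = l.comp (der k v) :=
  der_eq_of_hasFDerivAt_loc (l.contDiff.contMDiff.contMDiffAt.comp v hk)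
    (l.hasFDerivAt.comp _ (hasFDerivAt_loc v hk))

/-- A smooth function on `T*M \ 0`, homogeneous of degree zero. -/
structure IsSymbol (P : Cotangent M → ℝ) : Prop where
  smooth : ∀ v ∈ nonzero M, ContMDiffAt cotModel 𝓘(ℝ, ℝ) ∞ P v
  homog : ∀ v ∈ nonzero M, ∀ t : ℝ, 0 < t → P (scale t v) = P v

theorem IsSymbol.neg {P : Cotangent M → ℝ} (hP : IsSymbol P) : IsSymbol fun v => -P v :=
  ⟨fun v hv => (hP.smooth v hv).neg, fun v hv t ht => by rw [hP.homog v hv t ht]⟩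

variable (g : Metric M) (P : Cotangent M → ℝ)

/-- The function `|ξ| P`, homogeneous of degree one. -/
def ham (v : Cotangent M) : ℝ := conorm g v * P v

/-- The logarithmic derivative of `|ξ|` along the Hamiltonian flow of `|ξ| P`. -/
def growth (v : Cotangent M) : ℝ := bracket (ham g P) (conorm g) v / conorm g v

/-- The projection of the Hamiltonian field of `|ξ| P` to the unit cosphere bundle along the
radial field. -/
def normField (v : Cotangent M) : Phase := flatHam (der (ham g P) v) - growth g P v • radial v

variable {P} (hP : IsSymbol P)
include hP

theorem contMDiffAt_ham {v : Cotangent M} (hv : v ∈ nonzero M) :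
    ContMDiffAt cotModel 𝓘(ℝ, ℝ) ∞ (ham g P) v :=
  (contMDiffAt_conorm g hv).mul (hP.smooth v hv)

theorem ham_scale {v : Cotangent M} (hv : v ∈ nonzero M) {t : ℝ} (ht : 0 < t) :
    ham g P (scale t v) = t * ham g P v := by
  rw [ham, ham, hP.homog v hv t ht, conorm_scale g ht.le]
  ring

omit hP in
theorem der_conorm_radial {v : Cotangent M} (hv : v ∈ nonzero M) :
    der (conorm g) v (radial v) = conorm g v := by
  have h1 := hasDerivAt_scale ((contMDiffAt_conorm g hv).of_le (m := 1) (by simp))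
  have h2 : HasDerivAt (fun s : ℝ => s * conorm g v) (conorm g v) 1 := by
    simpa using (hasDerivAt_id (1 : ℝ)).mul_const (conorm g v)
  refine h1.unique (h2.congr_of_eventuallyEq ?_)
  filter_upwards [lt_mem_nhds (zero_lt_one' ℝ)] with s hs
  exact conorm_scale g hs.le v

theorem der_symbol_radial {v : Cotangent M} (hv : v ∈ nonzero M) : der P v (radial v) = 0 := by
  have h1 := hasDerivAt_scale ((hP.smooth v hv).of_le (m := 1) (by simp))
  refine h1.unique ((hasDerivAt_const 1 (P v)).congr_of_eventuallyEq ?_)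
  filter_upwards [lt_mem_nhds (zero_lt_one' ℝ)] with s hs
  exact hP.homog v hv s hs

theorem der_ham {v : Cotangent M} (hv : v ∈ nonzero M) :
    der (ham g P) v = conorm g v • der P v + P v • der (conorm g) v :=
  der_mul ((contMDiffAt_conorm g hv).of_le (by simp)) ((hP.smooth v hv).of_le (by simp))

theorem der_ham_radial {v : Cotangent M} (hv : v ∈ nonzero M) :
    der (ham g P) v (radial v) = ham g P v := by
  rw [der_ham g hP hv]
  simp only [add_apply, smul_apply, smul_eq_mul]
  rw [der_symbol_radial hP hv, der_conorm_radial g hv, ham]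
  ring

theorem bracket_symbol {v : Cotangent M} (hv : v ∈ nonzero M) :
    bracket (ham g P) P v = -(growth g P v * P v) := by
  have h1 := flatHam_spec (der (ham g P) v) (flatHam (der (ham g P) v))
  rw [sub_self, der_ham g hP hv] at h1
  simp only [add_apply, smul_apply, smul_eq_mul] at h1
  rw [← der_ham g hP hv] at h1
  have hN := (conorm_pos g hv).ne'
  rw [growth, bracket, bracket]
  field_simp
  linarith

omit hP in
theorem der_conorm_normField {v : Cotangent M} (hv : v ∈ nonzero M) :
    der (conorm g) v (normField g P v) = 0 := by
  rw [normField, map_sub, map_smul, der_conorm_radial g hv, growth, smul_eq_mul,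
    div_mul_cancel₀ _ (conorm_pos g hv).ne']
  exact sub_self _

theorem der_symbol_normField {v : Cotangent M} (hv : v ∈ nonzero M) :
    der P v (normField g P v) = -(growth g P v * P v) := by
  rw [normField, map_sub, map_smul, der_symbol_radial hP hv, smul_zero, sub_zero]
  exact bracket_symbol g hP hv

omit hP in
theorem radial_ne_zero (g : Metric M) {v : Cotangent M} (hv : v ∈ nonzero M) : radial v ≠ 0 := by
  intro h
  have h1 := der_conorm_radial g hv
  rw [h, map_zero] at h1
  exact (conorm_pos g hv).ne h1

theorem normField_neg {v : Cotangent M} (hv : v ∈ nonzero M) :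
    normField g (fun u => -P u) v = -normField g P v ∧
      growth g (fun u => -P u) v = -growth g P v := by
  have h1 : der (ham g fun u => -P u) v = -der (ham g P) v := by
    have h2 : (ham g fun u => -P u) = fun u => (-1 : ℝ) • ham g P u := by
      ext u
      simp [ham]
    rw [h2, der_const_smul _ ((contMDiffAt_ham g hP hv).of_le (by simp))]
    exact neg_one_smul ℝ (der (ham g P) v)
  have h0 : ∀ D : Phase →L[ℝ] ℝ, flatHam (-D) = -flatHam D := fun D => map_neg flatHam D
  have h3 : growth g (fun u => -P u) v = -growth g P v := by
    rw [growth, growth, bracket, bracket, h1, h0,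
      show ∀ w, der (conorm g) v (-w) = -der (conorm g) v w from fun w => map_neg _ w, neg_div]
  refine ⟨?_, h3⟩
  rw [normField, normField, h1, h3, h0]
  module

namespace ExactEmbedding

variable (J : ExactEmbedding M W)

omit hP

theorem base_scale (t : ℝ) (v : Cotangent M) : J.base (scale t v) = J.base v := rfl

theorem der_base_radial (v : Cotangent M) : der J.base v (radial v) = 0 :=
  (hasDerivAt_scale ((J.contMDiff_base v).of_le (by simp))).unique (hasDerivAt_const 1 (J.base v))

theorem der_mom_radial (v : Cotangent M) : der J.mom v (radial v) = J.mom v := by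
  refine (hasDerivAt_scale ((J.contMDiff_mom v).of_le (by simp))).unique ?_
  simp only [J.mom_scale]
  simpa using (hasDerivAt_id (1 : ℝ)).smul_const (J.mom v)

/-- The canonical one-form is the contraction of the symplectic form with the radial field. -/
theorem mom_der_base (v : Cotangent M) (w : Phase) :
    J.mom v (der J.base v w) = (radial v).2 w.1 - w.2 (radial v).1 := by
  rw [J.symplectic_eq v, der_base_radial, der_mom_radial, map_zero, sub_zero]

theorem der_emb (v : Cotangent M) (w : Phase) :
    der J.emb v w = (der J.base v w, der J.mom v w) :=
  congrArg (fun L : Phase →L[ℝ] W × (W →L[ℝ] ℝ) => L w)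
    (der_prodMk ((J.contMDiff_base v).of_le (by simp)) ((J.contMDiff_mom v).of_le (by simp)))

include hP in
theorem mom_bracket_base {v : Cotangent M} (hv : v ∈ nonzero M) :
    J.mom v (bracket (ham g P) J.base v) = ham g P v := by
  rw [bracket, J.mom_der_base]
  exact (flatHam_spec _ _).trans (der_ham_radial g hP hv)

theorem der_base_normField {v : Cotangent M} :
    der J.base v (normField g P v) = bracket (ham g P) J.base v := by
  rw [normField, map_sub, map_smul, der_base_radial, smul_zero, sub_zero, bracket]

theorem der_mom_normField {v : Cotangent M} :
    der J.mom v (normField g P v) = bracket (ham g P) J.mom v - growth g P v • J.mom v := by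
  rw [normField, map_sub, map_smul, der_mom_radial, bracket]

include hP in
/-- The Lie derivative of the canonical one-form along `H_f` vanishes for `f` homogeneous of
degree one. -/
theorem bracket_mom_add {v : Cotangent M} (hv : v ∈ nonzero M) (w : Phase) :
    bracket (ham g P) J.mom v (der J.base v w) +
      J.mom v (der (bracket (ham g P) J.base) v w) = 0 := by
  have hF := contMDiffAt_ham g hP hv
  have h1 := der_clm_apply ((J.contMDiff_mom v).of_le (by simp))
    ((J.contMDiffAt_bracket hF (J.contMDiff_base v)).of_le (by simp)) w
  have h2 : (fun u => J.mom u (bracket (ham g P) J.base u)) =ᶠ[𝓝 v] ham g P := by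
    filter_upwards [(isOpen_nonzero g).mem_nhds hv] with u hu using J.mom_bracket_base g hP hu
  rw [der_congr h2] at h1
  have h3 := J.symplectic_eq v w (flatHam (der (ham g P) v))
  rw [flatHam_spec, h1] at h3
  change der J.mom v (flatHam (der (ham g P) v)) (der J.base v w) + _ = 0
  rw [bracket] at h3
  linarith

include J in
/-- Dilations are conformally symplectic; hence they preserve the Hamiltonian fields of functions
which are homogeneous of degree one. -/
theorem bracket_scale {f : Cotangent M → ℝ} {h : Cotangent M → V} {v : Cotangent M} {t c : ℝ}
    (ht : 0 < t) (hf : ContMDiffAt cotModel 𝓘(ℝ, ℝ) 1 f (scale t v))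
    (hf' : ContMDiffAt cotModel 𝓘(ℝ, ℝ) 1 f v)
    (hfs : ∀ᶠ u in 𝓝 v, f (scale t u) = t * f u)
    (hh : ContMDiffAt cotModel 𝓘(ℝ, V) 1 h (scale t v))
    (hh' : ContMDiffAt cotModel 𝓘(ℝ, V) 1 h v)
    (hhs : ∀ᶠ u in 𝓝 v, h (scale t u) = c • h u) :
    bracket f h (scale t v) = c • bracket f h v := by
  set D : Phase →L[ℝ] Phase := mfderiv cotModel cotModel (scale t) v with hD
  have hb : (der J.base (scale t v)).comp D = der J.base v := by
    rw [← der_comp_scale ((J.contMDiff_base _).of_le (by simp))]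
    rfl
  have hm : (der J.mom (scale t v)).comp D = t • der J.mom v := by
    rw [← der_comp_scale ((J.contMDiff_mom _).of_le (by simp)),
      ← der_const_smul _ ((J.contMDiff_mom _).of_le (by simp))]
    simp only [J.mom_scale]
  have hff : (der f (scale t v)).comp D = t • der f v := by
    rw [← der_comp_scale hf, ← der_const_smul _ hf']
    exact der_congr hfs
  have hhh : (der h (scale t v)).comp D = c • der h v := by
    rw [← der_comp_scale hh, ← der_const_smul _ hh']
    exact der_congr hhs
  have hω : ∀ w w', (D w).2 (D w').1 - (D w').2 (D w).1 = t * (w.2 w'.1 - w'.2 w.1) := by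
    intro w w'
    rw [J.symplectic_eq, J.symplectic_eq]
    have e1 : ∀ w, der J.base (scale t v) (D w) = der J.base v w := fun w =>
      congrArg (fun L : Phase →L[ℝ] W => L w) hb
    have e2 : ∀ w, der J.mom (scale t v) (D w) = t • der J.mom v w := fun w =>
      congrArg (fun L : Phase →L[ℝ] W →L[ℝ] ℝ => L w) hm
    rw [e1, e1, e2, e2]
    simp only [smul_apply, smul_eq_mul]
    ring
  have hinj : Function.Injective D := by
    rw [injective_iff_map_eq_zero]
    intro w hw
    refine phase_ext (z' := 0) fun w' => ?_
    have h1 := hω w' w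
    rw [hw] at h1
    simp only [Prod.fst_zero, Prod.snd_zero, map_zero, zero_apply, sub_zero] at h1 ⊢
    exact (mul_eq_zero.1 h1.symm).resolve_left ht.ne'
  have hsurj : Function.Surjective D := LinearMap.injective_iff_surjective.1 hinj
  have hH : D (flatHam (der f v)) = flatHam (der f (scale t v)) := by
    refine phase_ext fun w' => ?_
    obtain ⟨w, rfl⟩ := hsurj w'
    rw [hω, flatHam_spec, flatHam_spec]
    exact (congrArg (fun L : Phase →L[ℝ] ℝ => L w) hff).symm
  rw [bracket, bracket, ← hH]
  exact congrArg (fun L : Phase →L[ℝ] V => L (flatHam (der f v))) hhh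

include J hP in
theorem growth_scale {v : Cotangent M} (hv : v ∈ nonzero M) {t : ℝ} (ht : 0 < t) :
    growth g P (scale t v) = growth g P v := by
  have hv' := scale_mem_nonzero ht.ne' hv
  have hnear := (isOpen_nonzero g).mem_nhds hv
  have h1 := J.bracket_scale (f := ham g P) (h := conorm g) (c := t) ht
    ((contMDiffAt_ham g hP hv').of_le (by simp)) ((contMDiffAt_ham g hP hv).of_le (by simp))
    (by filter_upwards [hnear] with u hu using ham_scale g hP hu ht)
    ((contMDiffAt_conorm g hv').of_le (by simp)) ((contMDiffAt_conorm g hv).of_le (by simp))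
    (Eventually.of_forall fun u => conorm_scale g ht.le u)
  rw [growth, growth, h1, conorm_scale g ht.le, smul_eq_mul, mul_div_mul_left _ _ ht.ne']

include hP in
theorem bracket_base_scale {v : Cotangent M} (hv : v ∈ nonzero M) {t : ℝ} (ht : 0 < t) :
    bracket (ham g P) J.base (scale t v) = bracket (ham g P) J.base v := by
  have hv' := scale_mem_nonzero ht.ne' hv
  have hnear := (isOpen_nonzero g).mem_nhds hv
  have h1 := J.bracket_scale (f := ham g P) (h := J.base) (c := 1) ht
    ((contMDiffAt_ham g hP hv').of_le (by simp)) ((contMDiffAt_ham g hP hv).of_le (by simp))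
    (by filter_upwards [hnear] with u hu using ham_scale g hP hu ht)
    ((J.contMDiff_base _).of_le (by simp)) ((J.contMDiff_base _).of_le (by simp))
    (Eventually.of_forall fun u => by rw [one_smul, base_scale])
  rw [h1, one_smul]

include hP in
theorem bracket_mom_scale {v : Cotangent M} (hv : v ∈ nonzero M) {t : ℝ} (ht : 0 < t) :
    bracket (ham g P) J.mom (scale t v) = t • bracket (ham g P) J.mom v := by
  have hv' := scale_mem_nonzero ht.ne' hv
  have hnear := (isOpen_nonzero g).mem_nhds hv
  exact J.bracket_scale (f := ham g P) (h := J.mom) (c := t) ht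
    ((contMDiffAt_ham g hP hv').of_le (by simp)) ((contMDiffAt_ham g hP hv).of_le (by simp))
    (by filter_upwards [hnear] with u hu using ham_scale g hP hu ht)
    ((J.contMDiff_mom _).of_le (by simp)) ((J.contMDiff_mom _).of_le (by simp))
    (Eventually.of_forall fun u => J.mom_scale t u)

include J hP in
theorem contMDiffAt_growth {v : Cotangent M} (hv : v ∈ nonzero M) :
    ContMDiffAt cotModel 𝓘(ℝ, ℝ) ∞ (growth g P) v :=
  (J.contMDiffAt_bracket (contMDiffAt_ham g hP hv) (contMDiffAt_conorm g hv)).div₀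
    (contMDiffAt_conorm g hv) (conorm_pos g hv).ne'

include hP in
theorem contMDiffAt_der_emb_normField {v : Cotangent M} (hv : v ∈ nonzero M) :
    ContMDiffAt cotModel 𝓘(ℝ, W × (W →L[ℝ] ℝ)) ∞
      (fun u => der J.emb u (normField g P u)) v := by
  have h1 := J.contMDiffAt_bracket (contMDiffAt_ham g hP hv) (J.contMDiff_base v)
  have h2 := J.contMDiffAt_bracket (contMDiffAt_ham g hP hv) (J.contMDiff_mom v)
  have h3 := h1.prodMk_space
    (h2.sub ((J.contMDiffAt_growth g hP hv).smul (J.contMDiff_mom v)))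
  refine h3.congr_of_eventuallyEq (Eventually.of_forall fun u => ?_)
  change der J.emb u (normField g P u) = (bracket (ham g P) J.base u,
    bracket (ham g P) J.mom u - growth g P u • J.mom u)
  rw [der_emb, der_base_normField, der_mom_normField]

end ExactEmbedding

end

section

/-! ### Uniform estimates on compact sets -/

theorem exists_uniform_bound {X : Type*} [TopologicalSpace X] {s : Set X} (hs : IsCompact s)
    {R Q : X → ℝ} (hQ : ∀ x ∈ s, 0 ≤ Q x)
    (hloc : ∀ x ∈ s, ∃ K : ℝ, 0 ≤ K ∧ ∀ᶠ y in 𝓝 x, y ∈ s → R y ≤ K * Q y) :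
    ∃ K : ℝ, 0 ≤ K ∧ ∀ y ∈ s, R y ≤ K * Q y := by
  suffices h : ∃ K : ℝ, 0 ≤ K ∧ ∀ y ∈ s, y ∈ s → R y ≤ K * Q y by
    obtain ⟨K, hK, h⟩ := h
    exact ⟨K, hK, fun y hy => h y hy hy⟩
  refine hs.induction_on (p := fun t => ∃ K : ℝ, 0 ≤ K ∧ ∀ y ∈ t, y ∈ s → R y ≤ K * Q y)
    ⟨0, le_rfl, by simp⟩ ?_ ?_ ?_
  · rintro t t' htt' ⟨K, hK, h⟩
    exact ⟨K, hK, fun y hy => h y (htt' hy)⟩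
  · rintro t t' ⟨K, hK, h⟩ ⟨K', hK', h'⟩
    refine ⟨K + K', add_nonneg hK hK', ?_⟩
    rintro y (hy | hy) hys
    · nlinarith [h y hy hys, mul_nonneg hK' (hQ y hys)]
    · nlinarith [h' y hy hys, mul_nonneg hK (hQ y hys)]
  · intro x hx
    obtain ⟨K, hK, h⟩ := hloc x hx
    exact ⟨_, mem_nhdsWithin_of_mem_nhds h, K, hK, fun y hy => hy⟩

/-- An estimate `R ≤ K Q` on a compact set of pairs, where `Q` is positive off the diagonal, has to
be checked near the diagonal only. -/
theorem exists_uniform_bound_of_diagonal {X : Type*} [TopologicalSpace X] {s : Set (X × X)}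
    (hs : IsCompact s) {R Q : X × X → ℝ} (hQ : ∀ x ∈ s, 0 ≤ Q x) (hQc : ContinuousOn Q s)
    (hpos : ∀ p ∈ s, p.1 ≠ p.2 → 0 < Q p) (hR : ∃ C, ∀ p ∈ s, R p ≤ C)
    (hdiag : ∀ z, (z, z) ∈ s → ∃ K : ℝ, 0 ≤ K ∧ ∀ᶠ p in 𝓝 (z, z), p ∈ s → R p ≤ K * Q p) :
    ∃ K : ℝ, 0 ≤ K ∧ ∀ p ∈ s, R p ≤ K * Q p := by
  refine exists_uniform_bound hs hQ ?_
  rintro ⟨z, u⟩ hp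
  by_cases hzu : z = u
  · subst hzu
    exact hdiag z hp
  · obtain ⟨C, hC⟩ := hR
    have h0 := hpos _ hp hzu
    have h1 : ∀ᶠ y in 𝓝[s] (z, u), Q (z, u) / 2 < Q y :=
      (hQc _ hp).eventually (lt_mem_nhds (by linarith))
    rw [eventually_nhdsWithin_iff] at h1
    refine ⟨|C| / (Q (z, u) / 2), by positivity, ?_⟩
    filter_upwards [h1] with y hy hys
    calc R y ≤ |C| := (hC y hys).trans (le_abs_self C)
      _ = |C| / (Q (z, u) / 2) * (Q (z, u) / 2) := by field_simp
      _ ≤ _ := by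
        gcongr
        exact (hy hys).le

namespace ExactEmbedding

variable (J : ExactEmbedding M W) {S : Set (Cotangent M)}

theorem norm_emb_sub_pos {p : Cotangent M × Cotangent M} (hp : p.1 ≠ p.2) :
    0 < ‖J.emb p.1 - J.emb p.2‖ :=
  norm_pos_iff.2 (sub_ne_zero.2 fun h => hp (J.injective_emb h))

theorem continuous_norm_emb_sub :
    Continuous fun p : Cotangent M × Cotangent M => ‖J.emb p.1 - J.emb p.2‖ :=
  ((J.contMDiff_emb.continuous.comp continuous_fst).sub
    (J.contMDiff_emb.continuous.comp continuous_snd)).norm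

variable [FiniteDimensional ℝ W]

/-- Smooth functions are Lipschitz on compact sets, with respect to the distance of the exact
embedding. -/
theorem exists_lipschitz (hS : IsCompact S) {h : Cotangent M → V}
    (hh : ∀ z ∈ S, ContMDiffAt cotModel 𝓘(ℝ, V) ∞ h z) :
    ∃ K : ℝ, 0 ≤ K ∧ ∀ u ∈ S, ∀ z ∈ S, ‖h u - h z‖ ≤ K * ‖J.emb u - J.emb z‖ := by
  obtain ⟨C, hC⟩ := hS.exists_bound_of_continuousOn
    fun z hz => (hh z hz).continuousAt.continuousWithinAt
  obtain ⟨K, hK, h1⟩ := exists_uniform_bound_of_diagonal (hS.prod hS)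
    (R := fun p => ‖h p.1 - h p.2‖) (Q := fun p => ‖J.emb p.1 - J.emb p.2‖)
    (fun p _ => norm_nonneg _) J.continuous_norm_emb_sub.continuousOn
    (fun p _ hp => J.norm_emb_sub_pos hp)
    ⟨C + C, fun p hp => (norm_sub_le _ _).trans (add_le_add (hC _ hp.1) (hC _ hp.2))⟩ (by
      intro z hz
      obtain ⟨K₁, hK₁, h1⟩ := eventually_norm_sub_le (hh z hz.1)
      obtain ⟨K₂, hK₂, h2⟩ := eventually_norm_sub_le_of_immersion (J.contMDiff_emb z)
        (J.injective_der_emb z)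
      refine ⟨K₁ * K₂, mul_nonneg hK₁ hK₂, ?_⟩
      filter_upwards [h1, h2] with p hp1 hp2 _
      refine hp1.trans ?_
      rw [mul_assoc]
      gcongr)
  exact ⟨K, hK, fun u hu z hz => h1 (u, z) ⟨hu, hz⟩⟩

/-- A family `β z` of linear forms with `β z ∘ dh = 0` at `z` is quadratically small on the
increments of `h`. -/
theorem exists_quadratic (hS : IsCompact S) {h : Cotangent M → V} {β : Cotangent M → V →L[ℝ] ℝ}
    (hh : ∀ z ∈ S, ContMDiffAt cotModel 𝓘(ℝ, V) ∞ h z) (hβ : ∃ B, ∀ z ∈ S, ‖β z‖ ≤ B)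
    (hβ0 : ∀ z ∈ S, ∀ w, β z (der h z w) = 0) :
    ∃ K : ℝ, 0 ≤ K ∧ ∀ z ∈ S, ∀ u ∈ S, |β z (h u - h z)| ≤ K * ‖J.emb z - J.emb u‖ ^ 2 := by
  obtain ⟨C, hC⟩ := hS.exists_bound_of_continuousOn
    fun z hz => (hh z hz).continuousAt.continuousWithinAt
  obtain ⟨B, hB⟩ := hβ
  obtain ⟨K, hK, h1⟩ := exists_uniform_bound_of_diagonal (hS.prod hS)
    (R := fun p => |β p.1 (h p.2 - h p.1)|) (Q := fun p => ‖J.emb p.1 - J.emb p.2‖ ^ 2)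
    (fun p _ => sq_nonneg _) (J.continuous_norm_emb_sub.pow 2).continuousOn
    (fun p _ hp => pow_pos (J.norm_emb_sub_pos hp) 2)
    ⟨B * (C + C), fun p hp => ((β p.1).le_opNorm _).trans
      (mul_le_mul (hB _ hp.1) ((norm_sub_le _ _).trans (add_le_add (hC _ hp.2) (hC _ hp.1)))
        (norm_nonneg _) ((norm_nonneg _).trans (hB _ hp.1)))⟩ (by
      intro z hz
      obtain ⟨K₁, hK₁, h1⟩ := eventually_abs_le_sq (hh z hz.1)
      obtain ⟨K₂, hK₂, h2⟩ := eventually_norm_sub_le_of_immersion (J.contMDiff_emb z)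
        (J.injective_der_emb z)
      have hB0 : 0 ≤ B := (norm_nonneg _).trans (hB z hz.1)
      refine ⟨K₁ * B * K₂ ^ 2, by positivity, ?_⟩
      filter_upwards [h1, h2] with p hp1 hp2 hp
      refine (hp1 (β p.1) (hβ0 p.1 hp.1)).trans ?_
      calc _ ≤ K₁ * B * (K₂ * ‖J.emb p.1 - J.emb p.2‖) ^ 2 := by
            gcongr
            exact hB _ hp.1
        _ = _ := by ring)
  exact ⟨K, hK, fun z hz u hu => h1 (z, u) ⟨hz, hu⟩⟩

end ExactEmbedding

/-! ### The flow on the unit cosphere bundle -/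

section Kappa

variable (g : Metric M)

theorem kappa_mem {v : Cotangent M} (hv : v ∈ nonzero M) : kappa g v ∈ cosphere g := by
  have h := conorm_pos g hv
  change conorm g (scale _ v) = 1
  rw [conorm_scale g (inv_nonneg.2 h.le), inv_mul_cancel₀ h.ne']

theorem kappa_eq_self {v : Cotangent M} (hv : v ∈ cosphere g) : kappa g v = v := by
  rw [kappa, show conorm g v = 1 from hv, inv_one, scale_one]

theorem kappa_scale {v : Cotangent M} (hv : v ∈ nonzero M) {t : ℝ} (ht : 0 < t) :
    kappa g (scale t v) = kappa g v := by
  have h := conorm_pos g hv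
  rw [kappa, kappa, conorm_scale g ht.le, scale_scale]
  congr 1
  field_simp

theorem scale_conorm_kappa {v : Cotangent M} (hv : v ∈ nonzero M) :
    scale (conorm g v) (kappa g v) = v := by
  rw [kappa, scale_scale, mul_inv_cancel₀ (conorm_pos g hv).ne', scale_one]

theorem contMDiffAt_kappa {v : Cotangent M} (hv : v ∈ nonzero M) :
    ContMDiffAt cotModel cotModel ∞ (kappa g) v :=
  contMDiffAt_scale ((contMDiffAt_conorm g hv).inv₀ (conorm_pos g hv).ne') contMDiffAt_id

theorem IsSymbol.kappa {P : Cotangent M → ℝ} (hP : IsSymbol P) {v : Cotangent M}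
    (hv : v ∈ nonzero M) : P (kappa g v) = P v :=
  hP.homog v hv _ (inv_pos.2 (conorm_pos g hv))

end Kappa

/-- `γ` is an integral curve, on the set `I` of times, of the normalised Hamiltonian field of
`|ξ| P` on the unit cosphere bundle. -/
def IsNormCurve (g : Metric M) (P : Cotangent M → ℝ) (γ : ℝ → Cotangent M) : Prop :=
  ∀ t, γ t ∈ cosphere g ∧ HasMFDerivAt 𝓘(ℝ, ℝ) cotModel γ t
    ((1 : ℝ →L[ℝ] ℝ).smulRight (show TangentSpace cotModel (γ t) from normField g P (γ t)))

section

variable {g : Metric M} {P : Cotangent M → ℝ} {γ : ℝ → Cotangent M}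

theorem IsNormCurve.continuous (h : IsNormCurve g P γ) : Continuous γ :=
  continuous_iff_continuousAt.2 fun t => (h t).2.continuousAt

theorem IsNormCurve.hasDerivAt (h : IsNormCurve g P γ) {k : Cotangent M → V} {t : ℝ}
    (hk : ContMDiffAt cotModel 𝓘(ℝ, V) ∞ k (γ t)) :
    HasDerivAt (fun s => k (γ s)) (der k (γ t) (normField g P (γ t))) t :=
  hasDerivAt_comp_curve (hk.of_le (by simp)) (h t).2

end

namespace ExactEmbedding

variable (J : ExactEmbedding M W) {g : Metric M} {P : Cotangent M → ℝ}

theorem continuous_of_emb [CompactSpace M] {X : Type*} [TopologicalSpace X] {f : X → Cotangent M}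
    (hf : ∀ x, f x ∈ cosphere g) (hc : Continuous (fun x => J.emb (f x))) : Continuous f := by
  have : CompactSpace (cosphere g) := isCompact_iff_compactSpace.1 (isCompact_cosphere g)
  have h1 : IsClosedEmbedding (fun v : cosphere g => J.emb v.1) :=
    (J.contMDiff_emb.continuous.comp continuous_subtype_val).isClosedEmbedding
      (J.injective_emb.comp Subtype.val_injective)
  have h2 : Continuous (fun x => (⟨f x, hf x⟩ : cosphere g)) := h1.isInducing.continuous_iff.2 hc
  exact continuous_subtype_val.comp h2

theorem isSolution_of_isNormCurve {γ : ℝ → Cotangent M} (h : IsNormCurve g P γ) :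
    IsSolution (cosphere g) J.emb (fun u => der J.emb u (normField g P u)) γ univ := fun t _ =>
  ⟨(h t).1, h.hasDerivAt (J.contMDiff_emb _)⟩

theorem isNormCurve_of_isSolution [CompactSpace M] [FiniteDimensional ℝ W] {γ : ℝ → Cotangent M}
    (h : IsSolution (cosphere g) J.emb (fun u => der J.emb u (normField g P u)) γ univ) :
    IsNormCurve g P γ := by
  have hc : Continuous γ := J.continuous_of_emb (fun t => (h t trivial).1)
    (continuous_iff_continuousAt.2 fun t => (h t trivial).2.continuousAt)
  exact fun t => ⟨(h t trivial).1, J.hasMFDerivAt_curve hc.continuousAt (h t trivial).2⟩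

theorem exists_lipschitz_normField [CompactSpace M] [FiniteDimensional ℝ W] (hP : IsSymbol P) :
    ∃ L : NNReal, ∀ u ∈ cosphere g, ∀ z ∈ cosphere g,
      ‖der J.emb u (normField g P u) - der J.emb z (normField g P z)‖ ≤
        L * ‖J.emb u - J.emb z‖ := by
  obtain ⟨K, hK, h⟩ := J.exists_lipschitz (isCompact_cosphere g) fun z hz =>
    J.contMDiffAt_der_emb_normField g hP (cosphere_subset_nonzero g hz)
  exact ⟨⟨K, hK⟩, h⟩

/-- The projection of a Hamiltonian curve of `|ξ| P` to the unit cosphere bundle. -/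
theorem hasDerivAt_emb_kappa (hP : IsSymbol P) {γ : ℝ → Cotangent M} {t : ℝ}
    (hv : γ t ∈ nonzero M) (hγ : HasMFDerivAt 𝓘(ℝ, ℝ) cotModel γ t
        ((1 : ℝ →L[ℝ] ℝ).smulRight (hamiltonianField (ham g P) (γ t)))) :
    HasDerivAt (J.emb ∘ fun s => kappa g (γ s))
      (der J.emb (kappa g (γ t)) (normField g P (kappa g (γ t)))) t := by
  have hN := conorm_pos g hv
  have hs := inv_pos.2 hN
  have h1 : HasDerivAt (J.base ∘ γ) (bracket (ham g P) J.base (γ t)) t :=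
    hasDerivAt_comp_curve ((J.contMDiff_base _).of_le (by simp)) hγ
  have h2 : HasDerivAt (J.mom ∘ γ) (bracket (ham g P) J.mom (γ t)) t :=
    hasDerivAt_comp_curve ((J.contMDiff_mom _).of_le (by simp)) hγ
  have h3 : HasDerivAt (conorm g ∘ γ) (bracket (ham g P) (conorm g) (γ t)) t :=
    hasDerivAt_comp_curve ((contMDiffAt_conorm g hv).of_le (by simp)) hγ
  have h4 := h1.prodMk ((h3.inv hN.ne').smul h2)
  rw [der_emb, der_base_normField, der_mom_normField, kappa, J.bracket_base_scale g hP hv hs,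
    J.bracket_mom_scale g hP hv hs, J.growth_scale g hP hv hs, J.mom_scale]
  have h5 : J.emb ∘ (fun s => kappa g (γ s)) =
      fun s => ((J.base ∘ γ) s, ((conorm g ∘ γ)⁻¹ • (J.mom ∘ γ)) s) := by
    ext1 s
    exact Prod.ext rfl (J.mom_scale _ _)
  rw [h5]
  convert h4 using 2
  have h6 : ∀ (A B : W →L[ℝ] ℝ) (n b : ℝ), n ≠ 0 →
      n⁻¹ • A - (b / n) • n⁻¹ • B = n⁻¹ • A + (-b / n ^ 2) • B := by
    intro A B n b hn
    ext w
    simp only [sub_apply, add_apply, smul_apply, smul_eq_mul]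
    field_simp
    ring
  exact h6 _ _ _ _ hN.ne'

theorem exists_uniform_solutions [FiniteDimensional ℝ W] [CompactSpace M] (hP : IsSymbol P) :
    ∃ ε : ℝ, 0 < ε ∧ ∀ u ∈ cosphere g, ∃ γ : ℝ → Cotangent M, γ 0 = u ∧
      IsSolution (cosphere g) J.emb (fun u => der J.emb u (normField g P u)) γ (Ioo (-ε) ε) := by
  suffices h : ∃ ε : ℝ, 0 < ε ∧ ∀ u ∈ cosphere g, u ∈ cosphere g → ∃ γ : ℝ → Cotangent M, γ 0 = u ∧
      IsSolution (cosphere g) J.emb (fun u => der J.emb u (normField g P u)) γ (Ioo (-ε) ε) by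
    obtain ⟨ε, hε, h⟩ := h
    exact ⟨ε, hε, fun u hu => h u hu hu⟩
  refine (isCompact_cosphere g).induction_on (p := fun t => ∃ ε : ℝ, 0 < ε ∧ ∀ u ∈ t,
    u ∈ cosphere g → ∃ γ : ℝ → Cotangent M, γ 0 = u ∧
      IsSolution (cosphere g) J.emb (fun u => der J.emb u (normField g P u)) γ (Ioo (-ε) ε))
    ⟨1, one_pos, by simp⟩ ?_ ?_ ?_
  · rintro t t' htt' ⟨ε, hε, h⟩
    exact ⟨ε, hε, fun u hu => h u (htt' hu)⟩
  · rintro t t' ⟨ε, hε, h⟩ ⟨ε', hε', h'⟩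
    refine ⟨min ε ε', lt_min hε hε', ?_⟩
    rintro u (hu | hu) hus
    · obtain ⟨γ, h0, h1⟩ := h u hu hus
      exact ⟨γ, h0, fun s hs => h1 s
        ⟨by linarith [hs.1, min_le_left ε ε'], hs.2.trans_le (min_le_left _ _)⟩⟩
    · obtain ⟨γ, h0, h1⟩ := h' u hu hus
      exact ⟨γ, h0, fun s hs => h1 s
        ⟨by linarith [hs.1, min_le_right ε ε'], hs.2.trans_le (min_le_right _ _)⟩⟩
  · intro u₀ hu₀
    have hu₀' := cosphere_subset_nonzero g hu₀
    obtain ⟨ε, hε, h⟩ := J.exists_local_integralCurves (contMDiffAt_ham g hP hu₀')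
      ((isOpen_nonzero g).mem_nhds hu₀')
    refine ⟨_, mem_nhdsWithin_of_mem_nhds h, ε, hε, ?_⟩
    rintro u ⟨γ, h0, h1⟩ hus
    refine ⟨fun s => kappa g (γ s),
      (congrArg (kappa g) h0).trans (kappa_eq_self g hus), fun t ht => ?_⟩
    exact ⟨kappa_mem g (h1 t ht).1, J.hasDerivAt_emb_kappa hP (h1 t ht).1 (h1 t ht).2⟩

include J in
theorem exists_normCurves [FiniteDimensional ℝ W] [CompactSpace M] (hP : IsSymbol P) :
    ∃ ψ : ℝ → Cotangent M → Cotangent M, ∀ u ∈ cosphere g, ψ 0 u = u ∧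
      IsNormCurve g P (fun t => ψ t u) := by
  obtain ⟨L, hL⟩ := J.exists_lipschitz_normField (g := g) hP
  obtain ⟨ε, hε, h⟩ := J.exists_uniform_solutions (g := g) hP
  obtain ⟨ψ, hψ⟩ := exists_global_flow J.injective_emb.injOn hL hε h
  exact ⟨ψ, fun u hu => ⟨(hψ u hu).1, J.isNormCurve_of_isSolution (hψ u hu).2⟩⟩

include J in
theorem isNormCurve_eq [FiniteDimensional ℝ W] [CompactSpace M] (hP : IsSymbol P)
    {γ γ' : ℝ → Cotangent M} {t₀ : ℝ} (h : IsNormCurve g P γ) (h' : IsNormCurve g P γ')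
    (he : γ t₀ = γ' t₀) : γ = γ' := by
  obtain ⟨L, hL⟩ := J.exists_lipschitz_normField (g := g) hP
  exact (J.isSolution_of_isNormCurve h).eq J.injective_emb.injOn hL
    (J.isSolution_of_isNormCurve h') he

theorem exists_norm_emb_sub_le [FiniteDimensional ℝ W] [CompactSpace M] (hP : IsSymbol P) :
    ∃ L : ℝ, 0 ≤ L ∧ ∀ γ γ' : ℝ → Cotangent M, IsNormCurve g P γ → IsNormCurve g P γ' → ∀ t,
      ‖J.emb (γ t) - J.emb (γ' t)‖ ≤ Real.exp (L * |t|) * ‖J.emb (γ 0) - J.emb (γ' 0)‖ := by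
  obtain ⟨L, hL⟩ := J.exists_lipschitz_normField (g := g) hP
  refine ⟨L, L.2, fun γ γ' h h' t => ?_⟩
  rw [mul_comm]
  exact (J.isSolution_of_isNormCurve h).norm_sub_le J.injective_emb.injOn hL
    (J.isSolution_of_isNormCurve h') t

end ExactEmbedding

theorem IsNormCurve.shift {g : Metric M} {P : Cotangent M → ℝ} {γ : ℝ → Cotangent M}
    (h : IsNormCurve g P γ) (s : ℝ) : IsNormCurve g P (fun t => γ (t + s)) := by
  intro t
  refine ⟨(h _).1, ?_⟩
  have h1 : HasMFDerivAt 𝓘(ℝ, ℝ) 𝓘(ℝ, ℝ) (fun t : ℝ => t + s) t (1 : ℝ →L[ℝ] ℝ) :=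
    ((hasFDerivAt_id t).add_const s).hasMFDerivAt
  exact HasMFDerivAt.comp t (h (t + s)).2 h1

theorem IsNormCurve.reverse {g : Metric M} {P : Cotangent M → ℝ} (hP : IsSymbol P)
    {γ : ℝ → Cotangent M} (h : IsNormCurve g P γ) :
    IsNormCurve g (fun v => -P v) (fun t => γ (-t)) := by
  intro t
  refine ⟨(h _).1, ?_⟩
  have h1 : HasMFDerivAt 𝓘(ℝ, ℝ) 𝓘(ℝ, ℝ) (fun t : ℝ => -t) t (-1 : ℝ →L[ℝ] ℝ) :=
    ((hasFDerivAt_id t).neg).hasMFDerivAt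
  have h2 := HasMFDerivAt.comp t (h (-t)).2 h1
  have h3 := (normField_neg g hP (cosphere_subset_nonzero g (h (-t)).1)).1
  rw [h3]
  have h4 : ((1 : ℝ →L[ℝ] ℝ).smulRight (normField g P (γ (-t)))).comp (-1 : ℝ →L[ℝ] ℝ) =
      (1 : ℝ →L[ℝ] ℝ).smulRight (-normField g P (γ (-t))) := by
    ext1
    simp
  exact h4 ▸ h2

end

section

/-! ### The Hamiltonian flow and its extension to the compactification -/

/-- `ψ` is the flow of the normalised Hamiltonian field of `|ξ| P` on the unit cosphere bundle. -/
def IsNormFlow (g : Metric M) (P : Cotangent M → ℝ) (ψ : ℝ → Cotangent M → Cotangent M) : Prop :=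
  ∀ u ∈ cosphere g, ψ 0 u = u ∧ IsNormCurve g P (fun t => ψ t u)

/-- The logarithm of the growth of `|ξ|` along the Hamiltonian flow of `|ξ| P` over `γ`. -/
def logGrowth (g : Metric M) (P : Cotangent M → ℝ) (γ : ℝ → Cotangent M) (t : ℝ) : ℝ :=
  ∫ s in (0 : ℝ)..t, growth g P (γ s)

/-- The Hamiltonian flow of `|ξ| P`, in terms of the flow `ψ` on the unit cosphere bundle. -/
def hamFlow (g : Metric M) (P : Cotangent M → ℝ) (ψ : ℝ → Cotangent M → Cotangent M) (t : ℝ)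
    (v : Cotangent M) : Cotangent M :=
  scale (conorm g v * Real.exp (logGrowth g P (fun s => ψ s (kappa g v)) t)) (ψ t (kappa g v))

/-- The norm, in the unit ball bundle, of the image under the flow of a point of norm `r`, if the
flow multiplies `|ξ|` by `m`. -/
def ballNorm (r m : ℝ) : ℝ := r * m / √(1 - r ^ 2 + r ^ 2 * m ^ 2)

theorem ballNorm_radicand_pos {r m : ℝ} (h0 : 0 ≤ r) (h1 : r ≤ 1) (hm : 0 < m) :
    0 < 1 - r ^ 2 + r ^ 2 * m ^ 2 := by
  rcases eq_or_lt_of_le h0 with rfl | h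
  · norm_num
  · have : 0 < r ^ 2 * m ^ 2 := by positivity
    nlinarith

theorem ballNorm_le_one {r m : ℝ} (h0 : 0 ≤ r) (h1 : r ≤ 1) (hm : 0 < m) : ballNorm r m ≤ 1 := by
  rw [ballNorm, div_le_one (Real.sqrt_pos.2 (ballNorm_radicand_pos h0 h1 hm))]
  refine Real.le_sqrt_of_sq_le ?_
  nlinarith

theorem ballNorm_nonneg {r m : ℝ} (h0 : 0 ≤ r) (hm : 0 < m) : 0 ≤ ballNorm r m := by
  unfold ballNorm
  positivity

theorem ballNorm_mul {N m : ℝ} :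
    ballNorm ((√(1 + N ^ 2))⁻¹ * N) m = (√(1 + (N * m) ^ 2))⁻¹ * (N * m) := by
  have h1 : 0 < 1 + N ^ 2 := by positivity
  have hs := Real.sqrt_pos.2 h1
  have h2 : 1 - ((√(1 + N ^ 2))⁻¹ * N) ^ 2 + ((√(1 + N ^ 2))⁻¹ * N) ^ 2 * m ^ 2 =
      (1 + (N * m) ^ 2) / (1 + N ^ 2) := by
    rw [mul_pow, inv_pow, Real.sq_sqrt h1.le]
    field_simp
    ring
  rw [ballNorm, h2, Real.sqrt_div' _ h1.le]
  field_simp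

/-- The extension of the Hamiltonian flow of `|ξ| P` to the unit ball bundle. -/
def ballFlow (g : Metric M) (P : Cotangent M → ℝ) {ψ : ℝ → Cotangent M → Cotangent M}
    (hψ : IsNormFlow g P ψ) (t : ℝ) (z : Compactified g) : Compactified g :=
  ⟨scale (ballNorm (conorm g z.1) (Real.exp (logGrowth g P (fun s => ψ s (kappa g z.1)) t)))
    (ψ t (kappa g z.1)), by
    have h0 := conorm_nonneg g z.1
    rw [conorm_scale g (ballNorm_nonneg h0 (Real.exp_pos _))]
    rcases eq_or_lt_of_le h0 with h | h
    · rw [← h, ballNorm]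
      simp
    · rw [show conorm g (ψ t (kappa g z.1)) = 1 from
        (((hψ _ (kappa_mem g (mem_nonzero_of_conorm_pos g h))).2 t).1), mul_one]
      exact ballNorm_le_one h0 z.2 (Real.exp_pos _)⟩

variable {g : Metric M} {P : Cotangent M → ℝ} {ψ : ℝ → Cotangent M → Cotangent M}

theorem logGrowth_zero (γ : ℝ → Cotangent M) : logGrowth g P γ 0 = 0 :=
  intervalIntegral.integral_same

theorem conorm_hamFlow (hψ : IsNormFlow g P ψ) {v : Cotangent M} (hv : v ∈ nonzero M) (t : ℝ) :
    conorm g (hamFlow g P ψ t v) =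
      conorm g v * Real.exp (logGrowth g P (fun s => ψ s (kappa g v)) t) := by
  rw [hamFlow, conorm_scale g (mul_pos (conorm_pos g hv) (Real.exp_pos _)).le,
    show conorm g (ψ t (kappa g v)) = 1 from ((hψ _ (kappa_mem g hv)).2 t).1, mul_one]

theorem kappa_embed {v : Cotangent M} (hv : v ∈ nonzero M) :
    kappa g (Compactified.embed g v).1 = kappa g v :=
  kappa_scale g hv (inv_pos.2 (Real.sqrt_pos.2 (by positivity)))

theorem kappa_ballFlow (hψ : IsNormFlow g P ψ) {z : Compactified g}
    (hz : z ∈ Compactified.nonzero g) (t : ℝ) :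
    kappa g (ballFlow g P hψ t z).1 = ψ t (kappa g z.1) := by
  have hv : z.1 ∈ nonzero M := hz
  have h1 := ((hψ _ (kappa_mem g hv)).2 t).1
  have h0 := conorm_pos g hv
  refine (kappa_scale g (cosphere_subset_nonzero g h1) (div_pos (mul_pos h0 (Real.exp_pos _))
    (Real.sqrt_pos.2 (ballNorm_radicand_pos h0.le z.2 (Real.exp_pos _))))).trans ?_
  exact kappa_eq_self g h1

theorem ballFlow_of_mem_cosphere (hψ : IsNormFlow g P ψ) {z : Compactified g}
    (hz : z.1 ∈ cosphere g) (t : ℝ) : (ballFlow g P hψ t z).1 = ψ t z.1 := by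
  change scale (ballNorm (conorm g z.1) _) (ψ t (kappa g z.1)) = _
  rw [kappa_eq_self g hz, show conorm g z.1 = 1 from hz, ballNorm, one_pow, sub_self, zero_add,
    one_mul, one_mul, Real.sqrt_sq (Real.exp_pos _).le, div_self (Real.exp_pos _).ne', scale_one]

theorem ballFlow_embed (hψ : IsNormFlow g P ψ) {v : Cotangent M} (hv : v ∈ nonzero M) (t : ℝ) :
    ballFlow g P hψ t (Compactified.embed g v) = Compactified.embed g (hamFlow g P ψ t v) := by
  have h1 := kappa_embed (g := g) hv
  have h2 := conorm_hamFlow hψ hv t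
  refine Subtype.ext ?_
  change scale (ballNorm (conorm g (Compactified.embed g v).1) (Real.exp (logGrowth g P
      (fun s => ψ s (kappa g (Compactified.embed g v).1)) t)))
    (ψ t (kappa g (Compactified.embed g v).1)) =
      scale (√(1 + conorm g (hamFlow g P ψ t v) ^ 2))⁻¹ (hamFlow g P ψ t v)
  rw [h1, h2, hamFlow, scale_scale]
  congr 1
  rw [← ballNorm_mul]
  congr 1
  exact conorm_scale g (inv_nonneg.2 (Real.sqrt_nonneg _)) v

section Flow

variable [CompactSpace M] [FiniteDimensional ℝ W] (J : ExactEmbedding M W) (hP : IsSymbol P)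
include J hP

omit [CompactSpace M] [FiniteDimensional ℝ W] in
theorem continuous_growth_curve {γ : ℝ → Cotangent M} (h : IsNormCurve g P γ) :
    Continuous fun t => growth g P (γ t) :=
  continuous_iff_continuousAt.2 fun t =>
    (J.contMDiffAt_growth g hP (cosphere_subset_nonzero g (h t).1)).continuousAt.comp
      (f := γ) h.continuous.continuousAt

omit [CompactSpace M] [FiniteDimensional ℝ W] in
theorem hasDerivAt_logGrowth {γ : ℝ → Cotangent M} (h : IsNormCurve g P γ) (t : ℝ) :
    HasDerivAt (logGrowth g P γ) (growth g P (γ t)) t :=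
  (continuous_growth_curve J hP h).integral_hasStrictDerivAt 0 t |>.hasDerivAt

theorem continuous_normFlow (hψ : IsNormFlow g P ψ) :
    Continuous fun q : ℝ × cosphere g => ψ q.1 q.2.1 := by
  obtain ⟨L, hL0, hL⟩ := J.exists_norm_emb_sub_le (g := g) hP
  refine J.continuous_of_emb (g := g) (fun q => ((hψ _ q.2.2).2 q.1).1) ?_
  rw [continuous_iff_continuousAt]
  rintro ⟨t₀, u₀⟩
  rw [ContinuousAt, tendsto_iff_norm_sub_tendsto_zero]
  have h1 : ∀ q : ℝ × cosphere g, ‖J.emb (ψ q.1 q.2.1) - J.emb (ψ t₀ u₀.1)‖ ≤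
      Real.exp (L * |q.1|) * ‖J.emb q.2.1 - J.emb u₀.1‖ +
        ‖J.emb (ψ q.1 u₀.1) - J.emb (ψ t₀ u₀.1)‖ := by
    intro q
    have h2 := hL _ _ (hψ _ q.2.2).2 (hψ _ u₀.2).2 q.1
    rw [(hψ _ q.2.2).1, (hψ _ u₀.2).1] at h2
    exact (norm_sub_le_norm_sub_add_norm_sub _ (J.emb (ψ q.1 u₀.1)) _).trans
      (by gcongr)
  have hJ := J.contMDiff_emb.continuous
  have h3 : Continuous fun q : ℝ × cosphere g => Real.exp (L * |q.1|) *
      ‖J.emb q.2.1 - J.emb u₀.1‖ + ‖J.emb (ψ q.1 u₀.1) - J.emb (ψ t₀ u₀.1)‖ := by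
    have h4 : Continuous fun q : ℝ × cosphere g => J.emb (ψ q.1 u₀.1) :=
      hJ.comp ((hψ _ u₀.2).2.continuous.comp continuous_fst)
    have h5 : Continuous fun q : ℝ × cosphere g => J.emb q.2.1 :=
      hJ.comp (continuous_subtype_val.comp continuous_snd)
    fun_prop
  have h6 := h3.tendsto (t₀, u₀)
  simp only [sub_self, norm_zero, mul_zero, add_zero] at h6
  exact squeeze_zero (fun _ => norm_nonneg _) h1 h6

theorem continuous_logGrowth_normFlow (hψ : IsNormFlow g P ψ) :
    Continuous fun q : ℝ × cosphere g => logGrowth g P (fun s => ψ s q.2.1) q.1 := by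
  have hg : ∀ v ∈ cosphere g, ContinuousAt (growth g P) v := fun v hv =>
    (J.contMDiffAt_growth g hP (cosphere_subset_nonzero g hv)).continuousAt
  have h1 : Continuous (Function.uncurry fun (q : ℝ × cosphere g) (s : ℝ) =>
      growth g P (ψ s q.2.1)) := by
    have h2 : Continuous fun p : (ℝ × cosphere g) × ℝ => ψ p.2 p.1.2.1 :=
      (continuous_normFlow J hP hψ).comp (continuous_snd.prodMk continuous_fst.snd)
    rw [continuous_iff_continuousAt]
    intro p
    exact (hg _ ((hψ _ p.1.2.2).2 p.2).1).comp (f := fun p : (ℝ × cosphere g) × ℝ =>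
      ψ p.2 p.1.2.1) h2.continuousAt
  exact intervalIntegral.continuous_parametric_intervalIntegral_of_continuous h1 continuous_fst

omit [CompactSpace M] in
theorem isMIntegralCurve_hamFlow (hψ : IsNormFlow g P ψ) {v : Cotangent M} (hv : v ∈ nonzero M) :
    IsMIntegralCurve (I := cotModel) (fun t => hamFlow g P ψ t v)
      (hamiltonianField (ham g P)) := by
  intro t
  have hκ := kappa_mem g hv
  have hc := (hψ _ hκ).2
  set γ : ℝ → Cotangent M := fun s => ψ s (kappa g v) with hγ
  set ρ : ℝ → ℝ := fun t => conorm g v * Real.exp (logGrowth g P γ t) with hρ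
  have hρ0 : ∀ t, 0 < ρ t := fun t => mul_pos (conorm_pos g hv) (Real.exp_pos _)
  have hρd : HasDerivAt ρ (ρ t * growth g P (γ t)) t := by
    have h1 := ((hasDerivAt_logGrowth J hP hc t).exp).const_mul (conorm g v)
    rw [← mul_assoc] at h1
    exact h1
  have hγn := cosphere_subset_nonzero g (hc t).1
  have hρc : Continuous ρ := by
    have h1 : Continuous (logGrowth g P γ) :=
      continuous_iff_continuousAt.2 fun t => (hasDerivAt_logGrowth J hP hc t).continuousAt
    fun_prop
  rw [hamiltonianField_eq]
  refine J.hasMFDerivAt_curve (γ := fun t => scale (ρ t) (γ t))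
    (w := flatHam (der (ham g P) (scale (ρ t) (γ t)))) ?_ ?_
  · exact (continuous_scale.comp (hρc.prodMk hc.continuous)).continuousAt
  · have h1 := hc.hasDerivAt (t := t) (J.contMDiff_base _)
    have h2 := hc.hasDerivAt (t := t) (J.contMDiff_mom _)
    have h3 := h1.prodMk (hρd.smul h2)
    rw [J.der_base_normField, J.der_mom_normField] at h3
    have h4 : J.emb ∘ (fun t => scale (ρ t) (γ t)) =
        fun s => (J.base (γ s), (ρ • fun s => J.mom (γ s)) s) := by
      ext1 s
      exact Prod.ext rfl (J.mom_scale _ _)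
    rw [h4, J.der_emb]
    convert h3 using 2
    · exact J.bracket_base_scale g hP hγn (hρ0 t)
    · refine (J.bracket_mom_scale g hP hγn (hρ0 t)).trans ?_
      have h6 : ∀ (A B : W →L[ℝ] ℝ) (n b : ℝ),
          n • A = n • (A - b • B) + (n * b) • B := by
        intro A B n b
        ext w
        simp only [sub_apply, add_apply, smul_apply, smul_eq_mul]
        ring
      exact h6 _ _ _ _

theorem isCompactifiedFlow (hψ : IsNormFlow g P ψ) :
    IsCompactifiedFlow g (hamiltonianField (ham g P)) (hamFlow g P ψ) (ballFlow g P hψ) where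
  zero v hv := by
    rw [hamFlow, logGrowth_zero, Real.exp_zero, mul_one, (hψ _ (kappa_mem g hv)).1,
      scale_conorm_kappa g hv]
  mem v hv t := scale_mem_nonzero (mul_pos (conorm_pos g hv) (Real.exp_pos _)).ne'
    (cosphere_subset_nonzero g ((hψ _ (kappa_mem g hv)).2 t).1)
  integralCurve v hv := isMIntegralCurve_hamFlow J hP hψ hv
  embed v hv t := ballFlow_embed hψ hv t
  continuousOn := by
    rw [continuousOn_iff_continuous_domRestrict]
    have hval : Continuous fun z : Compactified g => z.1 := continuous_subtype_val
    let D : Set (ℝ × Compactified g) := {q | q.2 ∈ Compactified.nonzero g}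
    have hD : ∀ q : D, q.1.2.1 ∈ nonzero M := fun q => q.2
    have hκ : Continuous fun q : D => kappa g q.1.2.1 := by
      rw [continuous_iff_continuousAt]
      intro q
      exact (contMDiffAt_kappa g (hD q)).continuousAt.comp (f := fun q : D => q.1.2.1)
        (hval.comp (continuous_snd.comp continuous_subtype_val)).continuousAt
    have hpair : Continuous fun q : D =>
        ((q.1.1, ⟨kappa g q.1.2.1, kappa_mem g (hD q)⟩) : ℝ × cosphere g) :=
      (continuous_fst.comp continuous_subtype_val).prodMk (hκ.subtype_mk _)
    have h1 := (continuous_normFlow J hP hψ).comp hpair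
    have h2 := (continuous_logGrowth_normFlow J hP hψ).comp hpair
    have h3 : Continuous fun q : D => conorm g q.1.2.1 :=
      (continuous_conorm g).comp (hval.comp (continuous_snd.comp continuous_subtype_val))
    have h4 : Continuous fun q : D => ballNorm (conorm g q.1.2.1)
        (Real.exp (logGrowth g P (fun s => ψ s (kappa g q.1.2.1)) q.1.1)) := by
      have h5 : Continuous fun q : D =>
        Real.exp (logGrowth g P (fun s => ψ s (kappa g q.1.2.1)) q.1.1) := h2.rexp
      unfold ballNorm
      refine (h3.mul h5).div ((continuous_const.sub (h3.pow 2)).add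
        ((h3.pow 2).mul (h5.pow 2))).sqrt fun q => ?_
      exact (Real.sqrt_pos.2 (ballNorm_radicand_pos (conorm_nonneg g _) q.1.2.2
        (Real.exp_pos _))).ne'
    exact (continuous_scale.comp (h4.prodMk h1)).subtype_mk _

end Flow

end

section

/-! ### Evolution of the canonical one-form and of the symbol -/

/-- The displacement from `z` to `u` (in the ambient space), paired with the momentum of `z`. This
is a primitive, to first order at `z`, of the canonical one-form. -/
def ExactEmbedding.action (J : ExactEmbedding M W) (z u : Cotangent M) : ℝ :=
  J.mom z (J.base u - J.base z)

variable {g : Metric M} {P : Cotangent M → ℝ}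

section Estimates

variable (J : ExactEmbedding M W) (hP : IsSymbol P)
include J hP

/-- Along the flow on the unit cosphere bundle, `P` decays as `|ξ|` grows: `|ξ| P` is conserved by
its Hamiltonian flow. -/
theorem IsNormCurve.symbol_mul_exp {γ : ℝ → Cotangent M} (h : IsNormCurve g P γ) (t : ℝ) :
    P (γ t) * Real.exp (logGrowth g P γ t) = P (γ 0) := by
  have hd : ∀ t, HasDerivAt (fun t => P (γ t) * Real.exp (logGrowth g P γ t)) 0 t := by
    intro t
    have hn := cosphere_subset_nonzero g (h t).1
    have h1 := (h.hasDerivAt (hP.smooth _ hn)).mul (hasDerivAt_logGrowth J hP h t).exp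
    rw [der_symbol_normField g hP hn] at h1
    convert! h1 using 1
    ring
  have h2 := is_const_of_deriv_eq_zero (fun t => (hd t).differentiableAt)
    (fun t => (hd t).deriv) t 0
  simpa [logGrowth_zero] using h2

variable [CompactSpace M]

theorem exists_abs_growth_le : ∃ C : ℝ, 0 ≤ C ∧ ∀ z ∈ cosphere g, |growth g P z| ≤ C := by
  obtain ⟨C, hC⟩ := (isCompact_cosphere g).exists_bound_of_continuousOn (f := growth g P)
    fun z hz =>
    (J.contMDiffAt_growth g hP (cosphere_subset_nonzero g hz)).continuousAt.continuousWithinAt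
  exact ⟨max C 0, le_max_right _ _, fun z hz => (hC z hz).trans (le_max_left _ _)⟩

omit [NormedAddCommGroup W] [NormedSpace ℝ W] J hP [CompactSpace M] in
theorem abs_logGrowth_le {C : ℝ} (hC : ∀ z ∈ cosphere g, |growth g P z| ≤ C)
    {γ : ℝ → Cotangent M} (h : IsNormCurve g P γ) (t : ℝ) : |logGrowth g P γ t| ≤ C * |t| := by
  have h1 := intervalIntegral.norm_integral_le_of_norm_le_const (a := 0) (b := t)
    (f := fun s => growth g P (γ s)) (C := C) fun s _ => hC _ (h s).1
  simpa [logGrowth] using h1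

variable [FiniteDimensional ℝ W]

/-- The canonical one-form is conformally invariant under the flow on the unit cosphere bundle:
the action of a nearby pair of trajectories, multiplied by the growth of `|ξ|`, is conserved up to
a quadratic error. -/
theorem exists_action_estimate (T : ℝ) :
    ∃ C : ℝ, 0 ≤ C ∧ ∀ γ γ' : ℝ → Cotangent M, IsNormCurve g P γ → IsNormCurve g P γ' → ∀ t,
      |t| ≤ T → |J.action (γ t) (γ' t) * Real.exp (logGrowth g P γ t) - J.action (γ 0) (γ' 0)| ≤
        C * ‖J.emb (γ 0) - J.emb (γ' 0)‖ ^ 2 := by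
  have hn : ∀ z ∈ cosphere g, z ∈ nonzero M := cosphere_subset_nonzero g
  have hba : ∀ z ∈ cosphere g, ContMDiffAt cotModel 𝓘(ℝ, W) ∞ (bracket (ham g P) J.base) z :=
    fun z hz => J.contMDiffAt_bracket (contMDiffAt_ham g hP (hn z hz)) (J.contMDiff_base z)
  have hbm : ∀ z ∈ cosphere g, ContMDiffAt cotModel 𝓘(ℝ, W →L[ℝ] ℝ) ∞
      (bracket (ham g P) J.mom) z :=
    fun z hz => J.contMDiffAt_bracket (contMDiffAt_ham g hP (hn z hz)) (J.contMDiff_mom z)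
  let β : Cotangent M → W × W →L[ℝ] ℝ := fun z =>
    (bracket (ham g P) J.mom z).comp (ContinuousLinearMap.fst ℝ W W) +
      (J.mom z).comp (ContinuousLinearMap.snd ℝ W W)
  have hβc : ContinuousOn β (cosphere g) := fun z hz =>
    (((hbm z hz).continuousAt.clm_comp continuousAt_const).add
      ((J.contMDiff_mom z).continuousAt.clm_comp continuousAt_const)).continuousWithinAt
  obtain ⟨K, hK, hKq⟩ := J.exists_quadratic (isCompact_cosphere g)
    (h := fun u => (J.base u, bracket (ham g P) J.base u)) (β := β)
    (fun z hz => (J.contMDiff_base z).prodMk_space (hba z hz))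
    ((isCompact_cosphere g).exists_bound_of_continuousOn hβc) (fun z hz w => by
      rw [der_prodMk ((J.contMDiff_base z).of_le (by simp)) ((hba z hz).of_le (by simp))]
      exact J.bracket_mom_add g hP (hn z hz) w)
  obtain ⟨Λ, hΛ0, hΛ⟩ := exists_abs_growth_le (g := g) J hP
  obtain ⟨L, hL0, hL⟩ := J.exists_norm_emb_sub_le (g := g) hP
  refine ⟨Real.exp (Λ * |T|) * (K * (Real.exp (L * |T|)) ^ 2) * |T|, by positivity, ?_⟩
  intro γ γ' h h' t ht
  have hT : |t| ≤ |T| := ht.trans (le_abs_self T)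
  let f : ℝ → ℝ := fun t => J.action (γ t) (γ' t) * Real.exp (logGrowth g P γ t)
  have hd : ∀ s, HasDerivAt f (Real.exp (logGrowth g P γ s) *
      β (γ s) ((J.base (γ' s), bracket (ham g P) J.base (γ' s)) -
        (J.base (γ s), bracket (ham g P) J.base (γ s)))) s := by
    intro s
    have h1 := h.hasDerivAt (t := s) (J.contMDiff_base _)
    have h2 := h.hasDerivAt (t := s) (J.contMDiff_mom _)
    have h3 := h'.hasDerivAt (t := s) (J.contMDiff_base _)
    rw [J.der_base_normField] at h1 h3
    rw [J.der_mom_normField] at h2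
    have h4 := (h2.clm_apply (h3.sub h1)).mul (hasDerivAt_logGrowth J hP h s).exp
    convert! h4 using 1
    simp only [β, add_apply, sub_apply, smul_apply, smul_eq_mul, ContinuousLinearMap.comp_apply,
      Prod.mk_sub_mk, ContinuousLinearMap.coe_fst', ContinuousLinearMap.coe_snd', Pi.sub_apply]
    ring
  have hbd : ∀ s ∈ Icc (-|t|) |t|, ‖Real.exp (logGrowth g P γ s) *
      β (γ s) ((J.base (γ' s), bracket (ham g P) J.base (γ' s)) -
        (J.base (γ s), bracket (ham g P) J.base (γ s)))‖ ≤
      Real.exp (Λ * |T|) * (K * (Real.exp (L * |T|)) ^ 2) * ‖J.emb (γ 0) - J.emb (γ' 0)‖ ^ 2 := by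
    intro s hs
    have hsT : |s| ≤ |T| := (abs_le.2 ⟨hs.1, hs.2⟩).trans hT
    rw [norm_mul, Real.norm_eq_abs, Real.abs_exp, mul_assoc]
    refine mul_le_mul (Real.exp_le_exp.2 ?_) ?_ (norm_nonneg _) (Real.exp_pos _).le
    · exact ((le_abs_self _).trans (abs_logGrowth_le hΛ h s)).trans (by gcongr)
    · refine (hKq _ (h s).1 _ (h' s).1).trans ?_
      rw [mul_assoc, ← mul_pow]
      gcongr
      refine (hL γ γ' h h' s).trans ?_
      gcongr
  have h5 := (convex_Icc (-|t|) |t|).norm_image_sub_le_of_norm_hasDerivWithin_le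
    (fun s _ => (hd s).hasDerivWithinAt) hbd (x := 0) (y := t)
    ⟨by simp, abs_nonneg t⟩ ⟨neg_abs_le t, le_abs_self t⟩
  have h6 : f 0 = J.action (γ 0) (γ' 0) := by
    simp only [f, logGrowth_zero, Real.exp_zero, mul_one]
  rw [h6, sub_zero, Real.norm_eq_abs, Real.norm_eq_abs] at h5
  refine h5.trans ?_
  calc _ ≤ Real.exp (Λ * |T|) * (K * (Real.exp (L * |T|)) ^ 2) *
        ‖J.emb (γ 0) - J.emb (γ' 0)‖ ^ 2 * |T| := by gcongr
    _ = _ := by ring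

end Estimates

/-! ### Closed orbits -/

/-- `γ` is a closed orbit, with prime period `T`, of the normalised Hamiltonian field of `|ξ| P` in
the zero set of `P`. -/
structure IsCycle (g : Metric M) (P : Cotangent M → ℝ) (γ : ℝ → Cotangent M) (T : ℝ) : Prop where
  curve : IsNormCurve g P γ
  symbol : ∀ t, P (γ t) = 0
  pos : 0 < T
  periodic : Function.Periodic γ T
  prime : ∀ t, 0 < t → t < T → γ t ≠ γ 0

theorem ExactEmbedding.t2Space (J : ExactEmbedding M W) : T2Space (Cotangent M) :=
  T2Space.of_injective_continuous J.injective_emb J.contMDiff_emb.continuous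

namespace IsCycle

variable {γ : ℝ → Cotangent M} {T : ℝ} (hγ : IsCycle g P γ T)
include hγ

theorem range_eq : range γ = γ '' Icc 0 T := by
  rw [← hγ.periodic.image_Icc hγ.pos 0, zero_add]

theorem isCompact_range : IsCompact (range γ) := by
  rw [hγ.range_eq]
  exact isCompact_Icc.image hγ.curve.continuous

theorem range_subset : range γ ⊆ cosphere g := by
  rintro _ ⟨t, rfl⟩
  exact (hγ.curve t).1

theorem reverse (hP : IsSymbol P) : IsCycle g (fun v => -P v) (fun t => γ (-t)) T where
  curve := hγ.curve.reverse hP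
  symbol t := by rw [hγ.symbol, neg_zero]
  pos := hγ.pos
  periodic t := by
    change γ (-(t + T)) = γ (-t)
    rw [neg_add, ← sub_eq_add_neg]
    exact hγ.periodic.sub_eq _
  prime t h0 hT := by
    rw [neg_zero, ← hγ.periodic (-t)]
    exact hγ.prime _ (by linarith) (by linarith)

variable [CompactSpace M] [FiniteDimensional ℝ W] (J : ExactEmbedding M W) (hP : IsSymbol P)
include J hP

theorem eq_imp {s s' : ℝ} (h : γ s = γ s') : ∃ k : ℤ, s - s' = k * T := by
  have h1 : (fun t => γ (t + s)) = fun t => γ (t + s') :=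
    J.isNormCurve_eq hP (t₀ := 0) (hγ.curve.shift s) (hγ.curve.shift s') (by simpa using h)
  have h2 : γ (s - s') = γ 0 := by
    have h3 := congrFun h1 (-s')
    simp only [neg_add_cancel] at h3
    rw [← h3]
    congr 1
    ring
  set k := ⌊(s - s') / T⌋ with hk
  have hT := hγ.pos
  have h4 : (k : ℝ) ≤ (s - s') / T := Int.floor_le _
  have h5 : (s - s') / T < k + 1 := Int.lt_floor_add_one _
  rw [le_div_iff₀ hT] at h4
  rw [div_lt_iff₀ hT] at h5
  have h6 : γ (s - s' - k * T) = γ 0 := by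
    rw [hγ.periodic.sub_int_mul_eq k, h2]
  rcases h4.eq_or_lt with h | h
  · exact ⟨k, h.symm⟩
  · exact absurd h6 (hγ.prime _ (by linarith) (by linarith))

/-- Near one of its points, a closed orbit is a single arc. -/
theorem exists_arc (τ : ℝ) {η : ℝ} (hη : 0 < η) :
    ∃ O ∈ 𝓝 (γ τ), ∀ z ∈ O, z ∈ range γ → ∃ s, |s - τ| < η ∧ γ s = z := by
  have := J.t2Space
  have hT := hγ.pos
  set K : Set ℝ := Icc (τ - T / 2) (τ + T / 2) \ Ioo (τ - η) (τ + η) with hK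
  have hKc : IsCompact K := isCompact_Icc.diff isOpen_Ioo
  have hKcl : IsClosed (γ '' K) := (hKc.image hγ.curve.continuous).isClosed
  refine ⟨(γ '' K)ᶜ, hKcl.isOpen_compl.mem_nhds ?_, ?_⟩
  · rintro ⟨s, ⟨hs1, hs2⟩, hs⟩
    obtain ⟨k, hk⟩ := hγ.eq_imp J hP hs
    have h1 : |(k : ℝ)| < 1 := by
      rw [abs_lt]
      constructor
      · by_contra hh
        push Not at hh
        nlinarith [hs1.1]
      · by_contra hh
        push Not at hh
        nlinarith [hs1.2]
    have h2 : k = 0 := by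
      have : |k| < 1 := by exact_mod_cast h1
      exact Int.abs_lt_one_iff.1 this
    rw [h2, Int.cast_zero, zero_mul] at hk
    exact hs2 ⟨by linarith, by linarith⟩
  · rintro z hz ⟨s, rfl⟩
    obtain ⟨s', hs', he⟩ := hγ.periodic.exists_mem_Ico hT s (τ - T / 2)
    have hs'' : s' ∈ Icc (τ - T / 2) (τ + T / 2) := ⟨hs'.1, by linarith [hs'.2]⟩
    by_cases h : s' ∈ Ioo (τ - η) (τ + η)
    · exact ⟨s', abs_lt.2 ⟨by linarith [h.1], by linarith [h.2]⟩, he.symm⟩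
    · exact absurd ⟨s', ⟨hs'', h⟩, he.symm⟩ hz

omit [CompactSpace M] [FiniteDimensional ℝ W] in
theorem logGrowth_int_mul (n : ℤ) : logGrowth g P γ (n * T) = n * logGrowth g P γ T := by
  have h1 : Function.Periodic (fun s => growth g P (γ s)) T := fun s =>
    congrArg (growth g P) (hγ.periodic s)
  have h2 := h1.intervalIntegral_add_zsmul_eq n 0
    (fun a b => (continuous_growth_curve J hP hγ.curve).intervalIntegrable a b)
  simpa [logGrowth] using h2

theorem shift (s : ℝ) : IsCycle g P (fun t => γ (t + s)) T where
  curve := hγ.curve.shift s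
  symbol t := hγ.symbol _
  pos := hγ.pos
  periodic t := by
    change γ (t + T + s) = γ (t + s)
    rw [add_right_comm, hγ.periodic]
  prime t h0 ht h := by
    obtain ⟨k, hk⟩ := hγ.eq_imp J hP h
    have hT := hγ.pos
    have h1 : (0 : ℝ) < k := by
      by_contra hh
      push Not at hh
      nlinarith
    have h2 : (k : ℝ) < 1 := by
      by_contra hh
      push Not at hh
      nlinarith
    have h3 : 0 < k := by exact_mod_cast h1
    have h4 : k < 1 := by exact_mod_cast h2
    omega

omit [CompactSpace M] [FiniteDimensional ℝ W] J hP in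
theorem logGrowth_shift (s : ℝ) : logGrowth g P (fun t => γ (t + s)) T = logGrowth g P γ T := by
  have h1 : Function.Periodic (fun s => growth g P (γ s)) T := fun s =>
    congrArg (growth g P) (hγ.periodic s)
  have h2 := h1.intervalIntegral_add_eq s 0
  rw [logGrowth, logGrowth, intervalIntegral.integral_comp_add_right
    (fun t => growth g P (γ t)), zero_add, add_comm T s, h2, zero_add]

end IsCycle

end

section

/-! ### Transversal coordinates on the energy surface -/

variable {g : Metric M} {P : Cotangent M → ℝ}

section Transversal

variable (J : ExactEmbedding M W)

/-- Functions which are coordinates near a point `z₀` of the zero set of `P` where the normalised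
field does not vanish: a primitive of the canonical one-form at `z₀`, the symbol `P`, the norm
`|ξ|`, and a function `ℓ` which is not constant along the flow. -/
def transCoord (g : Metric M) (P : Cotangent M → ℝ) (z₀ : Cotangent M)
    (ℓ : W × (W →L[ℝ] ℝ) →L[ℝ] ℝ) (u : Cotangent M) : ℝ × ℝ × ℝ × ℝ :=
  (J.mom z₀ (J.base u), P u, conorm g u, ℓ (J.emb u))

theorem contMDiffAt_transCoord (hP : IsSymbol P) {z₀ u : Cotangent M} (hu : u ∈ nonzero M)
    (ℓ : W × (W →L[ℝ] ℝ) →L[ℝ] ℝ) :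
    ContMDiffAt cotModel 𝓘(ℝ, ℝ × ℝ × ℝ × ℝ) ∞ (transCoord J g P z₀ ℓ) u :=
  ((J.mom z₀).contDiff.contMDiff.contMDiffAt.comp u (J.contMDiff_base u)).prodMk_space
    ((hP.smooth u hu).prodMk_space ((contMDiffAt_conorm g hu).prodMk_space
      (ℓ.contDiff.contMDiff.contMDiffAt.comp u (J.contMDiff_emb u))))

theorem der_transCoord (hP : IsSymbol P) {z₀ : Cotangent M} (hz : z₀ ∈ nonzero M)
    (ℓ : W × (W →L[ℝ] ℝ) →L[ℝ] ℝ) (w : Phase) :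
    der (transCoord J g P z₀ ℓ) z₀ w =
      (J.mom z₀ (der J.base z₀ w), der P z₀ w, der (conorm g) z₀ w, ℓ (der J.emb z₀ w)) := by
  have hb := (J.contMDiff_base z₀).of_le (m := 1) (by simp)
  have he := (J.contMDiff_emb z₀).of_le (m := 1) (by simp)
  have h1 : ContMDiffAt cotModel 𝓘(ℝ, ℝ) 1 (fun u => J.mom z₀ (J.base u)) z₀ :=
    (J.mom z₀).contDiff.contMDiff.contMDiffAt.comp z₀ hb
  have h2 := (hP.smooth z₀ hz).of_le (m := 1) (by simp)
  have h3 := (contMDiffAt_conorm g hz).of_le (m := 1) (by simp)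
  have h4 : ContMDiffAt cotModel 𝓘(ℝ, ℝ) 1 (fun u => ℓ (J.emb u)) z₀ :=
    ℓ.contDiff.contMDiff.contMDiffAt.comp z₀ he
  have e1 : der (transCoord J g P z₀ ℓ) z₀ = (der (fun u => J.mom z₀ (J.base u)) z₀).prod
      ((der P z₀).prod ((der (conorm g) z₀).prod (der (fun u => ℓ (J.emb u)) z₀))) := by
    rw [← der_prodMk h3 h4, ← der_prodMk h2 (h3.prodMk_space h4),
      ← der_prodMk h1 (h2.prodMk_space (h3.prodMk_space h4))]
    rfl
  rw [e1, der_clm_comp _ hb, der_clm_comp _ he]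
  rfl

theorem finrank_phase : Module.finrank ℝ Phase = 4 := by
  have h : Module.finrank ℝ CoPlane = 2 := by
    rw [← (LinearMap.toContinuousLinearMap (𝕜 := ℝ) (E := Plane) (F' := ℝ)).finrank_eq,
      Module.finrank_linearMap]
    simp
  rw [Module.finrank_prod, h]
  simp

theorem bijective_der_transCoord (hP : IsSymbol P) {z₀ : Cotangent M} (hz : z₀ ∈ cosphere g)
    (hP0 : P z₀ = 0) (hX : normField g P z₀ ≠ 0) {ℓ : W × (W →L[ℝ] ℝ) →L[ℝ] ℝ}
    (hℓ : ℓ (der J.emb z₀ (normField g P z₀)) ≠ 0) :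
    Function.Bijective (der (transCoord J g P z₀ ℓ) z₀) := by
  have hn := cosphere_subset_nonzero g hz
  have hN := conorm_pos g hn
  set D := der (transCoord J g P z₀ ℓ) z₀ with hD
  have hDw : ∀ w, D w = (J.mom z₀ (der J.base z₀ w), der P z₀ w, der (conorm g) z₀ w,
    ℓ (der J.emb z₀ w)) := der_transCoord J hP hn ℓ
  suffices hs : Function.Surjective D by
    refine ⟨?_, hs⟩
    exact (LinearMap.injective_iff_surjective_of_finrank_eq_finrank
      (f := D.toLinearMap) (by rw [finrank_phase]; simp)).2 hs
  -- a linear relation between the four differentials is evaluated on the normalised field, the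
  -- radial field and finally, by nondegeneracy, on everything
  by_contra hs
  have hlt : LinearMap.range (D : Phase →ₗ[ℝ] ℝ × ℝ × ℝ × ℝ) < ⊤ := by
    rw [lt_top_iff_ne_top]
    exact fun h => hs (LinearMap.range_eq_top.1 h)
  obtain ⟨f, hf0, hf⟩ := Submodule.exists_le_ker_of_lt_top _ hlt
  have hfD : ∀ w, f (D w) = 0 := fun w => hf ⟨w, rfl⟩
  set c₁ := f (1, 0, 0, 0)
  set c₂ := f (0, 1, 0, 0)
  set c₃ := f (0, 0, 1, 0)
  set c₄ := f (0, 0, 0, 1)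
  have hfx : ∀ x₁ x₂ x₃ x₄ : ℝ, f (x₁, x₂, x₃, x₄) = x₁ * c₁ + x₂ * c₂ + x₃ * c₃ + x₄ * c₄ := by
    intro x₁ x₂ x₃ x₄
    have h : ((x₁, x₂, x₃, x₄) : ℝ × ℝ × ℝ × ℝ) = x₁ • ((1, 0, 0, 0) : ℝ × ℝ × ℝ × ℝ) +
        x₂ • ((0, 1, 0, 0) : ℝ × ℝ × ℝ × ℝ) + x₃ • ((0, 0, 1, 0) : ℝ × ℝ × ℝ × ℝ) +
        x₄ • ((0, 0, 0, 1) : ℝ × ℝ × ℝ × ℝ) := by simp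
    rw [h, map_add, map_add, map_add, map_smul, map_smul, map_smul, map_smul]
    rfl
  have hrel : ∀ w, J.mom z₀ (der J.base z₀ w) * c₁ + der P z₀ w * c₂ +
      der (conorm g) z₀ w * c₃ + ℓ (der J.emb z₀ w) * c₄ = 0 := by
    intro w
    rw [← hfx, ← hDw]
    exact hfD w
  have h4 : c₄ = 0 := by
    have h1 := hrel (normField g P z₀)
    rw [J.der_base_normField, J.mom_bracket_base g hP hn, ham, hP0,
      der_symbol_normField g hP hn, hP0, der_conorm_normField g hn] at h1
    simpa [hℓ] using h1
  have h3 : c₃ = 0 := by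
    have h1 := hrel (radial z₀)
    rw [J.der_base_radial, map_zero, der_symbol_radial hP hn, der_conorm_radial g hn, h4] at h1
    simpa [hN.ne'] using h1
  rw [h3, h4] at hrel
  have hpar : c₁ • radial z₀ = c₂ • flatHam (der P z₀) := by
    refine phase_ext fun w => ?_
    have h1 := hrel w
    rw [J.mom_der_base, ← flatHam_spec (der P z₀) w] at h1
    simp only [Prod.smul_fst, Prod.smul_snd, map_smul, smul_apply, smul_eq_mul]
    linarith
  have hXeq : normField g P z₀ = conorm g z₀ • flatHam (der P z₀) - growth g P z₀ • radial z₀ := by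
    rw [normField, der_ham g hP hn, hP0, zero_smul, add_zero, map_smul]
  have h2 : c₂ = 0 := by
    by_contra hc
    apply hX
    have e1 : flatHam (der P z₀) = (c₂⁻¹ * c₁) • radial z₀ := by
      rw [mul_smul, hpar, smul_smul, inv_mul_cancel₀ hc, one_smul]
    have e0 : ∀ (a b : ℝ) (x : Phase), a • x - b • x = (a - b) • x :=
      fun a b x => (sub_smul a b x).symm
    rw [e1, smul_smul, e0] at hXeq
    have e2 := der_conorm_normField (P := P) g hn
    rw [hXeq, map_smul, der_conorm_radial g hn, smul_eq_mul] at e2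
    rw [hXeq, (mul_eq_zero.1 e2).resolve_right hN.ne', zero_smul]
  have h1 : c₁ = 0 := by
    rw [h2, zero_smul] at hpar
    exact (smul_eq_zero.1 hpar).resolve_right (radial_ne_zero g hn)
  apply hf0
  ext <;> simp [hfx, h1, h2, h3, h4]

theorem exists_transversal {z₀ : Cotangent M} (hX : normField g P z₀ ≠ 0) :
    ∃ ℓ : W × (W →L[ℝ] ℝ) →L[ℝ] ℝ, ℓ (der J.emb z₀ (normField g P z₀)) ≠ 0 := by
  have h : der J.emb z₀ (normField g P z₀) ≠ 0 := fun h =>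
    hX (J.injective_der_emb z₀ (by rw [h, map_zero]))
  obtain ⟨ℓ, -, hℓ⟩ := exists_dual_vector ℝ _ (norm_ne_zero_iff.2 h)
  exact ⟨ℓ, by rw [hℓ]; exact_mod_cast (norm_pos_iff.2 h).ne'⟩

end Transversal

/-! ### Geometry near a closed orbit -/

namespace IsCycle

variable {γ : ℝ → Cotangent M} {T : ℝ} (hγ : IsCycle g P γ T)
variable [CompactSpace M] [FiniteDimensional ℝ W] (J : ExactEmbedding M W) (hP : IsSymbol P)
include hγ J hP

omit [CompactSpace M] [FiniteDimensional ℝ W] in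
theorem hasStrictDerivAt_emb (ℓ : W × (W →L[ℝ] ℝ) →L[ℝ] ℝ) (τ : ℝ) :
    HasStrictDerivAt (fun s => ℓ (J.emb (γ s))) (ℓ (der J.emb (γ τ) (normField g P (γ τ)))) τ := by
  have hd : ∀ s, HasDerivAt (fun s => ℓ (J.emb (γ s)))
      (ℓ (der J.emb (γ s) (normField g P (γ s)))) s := fun s =>
    ℓ.hasFDerivAt.comp_hasDerivAt s (hγ.curve.hasDerivAt (J.contMDiff_emb _))
  refine hasStrictDerivAt_of_hasDerivAt_of_continuousAt (Eventually.of_forall hd) ?_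
  exact ℓ.continuous.continuousAt.comp
    ((J.contMDiffAt_der_emb_normField g hP
      (cosphere_subset_nonzero g (hγ.curve τ).1)).continuousAt.comp
      (f := γ) hγ.curve.continuous.continuousAt)

/-- The canonical one-form vanishes on a closed orbit, so that the action between two of its points
is quadratically small. -/
theorem exists_action_le (hX : ∀ t, normField g P (γ t) ≠ 0) :
    ∃ K : ℝ, 0 ≤ K ∧ ∀ z ∈ range γ, ∀ z' ∈ range γ,
      |J.action z z'| ≤ K * ‖J.emb z - J.emb z'‖ ^ 2 := by
  have hC := hγ.isCompact_range
  have hsub := hγ.range_subset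
  have hba : ∀ z ∈ cosphere g, ContMDiffAt cotModel 𝓘(ℝ, W) ∞ (bracket (ham g P) J.base) z :=
    fun z hz => J.contMDiffAt_bracket (contMDiffAt_ham g hP (cosphere_subset_nonzero g hz))
      (J.contMDiff_base z)
  obtain ⟨B, hB⟩ := (isCompact_cosphere g).exists_bound_of_continuousOn
    fun z hz => (hba z hz).continuousAt.continuousWithinAt
  obtain ⟨A, hA⟩ := (isCompact_cosphere g).exists_bound_of_continuousOn
    J.contMDiff_mom.continuous.continuousOn
  obtain ⟨E, hE⟩ := (isCompact_cosphere g).exists_bound_of_continuousOn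
    J.contMDiff_base.continuous.continuousOn
  obtain ⟨Y, hY⟩ := (isCompact_cosphere g).exists_bound_of_continuousOn
    (f := fun u => der J.emb u (normField g P u)) fun z hz =>
      (J.contMDiffAt_der_emb_normField g hP
        (cosphere_subset_nonzero g hz)).continuousAt.continuousWithinAt
  have hA0 : 0 ≤ A := (norm_nonneg _).trans (hA _ (hγ.curve 0).1)
  have hB0 : 0 ≤ B := (norm_nonneg _).trans (hB _ (hγ.curve 0).1)
  have hY0 : 0 ≤ Y := (norm_nonneg _).trans (hY _ (hγ.curve 0).1)
  -- the mean value inequality in terms of the time difference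
  have hlip : ∀ s τ, ‖J.emb (γ τ) - J.emb (γ s)‖ ≤ Y * |τ - s| := fun s τ =>
    (convex_univ).norm_image_sub_le_of_norm_hasDerivWithin_le (f := fun t => J.emb (γ t))
      (fun t _ => (hγ.curve.hasDerivAt (J.contMDiff_emb _)).hasDerivWithinAt)
      (fun t _ => hY _ (hγ.curve t).1) (mem_univ s) (mem_univ τ)
  have hact : ∀ s τ, |J.action (γ s) (γ τ)| ≤ Y * B * |τ - s| ^ 2 := by
    intro s τ
    have hd : ∀ t, HasDerivAt (fun t => J.action (γ s) (γ t))
        (J.mom (γ s) (bracket (ham g P) J.base (γ t))) t := by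
      intro t
      have h1 := hγ.curve.hasDerivAt (t := t) (J.contMDiff_base _)
      rw [J.der_base_normField] at h1
      exact (J.mom (γ s)).hasFDerivAt.comp_hasDerivAt t (h1.sub_const _)
    have hbd : ∀ t ∈ uIcc s τ, ‖J.mom (γ s) (bracket (ham g P) J.base (γ t))‖ ≤
        Y * |τ - s| * B := by
      intro t ht
      have h0 : J.mom (γ t) (bracket (ham g P) J.base (γ t)) = 0 := by
        rw [J.mom_bracket_base g hP (cosphere_subset_nonzero g (hγ.curve t).1), ham, hγ.symbol,
          mul_zero]
      have h1 : J.mom (γ s) (bracket (ham g P) J.base (γ t)) =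
          (J.mom (γ s) - J.mom (γ t)) (bracket (ham g P) J.base (γ t)) := by
        rw [sub_apply, h0, sub_zero]
      rw [h1]
      refine ((J.mom (γ s) - J.mom (γ t)).le_opNorm _).trans ?_
      refine mul_le_mul ?_ (hB _ (hγ.curve t).1) (norm_nonneg _) (by positivity)
      have h2 : ‖J.mom (γ s) - J.mom (γ t)‖ ≤ ‖J.emb (γ s) - J.emb (γ t)‖ :=
        norm_snd_le (J.emb (γ s) - J.emb (γ t))
      refine h2.trans ((norm_sub_rev _ _).trans_le ((hlip s t).trans
        (mul_le_mul_of_nonneg_left (abs_sub_left_of_mem_uIcc ht) hY0)))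
    have h3 := (convex_uIcc s τ).norm_image_sub_le_of_norm_hasDerivWithin_le
      (fun t _ => (hd t).hasDerivWithinAt) hbd left_mem_uIcc right_mem_uIcc
    have h4 : J.action (γ s) (γ s) = 0 := by rw [ExactEmbedding.action, sub_self, map_zero]
    rw [h4, sub_zero] at h3
    refine h3.trans (le_of_eq ?_)
    rw [Real.norm_eq_abs]
    ring
  obtain ⟨K, hK, h⟩ := exists_uniform_bound_of_diagonal (hC.prod hC)
    (R := fun p => |J.action p.1 p.2|) (Q := fun p => ‖J.emb p.1 - J.emb p.2‖ ^ 2)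
    (fun p _ => sq_nonneg _) (J.continuous_norm_emb_sub.pow 2).continuousOn
    (fun p _ hp => pow_pos (J.norm_emb_sub_pos hp) 2)
    ⟨A * (E + E), fun p hp => ((J.mom p.1).le_opNorm _).trans
      (mul_le_mul (hA _ (hsub hp.1)) ((norm_sub_le _ _).trans
        (add_le_add (hE _ (hsub hp.2)) (hE _ (hsub hp.1)))) (norm_nonneg _) hA0)⟩ (by
      rintro z ⟨⟨τ, rfl⟩, -⟩
      obtain ⟨ℓ, hℓ⟩ := exists_transversal J (hX τ)
      set c := |ℓ (der J.emb (γ τ) (normField g P (γ τ)))| with hc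
      have hc0 : 0 < c := abs_pos.2 hℓ
      have hstrict := (hγ.hasStrictDerivAt_emb J hP ℓ τ).isLittleO.def (half_pos hc0)
      rw [nhds_prod_eq, eventually_prod_self_iff'] at hstrict
      obtain ⟨N, hN, hNN⟩ := hstrict
      obtain ⟨η, hη, hηN⟩ := Metric.mem_nhds_iff.1 hN
      obtain ⟨O, hO, hOarc⟩ := hγ.exists_arc J hP τ hη
      refine ⟨Y * B * (2 * ‖ℓ‖ / c) ^ 2, by positivity, ?_⟩
      rw [nhds_prod_eq]
      filter_upwards [prod_mem_prod hO hO] with p hp hpC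
      obtain ⟨s, hs, hsp⟩ := hOarc p.1 hp.1 hpC.1
      obtain ⟨t, ht, htp⟩ := hOarc p.2 hp.2 hpC.2
      rw [← hsp, ← htp]
      have h1 := hNN s (hηN hs) t (hηN ht)
      have h2 : |s - t| ≤ 2 * ‖ℓ‖ / c * ‖J.emb (γ s) - J.emb (γ t)‖ := by
        have h3 : |(s - t) * ℓ (der J.emb (γ τ) (normField g P (γ τ)))| ≤
            |ℓ (J.emb (γ s)) - ℓ (J.emb (γ t))| + c / 2 * |s - t| := by
          have h4 := abs_sub_abs_le_abs_sub
            ((s - t) * ℓ (der J.emb (γ τ) (normField g P (γ τ))))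
            (ℓ (J.emb (γ s)) - ℓ (J.emb (γ t)))
          simp only [ContinuousLinearMap.toSpanSingleton_apply,
            smul_eq_mul, Real.norm_eq_abs] at h1
          rw [abs_sub_comm] at h1
          linarith
        rw [abs_mul, ← hc, ← map_sub] at h3
        have h5 := ℓ.le_opNorm (J.emb (γ s) - J.emb (γ t))
        rw [Real.norm_eq_abs] at h5
        rw [div_mul_eq_mul_div, le_div_iff₀ hc0]
        linarith
      refine (hact s t).trans ?_
      rw [abs_sub_comm]
      calc _ ≤ Y * B * (2 * ‖ℓ‖ / c * ‖J.emb (γ s) - J.emb (γ t)‖) ^ 2 := by gcongr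
        _ = _ := by ring)
  exact ⟨K, hK, fun z hz z' hz' => h (z, z') ⟨hz, hz'⟩⟩

end IsCycle

end

section

variable {g : Metric M} {P : Cotangent M → ℝ}

/-- Absorption of the small terms in the estimate of the distance to a closed orbit. -/
theorem le_of_absorb {K₀ K₃ r D d a b x : ℝ} (hK₀ : 0 ≤ K₀) (hK₃ : 0 ≤ K₃) (hr : 0 ≤ r)
    (ha : 0 ≤ a) (hb : 0 ≤ b) (hD : 0 ≤ D) (hrK : r * (8 * (K₀ * K₃ + K₀ + 1)) = 1)
    (hDr : D ≤ 2 * r) (h : D ≤ K₀ * (x + b)) (hx : x ≤ a + K₃ * (2 * d ^ 2 + 2 * D ^ 2) + r * D) :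
    D ≤ 2 * K₀ * (1 + 2 * K₃) * (a + b + d ^ 2) := by
  have h1 : D ≤ K₀ * (a + K₃ * (2 * d ^ 2) + b) + (K₀ * K₃ * (4 * r) + K₀ * r) * D := by
    have h10 : D ^ 2 ≤ 2 * r * D := by nlinarith
    have h11 : K₀ * (K₃ * (2 * D ^ 2)) ≤ K₀ * (K₃ * (2 * (2 * r * D))) := by gcongr
    have h12 : K₀ * (x + b) ≤ K₀ * (a + K₃ * (2 * d ^ 2 + 2 * D ^ 2) + r * D + b) := by gcongr
    linarith
  have h2 : (K₀ * K₃ * (4 * r) + K₀ * r) * D ≤ 1 / 2 * D := by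
    have := mul_nonneg hK₀ hK₃
    gcongr
    nlinarith
  have h3 : D ≤ 2 * (K₀ * (a + K₃ * (2 * d ^ 2) + b)) := by linarith
  have h4 : 0 ≤ K₀ * K₃ * (a + b) := by positivity
  have h5 : 0 ≤ K₀ * d ^ 2 := by positivity
  linarith

namespace IsCycle

variable {γ : ℝ → Cotangent M} {T : ℝ} (hγ : IsCycle g P γ T)
variable [CompactSpace M] [FiniteDimensional ℝ W] (J : ExactEmbedding M W) (hP : IsSymbol P)
include hγ J hP

set_option maxHeartbeats 400000 in
/-- The distance to a closed orbit is controlled by the action, the symbol, and a quadratic term. -/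
theorem exists_infDist_le (hX : ∀ t, normField g P (γ t) ≠ 0) :
    ∃ K : ℝ, 0 ≤ K ∧ ∀ z ∈ range γ, ∀ u ∈ cosphere g,
      Metric.infDist (J.emb u) (J.emb '' range γ) ≤
        K * (|J.action z u| + |P u| + ‖J.emb z - J.emb u‖ ^ 2) := by
  have hC := hγ.isCompact_range
  have hsub := hγ.range_subset
  have hJc := J.contMDiff_emb.continuous
  obtain ⟨E, hE⟩ := (isCompact_cosphere g).exists_bound_of_continuousOn hJc.continuousOn
  obtain ⟨K₃, hK₃, hact⟩ := hγ.exists_action_le J hP hX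
  have hPc : ContinuousOn P (cosphere g) := fun z hz =>
    (hP.smooth z (cosphere_subset_nonzero g hz)).continuousAt.continuousWithinAt
  have hactc : Continuous fun p : Cotangent M × Cotangent M => J.action p.1 p.2 := by
    have h1 : Continuous fun p : Cotangent M × Cotangent M => J.base p.2 - J.base p.1 :=
      (J.contMDiff_base.continuous.comp continuous_snd).sub
        (J.contMDiff_base.continuous.comp continuous_fst)
    exact (J.contMDiff_mom.continuous.comp continuous_fst).clm_apply h1
  obtain ⟨K, hK, h⟩ := exists_uniform_bound_of_diagonal (hC.prod (isCompact_cosphere g))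
    (R := fun p => Metric.infDist (J.emb p.2) (J.emb '' range γ))
    (Q := fun p => |J.action p.1 p.2| + |P p.2| + ‖J.emb p.1 - J.emb p.2‖ ^ 2)
    (fun p _ => by positivity)
    ((hactc.continuousOn.abs.add (hPc.comp continuousOn_snd fun p hp => hp.2).abs).add
      (J.continuous_norm_emb_sub.pow 2).continuousOn)
    (fun p _ hp => by
      have := pow_pos (J.norm_emb_sub_pos hp) 2
      positivity)
    ⟨E + E, fun p hp => by
      refine (Metric.infDist_le_dist_of_mem (mem_image_of_mem _ (mem_range_self 0))).trans ?_
      rw [dist_eq_norm]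
      exact (norm_sub_le _ _).trans (add_le_add (hE _ hp.2) (hE _ (hγ.curve 0).1))⟩ (by
      rintro z ⟨⟨τ, rfl⟩, -⟩
      set z₀ := γ τ with hz₀
      have hz₀S := (hγ.curve τ).1
      have hn := cosphere_subset_nonzero g hz₀S
      obtain ⟨ℓ, hℓ⟩ := exists_transversal J (hX τ)
      obtain ⟨K₁, hK₁, h1⟩ := eventually_norm_sub_le_of_immersion
        (contMDiffAt_transCoord (z₀ := z₀) J hP hn ℓ)
        (bijective_der_transCoord J hP hz₀S (hγ.symbol τ) (hX τ) hℓ).1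
      obtain ⟨K₂, hK₂, h2⟩ := eventually_norm_sub_le (J.contMDiff_emb z₀)
      set K₀ := K₂ * K₁ with hK₀
      have hK₀0 : 0 ≤ K₀ := mul_nonneg hK₂ hK₁
      have h12 := h1.and h2
      rw [nhds_prod_eq, eventually_prod_self_iff'] at h12
      obtain ⟨O, hO, hOO⟩ := h12
      -- the radius below which the quadratic error terms can be absorbed
      set r : ℝ := 1 / (8 * (K₀ * K₃ + K₀ + 1)) with hr
      have hr0 : 0 < r := by positivity
      have hrK : r * (8 * (K₀ * K₃ + K₀ + 1)) = 1 := by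
        rw [hr]
        field_simp
      have hnear : ∀ᶠ u in 𝓝 z₀, u ∈ O ∧ ‖J.emb u - J.emb z₀‖ < r := by
        have h3 : ContinuousAt (fun u => ‖J.emb u - J.emb z₀‖) z₀ :=
          ((hJc.sub continuous_const).norm).continuousAt
        refine Filter.Eventually.and hO (h3.eventually (gt_mem_nhds ?_))
        change ‖J.emb z₀ - J.emb z₀‖ < r
        rwa [sub_self, norm_zero]
      have hcurve : ∀ᶠ y in 𝓝 (ℓ (J.emb z₀)), ∃ s, (γ s ∈ O ∧ ‖J.emb (γ s) - J.emb z₀‖ < r) ∧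
          ℓ (J.emb (γ s)) = y := by
        have h4 := (hγ.hasStrictDerivAt_emb J hP ℓ τ).map_nhds_eq hℓ
        rw [← h4]
        refine Filter.mem_map.2 ?_
        filter_upwards [hγ.curve.continuous.continuousAt.eventually hnear] with s hs
        exact ⟨s, hs, rfl⟩
      have hℓc : ContinuousAt (fun u => ℓ (J.emb u)) z₀ := (ℓ.continuous.comp hJc).continuousAt
      refine ⟨2 * K₀ * (1 + 2 * K₃), by positivity, ?_⟩
      rw [nhds_prod_eq]
      filter_upwards [prod_mem_prod hnear (hnear.and (hℓc.eventually hcurve))]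
      rintro ⟨z, u⟩ ⟨⟨hzO, hzr⟩, ⟨huO, hur⟩, s, ⟨hsO, hsr⟩, hs⟩ ⟨hzC, huS⟩
      simp only at hzO hzr huO hur hs hzC huS ⊢
      -- the point `z'` of the orbit has the same value of `ℓ` as `u`, so that only the action and
      -- `P` separate the two points in the transversal coordinates
      set z' := γ s with hz'
      set D := ‖J.emb u - J.emb z'‖ with hD
      have hD0 : 0 ≤ D := norm_nonneg _
      have hinf : Metric.infDist (J.emb u) (J.emb '' range γ) ≤ D := by
        refine (Metric.infDist_le_dist_of_mem (mem_image_of_mem _ (mem_range_self s))).trans ?_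
        rw [dist_eq_norm]
      have hDr : D ≤ 2 * r := by
        have := norm_sub_le_norm_sub_add_norm_sub (J.emb u) (J.emb z₀) (J.emb z')
        rw [norm_sub_rev (J.emb z₀)] at this
        linarith
      have hG : D ≤ K₀ * (|J.mom z₀ (J.base u - J.base z')| + |P u|) := by
        have h5 := hOO u huO z' hsO
        have h6 : transCoord J g P z₀ ℓ u - transCoord J g P z₀ ℓ z' =
            (J.mom z₀ (J.base u - J.base z'), P u, 0, 0) := by
          simp only [transCoord, Prod.mk_sub_mk, map_sub]
          rw [hz', hγ.symbol s, sub_zero, show conorm g u = 1 from huS,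
            show conorm g (γ s) = 1 from (hγ.curve s).1, sub_self, ← hs, sub_self]
        have h7 : ‖transCoord J g P z₀ ℓ u - transCoord J g P z₀ ℓ z'‖ ≤
            |J.mom z₀ (J.base u - J.base z')| + |P u| := by
          rw [h6]
          simp only [Prod.norm_def, norm_zero, Real.norm_eq_abs, max_self]
          refine max_le (by linarith [abs_nonneg (P u)]) (max_le ?_ ?_)
          · linarith [abs_nonneg (J.mom z₀ (J.base u - J.base z'))]
          · positivity
        calc D ≤ K₂ * (K₁ * ‖transCoord J g P z₀ ℓ u - transCoord J g P z₀ ℓ z'‖) :=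
              h5.2.trans (mul_le_mul_of_nonneg_left h5.1 hK₂)
          _ ≤ K₂ * (K₁ * (|J.mom z₀ (J.base u - J.base z')| + |P u|)) := by gcongr
          _ = _ := by ring
      have hA1 : J.mom z₀ (J.base u - J.base z') = J.action z u - J.action z z' +
          (J.mom z₀ - J.mom z) (J.base u - J.base z') := by
        simp only [ExactEmbedding.action, sub_apply, map_sub]
        ring
      have hA2 : |(J.mom z₀ - J.mom z) (J.base u - J.base z')| ≤ r * D := by
        refine ((J.mom z₀ - J.mom z).le_opNorm _).trans ?_
        refine mul_le_mul ?_ (norm_fst_le (J.emb u - J.emb z')) (norm_nonneg _) hr0.le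
        refine (norm_snd_le (J.emb z₀ - J.emb z)).trans ?_
        rw [norm_sub_rev]
        exact hzr.le
      set d := ‖J.emb z - J.emb u‖ with hd
      have hA3 : |J.action z z'| ≤ K₃ * (2 * d ^ 2 + 2 * D ^ 2) := by
        refine (hact z hzC z' (mem_range_self s)).trans ?_
        gcongr
        have h8 : ‖J.emb z - J.emb z'‖ ≤ d + D := norm_sub_le_norm_sub_add_norm_sub _ _ _
        have h9 : ‖J.emb z - J.emb z'‖ ^ 2 ≤ (d + D) ^ 2 := by gcongr
        nlinarith [sq_nonneg (d - D)]
      have hA4 : |J.mom z₀ (J.base u - J.base z')| ≤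
          |J.action z u| + K₃ * (2 * d ^ 2 + 2 * D ^ 2) + r * D := by
        rw [hA1]
        refine (abs_add_le _ _).trans (add_le_add ((abs_sub _ _).trans ?_) hA2)
        linarith
      exact hinf.trans (le_of_absorb hK₀0 hK₃ hr0.le (abs_nonneg _) (abs_nonneg _) hD0 hrK hDr hG
        hA4))
  exact ⟨K, hK, fun z hz u hu => h (z, u) ⟨hz, hu⟩⟩

end IsCycle

/-! ### Attraction to a closed orbit as time tends to minus infinity -/

theorem logGrowth_add [CompactSpace M] (J : ExactEmbedding M W) (hP : IsSymbol P)
    {η : ℝ → Cotangent M} (h : IsNormCurve g P η) (a b : ℝ) :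
    logGrowth g P η (a + b) = logGrowth g P η a + logGrowth g P (fun t => η (t + a)) b := by
  have hc := continuous_growth_curve J hP h
  rw [logGrowth, logGrowth, logGrowth, intervalIntegral.integral_comp_add_right
    (fun t => growth g P (η t)), zero_add, add_comm b a,
    intervalIntegral.integral_add_adjacent_intervals (hc.intervalIntegrable _ _)
      (hc.intervalIntegrable _ _)]

section

variable [CompactSpace M] [FiniteDimensional ℝ W] (J : ExactEmbedding M W) (hP : IsSymbol P)
include J hP

theorem exists_logGrowth_sub_le : ∃ G : ℝ, 0 ≤ G ∧ ∃ L : ℝ, 0 ≤ L ∧ ∀ η ζ : ℝ → Cotangent M,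
    IsNormCurve g P η → IsNormCurve g P ζ → ∀ t, |logGrowth g P η t - logGrowth g P ζ t| ≤
      G * Real.exp (L * |t|) * ‖J.emb (η 0) - J.emb (ζ 0)‖ * |t| := by
  obtain ⟨G, hG, h1⟩ := J.exists_lipschitz (isCompact_cosphere g) fun z hz =>
    J.contMDiffAt_growth g hP (cosphere_subset_nonzero g hz)
  obtain ⟨L, hL, h2⟩ := J.exists_norm_emb_sub_le (g := g) hP
  refine ⟨G, hG, L, hL, fun η ζ hη hζ t => ?_⟩
  have h3 := intervalIntegral.norm_integral_le_of_norm_le_const (a := 0) (b := t)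
    (f := fun s => growth g P (η s) - growth g P (ζ s))
    (C := G * Real.exp (L * |t|) * ‖J.emb (η 0) - J.emb (ζ 0)‖) fun s hs => by
      refine (h1 _ (hη s).1 _ (hζ s).1).trans ?_
      rw [mul_assoc]
      refine mul_le_mul_of_nonneg_left ((h2 η ζ hη hζ s).trans ?_) hG
      have : |s| ≤ |t| := by
        simpa using abs_sub_left_of_mem_uIcc (uIoc_subset_uIcc hs)
      gcongr
  rw [intervalIntegral.integral_sub
    ((continuous_growth_curve J hP hη).intervalIntegrable _ _)
    ((continuous_growth_curve J hP hζ).intervalIntegrable _ _), sub_zero] at h3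
  exact h3

end

namespace IsCycle

variable {γ : ℝ → Cotangent M} {T : ℝ} (hγ : IsCycle g P γ T)
variable [CompactSpace M] [FiniteDimensional ℝ W] (J : ExactEmbedding M W) (hP : IsSymbol P)
include hγ J hP

omit [CompactSpace M] [FiniteDimensional ℝ W] hP in
theorem exists_nearest (u : Cotangent M) :
    ∃ s, Metric.infDist (J.emb u) (J.emb '' range γ) = ‖J.emb u - J.emb (γ s)‖ := by
  obtain ⟨_, ⟨_, ⟨s, rfl⟩, rfl⟩, h⟩ := (hγ.isCompact_range.image
    J.contMDiff_emb.continuous).exists_infDist_eq_dist ((range_nonempty γ).image _) (J.emb u)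
  exact ⟨s, by rw [h, dist_eq_norm]⟩

/-- Going backwards in time by a large multiple of the period contracts the distance to a closed
orbit along which `|ξ|` decreases, and makes `|ξ|` grow. -/
theorem exists_contraction (hX : ∀ t, normField g P (γ t) ≠ 0) (hneg : logGrowth g P γ T < 0) :
    ∃ τ > 0, ∃ δ > 0, ∀ η : ℝ → Cotangent M, IsNormCurve g P η →
      Metric.infDist (J.emb (η 0)) (J.emb '' range γ) < δ →
      Metric.infDist (J.emb (η (-τ))) (J.emb '' range γ) ≤
        1 / 2 * Metric.infDist (J.emb (η 0)) (J.emb '' range γ) ∧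
      1 ≤ logGrowth g P η (-τ) := by
  obtain ⟨K, hK, hgeo⟩ := hγ.exists_infDist_le J hP hX
  obtain ⟨A, hA⟩ := (isCompact_cosphere g).exists_bound_of_continuousOn
    J.contMDiff_mom.continuous.continuousOn
  have hA0 : 0 ≤ A := (norm_nonneg _).trans (hA _ (hγ.curve 0).1)
  obtain ⟨B, hB0, hB⟩ := J.exists_lipschitz (isCompact_cosphere g) fun z hz =>
    hP.smooth z (cosphere_subset_nonzero g hz)
  obtain ⟨G, hG0, L', hL'0, hG⟩ := exists_logGrowth_sub_le (g := g) J hP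
  obtain ⟨L, hL0, hL⟩ := J.exists_norm_emb_sub_le (g := g) hP
  set I := -logGrowth g P γ T with hI
  have hI0 : 0 < I := by linarith
  have hT := hγ.pos
  -- after `n` periods the linear part of the estimate is a contraction; `δ` is chosen afterwards,
  -- to make the quadratic errors small
  obtain ⟨n, hn1, hn2, hn3⟩ : ∃ n : ℕ, 1 ≤ n ∧ 2 ≤ n * I ∧
      K * (A + B * Real.exp 1) * Real.exp (-(n * I)) ≤ 1 / 4 := by
    have h1 : Tendsto (fun n : ℕ => (n : ℝ) * I) atTop atTop :=
      tendsto_natCast_atTop_atTop.atTop_mul_const hI0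
    have h2 : Tendsto (fun n : ℕ => K * (A + B * Real.exp 1) * Real.exp (-(n * I))) atTop
        (𝓝 0) := by
      have h3 := (Real.tendsto_exp_neg_atTop_nhds_zero.comp h1).const_mul
        (K * (A + B * Real.exp 1))
      rw [mul_zero] at h3
      exact h3
    exact ((eventually_ge_atTop 1).and ((h1.eventually_ge_atTop 2).and
      (h2.eventually (ge_mem_nhds (by norm_num))))).exists
  have hn0 : (0 : ℝ) < n := by exact_mod_cast hn1
  set τ := n * T with hτ
  have hτ0 : 0 < τ := mul_pos hn0 hT
  obtain ⟨C, hC0, hC⟩ := exists_action_estimate (g := g) J hP τ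
  set δ : ℝ := min (1 / (4 * (K * (C + Real.exp (L * τ) ^ 2) + 1)))
    (1 / (G * Real.exp (L' * τ) * τ + 1)) with hδ
  have hδ0 : 0 < δ := lt_min (by positivity) (by positivity)
  refine ⟨τ, hτ0, δ, hδ0, fun η hη hηδ => ?_⟩
  obtain ⟨s, hs⟩ := hγ.exists_nearest J (η 0)
  set ρ := Metric.infDist (J.emb (η 0)) (J.emb '' range γ) with hρ
  have hρ0 : 0 ≤ ρ := Metric.infDist_nonneg
  have hγs := hγ.shift J hP s
  set ζ : ℝ → Cotangent M := fun t => γ (t + s) with hζ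
  have hζ0 : ζ 0 = γ s := by simp [hζ]
  have hτabs : |(-τ)| = τ := by rw [abs_neg, abs_of_pos hτ0]
  have hζlog : logGrowth g P ζ (-τ) = n * I := by
    have h1 := hγs.logGrowth_int_mul J hP (-n)
    rw [hγ.logGrowth_shift s] at h1
    push_cast at h1
    rw [hτ, ← neg_mul, h1, hI]
    ring
  have hd0 : ‖J.emb (ζ 0) - J.emb (η 0)‖ = ρ := by rw [hζ0, norm_sub_rev, ← hs]
  have hlog : |logGrowth g P η (-τ) - n * I| ≤ 1 := by
    have h1 := hG η ζ hη hγs.curve (-τ)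
    rw [hζlog, hτabs, norm_sub_rev, hd0] at h1
    refine h1.trans ?_
    have h2 : ρ ≤ 1 / (G * Real.exp (L' * τ) * τ + 1) := hηδ.le.trans (min_le_right _ _)
    rw [le_div_iff₀ (by positivity)] at h2
    nlinarith
  have hlog' : n * I - 1 ≤ logGrowth g P η (-τ) := by
    have := (abs_le.1 hlog).1
    linarith
  refine ⟨?_, by linarith⟩
  -- backwards in time the action contracts by the factor by which `|ξ|` grows, up to an error
  -- which is quadratic in the distance
  have hact : |J.action (ζ (-τ)) (η (-τ))| ≤ (A * ρ + C * ρ ^ 2) * Real.exp (-(n * I)) := by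
    have h1 := hC ζ η hγs.curve hη (-τ) hτabs.le
    rw [hζlog, hd0] at h1
    have h2 : |J.action (ζ 0) (η 0)| ≤ A * ρ := by
      refine ((J.mom (ζ 0)).le_opNorm _).trans ?_
      refine mul_le_mul (hA _ (hγs.curve 0).1) ?_ (norm_nonneg _) hA0
      rw [← hd0, norm_sub_rev]
      exact norm_fst_le (J.emb (ζ 0) - J.emb (η 0))
    have h3 : |J.action (ζ (-τ)) (η (-τ))| * Real.exp (n * I) ≤ A * ρ + C * ρ ^ 2 := by
      have h4 := abs_sub_abs_le_abs_sub (J.action (ζ (-τ)) (η (-τ)) * Real.exp (n * I))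
        (J.action (ζ 0) (η 0))
      rw [abs_mul, Real.abs_exp] at h4
      linarith
    rw [Real.exp_neg, ← div_eq_mul_inv, le_div_iff₀ (Real.exp_pos _)]
    exact h3
  -- `|ξ| P` is conserved, and so `P` contracts by the same factor
  have hsym : |P (η (-τ))| ≤ B * Real.exp 1 * ρ * Real.exp (-(n * I)) := by
    have h1 := hη.symbol_mul_exp J hP (-τ)
    have h2 : |P (η 0)| ≤ B * ρ := by
      have h3 := hB _ (hη 0).1 _ (hγs.curve 0).1
      rw [hγs.symbol, sub_zero, norm_sub_rev, hd0] at h3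
      exact h3
    have h3 : |P (η (-τ))| * Real.exp (n * I - 1) ≤ B * ρ := by
      rw [← h1, abs_mul, Real.abs_exp] at h2
      exact le_trans (by gcongr) h2
    have h4 : B * Real.exp 1 * ρ * Real.exp (-(n * I)) = B * ρ / Real.exp (n * I - 1) := by
      rw [Real.exp_sub, Real.exp_neg]
      field_simp
    rw [h4, le_div_iff₀ (Real.exp_pos _)]
    exact h3
  have hdist : ‖J.emb (ζ (-τ)) - J.emb (η (-τ))‖ ≤ Real.exp (L * τ) * ρ := by
    have h1 := hL ζ η hγs.curve hη (-τ)
    rwa [hτabs, hd0] at h1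
  have hfin := hgeo (ζ (-τ)) (mem_range_self _) (η (-τ)) (hη _).1
  have hexp : Real.exp (-(n * I)) ≤ 1 := Real.exp_le_one_iff.2 (by nlinarith)
  have hδ1 : ρ * (4 * (K * (C + Real.exp (L * τ) ^ 2) + 1)) ≤ 1 := by
    have h2 := hηδ.le.trans (min_le_left _ _)
    rwa [le_div_iff₀ (by positivity)] at h2
  have hsq : ‖J.emb (ζ (-τ)) - J.emb (η (-τ))‖ ^ 2 ≤ Real.exp (L * τ) ^ 2 * ρ ^ 2 := by
    rw [← mul_pow]
    gcongr
  calc _ ≤ K * (|J.action (ζ (-τ)) (η (-τ))| + |P (η (-τ))| +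
        ‖J.emb (ζ (-τ)) - J.emb (η (-τ))‖ ^ 2) := hfin
    _ ≤ K * ((A * ρ + C * ρ ^ 2) * Real.exp (-(n * I)) +
        B * Real.exp 1 * ρ * Real.exp (-(n * I)) + Real.exp (L * τ) ^ 2 * ρ ^ 2) := by gcongr
    _ = K * (A + B * Real.exp 1) * Real.exp (-(n * I)) * ρ +
        K * (C * Real.exp (-(n * I)) + Real.exp (L * τ) ^ 2) * ρ * ρ := by ring
    _ ≤ 1 / 4 * ρ + K * (C * 1 + Real.exp (L * τ) ^ 2) * ρ * ρ := by gcongr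
    _ ≤ 1 / 4 * ρ + 1 / 4 * ρ := by
        gcongr
        nlinarith
    _ = 1 / 2 * ρ := by ring

end IsCycle

end

section

variable {g : Metric M} {P : Cotangent M → ℝ}

namespace IsCycle

variable {γ : ℝ → Cotangent M} {T : ℝ} (hγ : IsCycle g P γ T)
variable [CompactSpace M] [FiniteDimensional ℝ W] (J : ExactEmbedding M W) (hP : IsSymbol P)
include hγ J hP

theorem exists_infDist_curve_le : ∃ L : ℝ, 0 ≤ L ∧ ∀ η : ℝ → Cotangent M, IsNormCurve g P η → ∀ t,
    Metric.infDist (J.emb (η t)) (J.emb '' range γ) ≤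
      Real.exp (L * |t|) * Metric.infDist (J.emb (η 0)) (J.emb '' range γ) := by
  obtain ⟨L, hL0, hL⟩ := J.exists_norm_emb_sub_le (g := g) hP
  refine ⟨L, hL0, fun η hη t => ?_⟩
  obtain ⟨s, hs⟩ := hγ.exists_nearest J (η 0)
  have h1 := hL η _ hη (hγ.curve.shift s) t
  rw [zero_add, ← hs] at h1
  refine (Metric.infDist_le_dist_of_mem (mem_image_of_mem _ (mem_range_self (t + s)))).trans ?_
  rwa [dist_eq_norm]

theorem exists_backward_attraction (hX : ∀ t, normField g P (γ t) ≠ 0)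
    (hneg : logGrowth g P γ T < 0) :
    ∃ δ > 0, (∀ ε > 0, ∃ T₀ : ℝ, ∀ η : ℝ → Cotangent M, IsNormCurve g P η →
        Metric.infDist (J.emb (η 0)) (J.emb '' range γ) < δ → ∀ t ≤ T₀,
          Metric.infDist (J.emb (η t)) (J.emb '' range γ) < ε) ∧
      ∃ K : ℝ, ∃ θ > 0, ∀ η : ℝ → Cotangent M, IsNormCurve g P η →
        Metric.infDist (J.emb (η 0)) (J.emb '' range γ) < δ → ∀ t ≤ 0,
          θ * |t| - K ≤ logGrowth g P η t := by
  obtain ⟨τ, hτ, δ, hδ, hstep⟩ := hγ.exists_contraction J hP hX hneg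
  obtain ⟨L, hL0, hL⟩ := hγ.exists_infDist_curve_le J hP
  obtain ⟨Λ, hΛ0, hΛ⟩ := exists_abs_growth_le (g := g) J hP
  have hiter : ∀ k : ℕ, ∀ η : ℝ → Cotangent M, IsNormCurve g P η →
      Metric.infDist (J.emb (η 0)) (J.emb '' range γ) < δ →
      Metric.infDist (J.emb (η (-(k * τ)))) (J.emb '' range γ) ≤
        (1 / 2) ^ k * Metric.infDist (J.emb (η 0)) (J.emb '' range γ) ∧
      k ≤ logGrowth g P η (-(k * τ)) := by
    intro k η hη hηδ
    induction k with
    | zero => simp [logGrowth_zero]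
    | succ k ih =>
      obtain ⟨ih1, ih2⟩ := ih
      have h0 : Metric.infDist (J.emb (η (0 + -(k * τ)))) (J.emb '' range γ) < δ := by
        rw [zero_add]
        refine ih1.trans_lt (lt_of_le_of_lt ?_ hηδ)
        exact mul_le_of_le_one_left Metric.infDist_nonneg
          (pow_le_one₀ (by norm_num) (by norm_num))
      obtain ⟨h1, h2⟩ := hstep _ (hη.shift (-(k * τ))) h0
      have h3 : (-((k + 1 : ℕ) * τ) : ℝ) = -τ + -(k * τ) := by
        push_cast
        ring
      rw [zero_add] at h1
      rw [h3]
      refine ⟨h1.trans ?_, ?_⟩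
      · rw [pow_succ]
        linarith
      · rw [add_comm (-τ), logGrowth_add J hP hη]
        push_cast
        linarith
  have hdec : ∀ t ≤ (0 : ℝ), ∃ r ∈ Icc (-τ) 0, t = -(⌊-t / τ⌋₊ * τ) + r ∧
      -t / τ - 1 ≤ ⌊-t / τ⌋₊ := by
    intro t ht
    have h0 : 0 ≤ -t / τ := div_nonneg (by linarith) hτ.le
    have h1 := Nat.floor_le h0
    have h2 := Nat.lt_floor_add_one (-t / τ)
    refine ⟨t + ⌊-t / τ⌋₊ * τ, ⟨?_, ?_⟩, by ring, by linarith⟩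
    · rw [div_lt_iff₀ hτ] at h2
      linarith
    · rw [le_div_iff₀ hτ] at h1
      linarith
  have habs : ∀ r ∈ Icc (-τ) 0, |r| ≤ τ := fun r hr => abs_le.2 ⟨hr.1, hr.2.trans hτ.le⟩
  refine ⟨δ, hδ, ?_, 1 + Λ * τ, 1 / τ, by positivity, ?_⟩
  · intro ε hε
    have h1 : Tendsto (fun k : ℕ => Real.exp (L * τ) * ((1 / 2 : ℝ) ^ k * δ)) atTop (𝓝 0) := by
      have h2 := ((tendsto_pow_atTop_nhds_zero_of_lt_one (r := (1 / 2 : ℝ)) (by norm_num)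
        (by norm_num)).mul_const δ).const_mul (Real.exp (L * τ))
      simpa using h2
    obtain ⟨k₀, hk₀⟩ := eventually_atTop.1 (h1.eventually (gt_mem_nhds hε))
    refine ⟨-(k₀ * τ), fun η hη hηδ t ht => ?_⟩
    have hk₀τ : 0 ≤ k₀ * τ := by positivity
    obtain ⟨r, hr, htr, -⟩ := hdec t (by linarith)
    set k := ⌊-t / τ⌋₊ with hk
    have hkk : k₀ ≤ k := Nat.le_floor (by rw [le_div_iff₀ hτ]; linarith)
    have h2 := hL _ (hη.shift (-(k * τ))) r
    rw [zero_add, add_comm r, ← htr] at h2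
    refine h2.trans_lt (lt_of_le_of_lt ?_ (hk₀ k hkk))
    have h3 := (hiter k η hη hηδ).1
    have h4 := habs r hr
    exact mul_le_mul (Real.exp_le_exp.2 (by gcongr)) (h3.trans (by gcongr))
      Metric.infDist_nonneg (Real.exp_pos _).le
  · intro η hη hηδ t ht
    obtain ⟨r, hr, htr, hfl⟩ := hdec t ht
    set k := ⌊-t / τ⌋₊ with hk
    have h1 := (hiter k η hη hηδ).2
    have h2 := abs_logGrowth_le hΛ (hη.shift (-(k * τ))) r
    have h3 : logGrowth g P η t = logGrowth g P η (-(k * τ)) +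
        logGrowth g P (fun s => η (s + -(k * τ))) r := by
      conv_lhs => rw [htr]
      exact logGrowth_add J hP hη _ _
    have h4 : Λ * |r| ≤ Λ * τ := mul_le_mul_of_nonneg_left (habs r hr) hΛ0
    have h5 := (abs_le.1 h2).1
    rw [abs_of_nonpos ht, h3, one_div, inv_mul_eq_div]
    linarith

end IsCycle

/-- A compact subset `L` of the unit cosphere bundle attracts uniformly a neighbourhood of itself as
time tends to minus infinity, and `|ξ|` grows exponentially backwards in time over this
neighbourhood. -/
def IsBackwardAttracting (g : Metric M) (P : Cotangent M → ℝ) (L : Set (Cotangent M)) : Prop :=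
  ∃ O ∈ 𝓝ˢ L, (∀ V ∈ 𝓝ˢ L, ∃ T : ℝ, ∀ η : ℝ → Cotangent M, IsNormCurve g P η → η 0 ∈ O →
      ∀ t ≤ T, η t ∈ V) ∧
    ∃ K : ℝ, ∃ θ > 0, ∀ η : ℝ → Cotangent M, IsNormCurve g P η → η 0 ∈ O → ∀ t ≤ 0,
      θ * |t| - K ≤ logGrowth g P η t

theorem isBackwardAttracting_empty : IsBackwardAttracting g P ∅ :=
  ⟨∅, by simp, fun V _ => ⟨0, fun _ _ h => h.elim⟩, 0, 1, one_pos, fun _ _ h => h.elim⟩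

theorem IsBackwardAttracting.union {L L' : Set (Cotangent M)} (h : IsBackwardAttracting g P L)
    (h' : IsBackwardAttracting g P L') : IsBackwardAttracting g P (L ∪ L') := by
  obtain ⟨O, hO, hV, K, θ, hθ, hG⟩ := h
  obtain ⟨O', hO', hV', K', θ', hθ', hG'⟩ := h'
  refine ⟨O ∪ O', union_mem_nhdsSet hO hO', ?_, max K K', min θ θ', lt_min hθ hθ', ?_⟩
  · intro V hVL
    obtain ⟨T, hT⟩ := hV V (nhdsSet_mono subset_union_left hVL)
    obtain ⟨T', hT'⟩ := hV' V (nhdsSet_mono subset_union_right hVL)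
    refine ⟨min T T', ?_⟩
    rintro η hη (h0 | h0) t ht
    · exact hT η hη h0 t (ht.trans (min_le_left _ _))
    · exact hT' η hη h0 t (ht.trans (min_le_right _ _))
  · rintro η hη (h0 | h0) t ht
    · have h1 := mul_le_mul_of_nonneg_right (min_le_left θ θ') (abs_nonneg t)
      linarith [hG η hη h0 t ht, le_max_left K K']
    · have h1 := mul_le_mul_of_nonneg_right (min_le_right θ θ') (abs_nonneg t)
      linarith [hG' η hη h0 t ht, le_max_right K K']

theorem isBackwardAttracting_sUnion {S : Set (Set (Cotangent M))} (hS : S.Finite)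
    (h : ∀ L ∈ S, IsBackwardAttracting g P L) : IsBackwardAttracting g P (⋃₀ S) := by
  induction S, hS using Set.Finite.induction_on with
  | empty =>
    rw [sUnion_empty]
    exact isBackwardAttracting_empty
  | insert _ _ ih =>
    rw [sUnion_insert]
    exact (h _ (mem_insert _ _)).union (ih fun L hL => h L (mem_insert_of_mem _ hL))

section

variable [CompactSpace M] [FiniteDimensional ℝ W] (J : ExactEmbedding M W) (hP : IsSymbol P)
include J

omit [FiniteDimensional ℝ W] in
/-- The neighbourhoods of a compact set are given by the distance of the exact embedding. -/
theorem exists_infDist_lt_subset {C V : Set (Cotangent M)} (hC : IsCompact C) (hne : C.Nonempty)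
    (hV : V ∈ 𝓝ˢ C) :
    ∃ ε > 0, ∀ u ∈ cosphere g, Metric.infDist (J.emb u) (J.emb '' C) < ε → u ∈ V := by
  have hJc := J.contMDiff_emb.continuous
  have hD : Continuous fun u => Metric.infDist (J.emb u) (J.emb '' C) :=
    (Metric.continuous_infDist_pt _).comp hJc
  obtain ⟨ε, hε, h⟩ := ((isCompact_cosphere g).diff (isOpen_interior (s := V))).exists_forall_le'
    hD.continuousOn (a := 0) (by
      rintro u ⟨-, hu⟩
      have hcl := (hC.image hJc).isClosed
      refine (hcl.notMem_iff_infDist_pos (hne.image _)).1 ?_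
      rintro ⟨z, hz, hzu⟩
      rw [J.injective_emb hzu] at hz
      exact hu (subset_interior_iff_mem_nhdsSet.2 hV hz))
  refine ⟨ε, hε, fun u hu huε => ?_⟩
  by_contra huV
  exact (h u ⟨hu, fun hi => huV (interior_subset hi)⟩).not_gt huε

include hP

/-- A closed orbit along which `|ξ|` decreases is backward attracting. -/
theorem IsCycle.isBackwardAttracting {γ : ℝ → Cotangent M} {T : ℝ} (hγ : IsCycle g P γ T)
    (hX : ∀ t, normField g P (γ t) ≠ 0) (hneg : logGrowth g P γ T < 0) :
    IsBackwardAttracting g P (range γ) := by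
  obtain ⟨δ, hδ, hconv, K, θ, hθ, hgrow⟩ := hγ.exists_backward_attraction J hP hX hneg
  have hD : Continuous fun u => Metric.infDist (J.emb u) (J.emb '' range γ) :=
    (Metric.continuous_infDist_pt _).comp J.contMDiff_emb.continuous
  refine ⟨{u | Metric.infDist (J.emb u) (J.emb '' range γ) < δ}, ?_, ?_, K, θ, hθ, hgrow⟩
  · refine (isOpen_lt hD continuous_const).mem_nhdsSet.2 fun z hz => ?_
    change Metric.infDist _ _ < δ
    rwa [Metric.infDist_zero_of_mem (mem_image_of_mem _ hz)]
  · intro V hV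
    obtain ⟨ε, hε, hεV⟩ := exists_infDist_lt_subset (g := g) J hγ.isCompact_range
      (range_nonempty γ) hV
    obtain ⟨T₀, hT₀⟩ := hconv ε hε
    exact ⟨T₀, fun η hη h0 t ht => hεV _ (hη t).1 (hT₀ η hη h0 t ht)⟩

theorem normFlow_neg_apply {ψ : ℝ → Cotangent M → Cotangent M} (hψ : IsNormFlow g P ψ)
    {u : Cotangent M} (hu : u ∈ cosphere g) (t : ℝ) : ψ t (ψ (-t) u) = u := by
  have h1 := ((hψ u hu).2 (-t)).1
  have h2 : (fun s => ψ s (ψ (-t) u)) = fun s => ψ (s + -t) u :=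
    J.isNormCurve_eq hP (t₀ := 0) (hψ _ h1).2 ((hψ u hu).2.shift (-t))
      (by rw [(hψ _ h1).1, zero_add])
  have h3 := congrFun h2 t
  simp only [add_neg_cancel] at h3
  rw [h3, (hψ u hu).1]

/-- A backward attracting invariant compact subset of the zero set of `P` is a radial source for
`|ξ| P`. -/
theorem isRadialSource_of_isBackwardAttracting {L : Set (Cotangent M)} (hne : L.Nonempty)
    (hc : IsCompact L) (hL : ∀ v ∈ L, v ∈ cosphere g ∧ P v = 0)
    (hinv : ∀ η : ℝ → Cotangent M, IsNormCurve g P η → η 0 ∈ L → ∀ t, η t ∈ L)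
    (h : IsBackwardAttracting g P L) : IsRadialSource g (ham g P) L := by
  obtain ⟨ψ, hψ⟩ := J.exists_normCurves (g := g) hP
  have hψ : IsNormFlow g P ψ := hψ
  obtain ⟨O, hO, hconv, K, θ, hθ, hgrow⟩ := h
  have hψL : ∀ u ∈ L, ∀ t, ψ t u ∈ L := fun u hu =>
    hinv _ (hψ u (hL u hu).1).2 (by rwa [(hψ u (hL u hu).1).1])
  have hstart : ∀ v ∈ nonzero M, kappa g v ∈ O → ψ 0 (kappa g v) ∈ O := fun v hv hO => by
    rwa [(hψ _ (kappa_mem g hv)).1]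
  refine ⟨hne, hc, fun v hv => ⟨(hL v hv).1, by rw [ham, (hL v hv).2, mul_zero]⟩,
    hamFlow g P ψ, ballFlow g P hψ, isCompactifiedFlow J hP hψ, ?_,
    {z | z ∈ Compactified.nonzero g ∧ kappa g z.1 ∈ O}, ?_, fun z hz => hz.1, ?_,
    Real.exp K, Real.exp_pos K, θ, hθ, ?_⟩
  · intro t
    refine Subset.antisymm ?_ ?_
    · rintro _ ⟨z, hz, rfl⟩
      change (ballFlow g P hψ t z).1 ∈ L
      rw [ballFlow_of_mem_cosphere hψ (hL _ hz).1]
      exact hψL _ hz t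
    · intro z hz
      have h1 : (ballFlow g P hψ (-t) z).1 = ψ (-t) z.1 :=
        ballFlow_of_mem_cosphere hψ (hL _ hz).1 (-t)
      have h2 : (ballFlow g P hψ (-t) z).1 ∈ L := by
        rw [h1]
        exact hψL _ hz _
      refine ⟨ballFlow g P hψ (-t) z, h2, Subtype.ext ?_⟩
      rw [ballFlow_of_mem_cosphere hψ (hL _ h2).1, h1, normFlow_neg_apply J hP hψ (hL _ hz).1]
  · rw [mem_nhdsSet_iff_forall]
    intro z hz
    have hzS := (hL _ hz).1
    have hzn := cosphere_subset_nonzero g hzS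
    have hval : ContinuousAt (fun z : Compactified g => z.1) z :=
      continuous_subtype_val.continuousAt
    have h1 : ∀ᶠ y in 𝓝 z, y ∈ Compactified.nonzero g :=
      hval.eventually ((isOpen_nonzero g).mem_nhds hzn)
    have h2 : ContinuousAt (fun z : Compactified g => kappa g z.1) z :=
      (contMDiffAt_kappa g hzn).continuousAt.comp (f := fun z : Compactified g => z.1) hval
    have h3 : O ∈ 𝓝 (kappa g z.1) := by
      rw [kappa_eq_self g hzS]
      exact mem_nhdsSet_iff_forall.1 hO _ hz
    exact h1.and (h2.eventually h3)
  · intro V hV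
    obtain ⟨T, hT⟩ := hconv V hV
    refine ⟨T, fun t ht z hz => ?_⟩
    rw [kappa_ballFlow hψ hz.1]
    exact hT _ (hψ _ (kappa_mem g hz.1)).2 (hstart _ hz.1 hz.2) t ht
  · intro v hv hvU t ht
    have h1 : kappa g v ∈ O := by
      rw [← kappa_embed hv]
      exact hvU.2
    have h2 := hgrow _ (hψ _ (kappa_mem g hv)).2 (hstart v hv h1) t ht
    rw [conorm_hamFlow hψ hv, mul_comm (conorm g v), ← Real.exp_neg, ← Real.exp_add]
    refine mul_le_mul_of_nonneg_right (Real.exp_le_exp.2 ?_) (conorm_nonneg g v)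
    linarith

end

end

section

/-! ### Transversal curves and the multiplier of a closed orbit -/

theorem hasDerivAt_zero_of_abs_le_sq {k : ℝ → ℝ} {f : ℝ → V} {f' : V} (hf : HasDerivAt f f' 0)
    {K : ℝ} (h : ∀ᶠ s in 𝓝 0, |k s| ≤ K * ‖f s - f 0‖ ^ 2) : HasDerivAt k 0 0 := by
  have h0 : k 0 = 0 := by simpa using h.self_of_nhds
  have h1 : (fun s => f s - f 0) =O[𝓝 0] fun s : ℝ => s := by simpa using hf.isBigO_sub
  have h2 : k =O[𝓝 0] fun s => ‖f s - f 0‖ ^ 2 :=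
    Asymptotics.IsBigO.of_bound K (h.mono fun s hs => by simpa using hs)
  have h3 : k =o[𝓝 0] fun s : ℝ => s :=
    (h2.trans (h1.norm_left.pow 2)).trans_isLittleO (Asymptotics.isLittleO_pow_id one_lt_two)
  rw [hasDerivAt_iff_isLittleO]
  simpa [h0] using h3

variable {g : Metric M} {P : Cotangent M → ℝ}

section

variable [FiniteDimensional ℝ W] (J : ExactEmbedding M W) (hP : IsSymbol P)
include hP

/-- Through every point of the energy surface where the normalised field does not vanish, there is
a curve in the surface transversal to the field, parametrised by the canonical one-form. -/
theorem exists_transversal_curve {z₀ : Cotangent M} (hz : z₀ ∈ cosphere g) (hP0 : P z₀ = 0)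
    (hX : normField g P z₀ ≠ 0) :
    ∃ (η : ℝ → Cotangent M) (w : Phase), (∀ s, η s ∈ cosphere g ∧ P (η s) = 0) ∧ η 0 = z₀ ∧
      HasMFDerivAt 𝓘(ℝ, ℝ) cotModel η 0
        ((1 : ℝ →L[ℝ] ℝ).smulRight (show TangentSpace cotModel (η 0) from w)) ∧
      J.mom z₀ (der J.base z₀ w) = 1 := by
  classical
  obtain ⟨ℓ, hℓ⟩ := exists_transversal J hX
  have hn := cosphere_subset_nonzero g hz
  have hbij := bijective_der_transCoord J hP hz hP0 hX hℓ
  let L : Phase ≃L[ℝ] ℝ × ℝ × ℝ × ℝ :=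
    (LinearEquiv.ofBijective (der (transCoord J g P z₀ ℓ) z₀).toLinearMap
      hbij).toContinuousLinearEquiv
  have hL : der (transCoord J g P z₀ ℓ) z₀ = L := rfl
  obtain ⟨r, hr, hr0, hGr⟩ := exists_inverse (contMDiffAt_transCoord J hP hn ℓ) L hL
  set c : ℝ → ℝ × ℝ × ℝ × ℝ := fun s =>
    transCoord J g P z₀ ℓ z₀ + s • ((1, 0, 0, 0) : ℝ × ℝ × ℝ × ℝ)
    with hc
  have hc0 : c 0 = transCoord J g P z₀ ℓ z₀ := by simp [hc]
  have hcd : HasDerivAt c (1, 0, 0, 0) 0 := by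
    have h1 := ((hasDerivAt_id (0 : ℝ)).smul_const ((1, 0, 0, 0) : ℝ × ℝ × ℝ × ℝ)).const_add
      (transCoord J g P z₀ ℓ z₀)
    rwa [one_smul] at h1
  set w : Phase := L.symm (1, 0, 0, 0) with hw
  have hLw : der (transCoord J g P z₀ ℓ) z₀ w = (1, 0, 0, 0) := by
    rw [hL]
    exact L.apply_symm_apply _
  rw [← hc0] at hr hr0 hGr
  have hrc : HasDerivAt (r ∘ c) w 0 := hr.comp_hasDerivAt 0 hcd
  set ζ : ℝ → Cotangent M := fun s => (extChartAt cotModel z₀).symm (r (c s)) with hζ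
  have hζ0 : ζ 0 = z₀ := by
    rw [hζ]
    change (extChartAt cotModel z₀).symm (r (c 0)) = z₀
    rw [hr0, extChartAt_to_inv]
  have hζc : ContinuousAt ζ 0 := by
    refine ContinuousAt.comp (f := r ∘ c) ?_ hrc.continuousAt
    change ContinuousAt (extChartAt cotModel z₀).symm (r (c 0))
    rw [hr0]
    exact continuousAt_extChartAt_symm z₀
  have hζd : HasDerivAt (J.emb ∘ ζ) (der J.emb z₀ w) 0 := by
    have h1 := hasFDerivAt_loc z₀ ((J.contMDiff_emb z₀).of_le (m := 1) (by simp))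
    rw [← hr0] at h1
    exact h1.comp_hasDerivAt 0 hrc
  have hev : ∀ᶠ s in 𝓝 0, ζ s ∈ cosphere g ∧ P (ζ s) = 0 := by
    filter_upwards [hcd.continuousAt.eventually hGr] with s hs
    have h1 : transCoord J g P z₀ ℓ (ζ s) = c s := hs
    have h2 : P (ζ s) = (c s).2.1 := by rw [← h1]; rfl
    have h3 : conorm g (ζ s) = (c s).2.2.1 := by rw [← h1]; rfl
    refine ⟨?_, ?_⟩
    · change conorm g (ζ s) = 1
      rw [h3]
      simpa [hc, transCoord] using show conorm g z₀ = 1 from hz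
    · rw [h2]
      simpa [hc, transCoord] using hP0
  set η : ℝ → Cotangent M := fun s => if ζ s ∈ cosphere g ∧ P (ζ s) = 0 then ζ s else z₀ with hη
  have hηζ : η =ᶠ[𝓝 0] ζ := hev.mono fun s hs => if_pos hs
  have hη0 : η 0 = z₀ := by rw [hηζ.self_of_nhds, hζ0]
  refine ⟨η, w, fun s => ?_, hη0, ?_, ?_⟩
  · by_cases hs : ζ s ∈ cosphere g ∧ P (ζ s) = 0
    · rw [show η s = ζ s from if_pos hs]
      exact hs
    · rw [show η s = z₀ from if_neg hs]
      exact ⟨hz, hP0⟩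
  · refine J.hasMFDerivAt_curve (hζc.congr hηζ.symm) ?_
    rw [hη0]
    exact hζd.congr_of_eventuallyEq (hηζ.fun_comp J.emb)
  · rw [der_transCoord J hP hn] at hLw
    exact congrArg Prod.fst hLw

/-- The return map of a closed orbit multiplies the canonical one-form by `exp (-logGrowth)`, and
the one-form vanishes on the field. Hence a transversal vector `w`, which is mapped to `c w` modulo
the field, satisfies this relation. -/
theorem IsCycle.exp_logGrowth_mul [CompactSpace M] {γ : ℝ → Cotangent M} {T : ℝ}
    (hγ : IsCycle g P γ T) {η : ℝ → Cotangent M} {w : Phase}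
    (hη0 : η 0 = γ 0)
    (hw : HasMFDerivAt 𝓘(ℝ, ℝ) cotModel η 0
        ((1 : ℝ →L[ℝ] ℝ).smulRight (show TangentSpace cotModel (η 0) from w)))
    {ψ : ℝ → Cotangent M → Cotangent M}
    (hψ : ∀ s, ψ 0 (η s) = η s ∧ IsNormCurve g P (fun t => ψ t (η s))) {c a : ℝ}
    (hd : HasMFDerivAt 𝓘(ℝ, ℝ) cotModel (fun s => ψ T (η s)) 0
        ((1 : ℝ →L[ℝ] ℝ).smulRight (show TangentSpace cotModel (ψ T (η 0)) from
          (c • w + a • normField g P (γ 0) : Phase)))) :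
    Real.exp (logGrowth g P γ T) * c * J.mom (γ 0) (der J.base (γ 0) w) =
      J.mom (γ 0) (der J.base (γ 0) w) := by
  have hψγ : (fun t => ψ t (η 0)) = γ :=
    J.isNormCurve_eq hP (t₀ := 0) (hψ 0).2 hγ.curve (by rw [(hψ 0).1, hη0])
  have hψT : ψ T (η 0) = γ 0 := by
    rw [congrFun hψγ T, ← zero_add T, hγ.periodic]
  obtain ⟨K, hK, hest⟩ := exists_action_estimate (g := g) J hP T
  set E := Real.exp (logGrowth g P γ T) with hE
  have h1 : HasDerivAt (J.base ∘ η) (der J.base (γ 0) w) 0 := by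
    rw [← hη0]
    exact hasDerivAt_comp_curve ((J.contMDiff_base _).of_le (by simp)) hw
  have h1' : HasDerivAt (J.emb ∘ η) (der J.emb (η 0) w) 0 :=
    hasDerivAt_comp_curve ((J.contMDiff_emb _).of_le (by simp)) hw
  have h2 : HasDerivAt (J.base ∘ fun s => ψ T (η s))
      (der J.base (γ 0) (c • w + a • normField g P (γ 0))) 0 := by
    rw [← hψT]
    rw [← hψT] at hd
    exact hasDerivAt_comp_curve (γ := fun s => ψ T (η s)) ((J.contMDiff_base _).of_le (by simp)) hd
  have h3 : HasDerivAt (fun s => J.action (γ 0) (ψ T (η s)) * E - J.action (γ 0) (η s))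
      (J.mom (γ 0) (der J.base (γ 0) (c • w + a • normField g P (γ 0))) * E -
        J.mom (γ 0) (der J.base (γ 0) w)) 0 :=
    (((J.mom (γ 0)).hasFDerivAt.comp_hasDerivAt 0 (h2.sub_const _)).mul_const E).sub
      ((J.mom (γ 0)).hasFDerivAt.comp_hasDerivAt 0 (h1.sub_const _))
  have h4 := hasDerivAt_zero_of_abs_le_sq h1' (K := K)
    (k := fun s => J.action (γ 0) (ψ T (η s)) * E - J.action (γ 0) (η s))
    (Eventually.of_forall fun s => by
      have h5 := hest γ _ hγ.curve (hψ s).2 T (abs_of_pos hγ.pos).le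
      rw [(hψ s).1, ← zero_add T, hγ.periodic, zero_add] at h5
      rw [Function.comp_apply, Function.comp_apply, hη0, norm_sub_rev]
      exact h5)
  have h6 := h3.unique h4
  have h7 : J.mom (γ 0) (der J.base (γ 0) (normField g P (γ 0))) = 0 := by
    rw [J.der_base_normField, J.mom_bracket_base g hP (cosphere_subset_nonzero g (hγ.curve 0).1),
      ham, hγ.symbol, mul_zero]
  rw [map_add, map_add, map_smul, map_smul, map_smul, map_smul, h7] at h6
  simp only [smul_eq_mul] at h6
  linarith

end

end

section

/-! ### The flow on the energy surface -/

variable {g : Metric M} {p : Cotangent M → ℝ} {ν : ℝ}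

/-- The symbol `p - ν`, whose zero set is the energy surface. -/
def levelFunction (p : Cotangent M → ℝ) (ν : ℝ) (v : Cotangent M) : ℝ := p v - ν

theorem isSymbol_levelFunction (g : Metric M)
    (hs : ContMDiffOn cotModel 𝓘(ℝ, ℝ) ∞ p (nonzero M))
    (hh : ∀ v ∈ nonzero M, ∀ t : ℝ, 0 < t → p (scale t v) = p v) (ν : ℝ) :
    IsSymbol (levelFunction p ν) where
  smooth v hv := (hs.contMDiffAt ((isOpen_nonzero g).mem_nhds hv)).sub contMDiffAt_const
  homog v hv t ht := by rw [levelFunction, hh v hv t ht, levelFunction]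

section

variable (hP : IsSymbol (levelFunction p ν))
include hP

theorem mem_energySurface_iff {v : Cotangent M} :
    v ∈ energySurface g p ν ↔ v ∈ cosphere g ∧ levelFunction p ν v = 0 := by
  constructor
  · rintro ⟨u, ⟨hu, hup⟩, rfl⟩
    refine ⟨kappa_mem g hu, ?_⟩
    rw [hP.kappa g hu, levelFunction, hup, sub_self]
  · rintro ⟨hv, hvp⟩
    exact ⟨v, ⟨cosphere_subset_nonzero g hv, sub_eq_zero.1 hvp⟩, kappa_eq_self g hv⟩

theorem der_levelFunction {v : Cotangent M} (hv : v ∈ nonzero M) :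
    der (levelFunction p ν) v = der p v := by
  have h1 : ContMDiffAt cotModel 𝓘(ℝ, ℝ) 1 (levelFunction p ν) v := (hP.smooth v hv).of_le (by simp)
  have h2 : ContMDiffAt cotModel 𝓘(ℝ, ℝ) 1 p v := by
    have h3 : p = fun v => levelFunction p ν v + ν := funext fun v => (sub_add_cancel _ _).symm
    rw [h3]
    exact h1.add contMDiffAt_const
  exact der_eq_of_hasFDerivAt_loc h1 ((hasFDerivAt_loc v h2).sub_const ν)

end

section

variable [FiniteDimensional ℝ W] (J : ExactEmbedding M W) {P : Cotangent M → ℝ}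
include J

/-- The quotient map `κ` maps the Hamiltonian field of `|ξ| P` to the normalised field. -/
theorem mfderiv_kappa_hamiltonianField (hP : IsSymbol P) {v : Cotangent M} (hv : v ∈ nonzero M) :
    (mfderiv cotModel cotModel (kappa g) v (hamiltonianField (ham g P) v) : Phase) =
      normField g P (kappa g v) := by
  obtain ⟨ε, hε, h⟩ := J.exists_local_integralCurves (contMDiffAt_ham g hP hv) univ_mem
  obtain ⟨γ, hγ0, hγ⟩ := h.self_of_nhds
  have h0 := (hγ 0 ⟨by linarith, hε⟩).2
  have hv' : γ 0 ∈ nonzero M := by rwa [hγ0]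
  have h1 := J.hasDerivAt_emb_kappa hP hv' h0
  have h2 : HasMFDerivAt 𝓘(ℝ, ℝ) cotModel (fun s => kappa g (γ s)) 0
      ((1 : ℝ →L[ℝ] ℝ).smulRight (show TangentSpace cotModel (kappa g (γ 0)) from
        mfderiv cotModel cotModel (kappa g) (γ 0) (hamiltonianField (ham g P) (γ 0)))) := by
    have h3 := ((contMDiffAt_kappa g hv').mdifferentiableAt (by simp)).hasMFDerivAt.comp 0 h0
    have h4 : ∀ (A : Phase →L[ℝ] Phase) (z : Phase),
        A.comp ((1 : ℝ →L[ℝ] ℝ).smulRight z) = (1 : ℝ →L[ℝ] ℝ).smulRight (A z) := fun A z => by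
      ext <;> simp
    exact (h4 _ _) ▸ h3
  have h4 := hasDerivAt_comp_curve (h := J.emb) ((J.contMDiff_emb _).of_le (by simp)) h2
  have h5 := J.injective_der_emb _ (h4.unique h1)
  rw [hγ0] at h5
  exact h5

theorem projectedField_eq (hP : IsSymbol (levelFunction p ν)) {v : Cotangent M}
    (hv : v ∈ energySurface g p ν) :
    projectedField g p v = normField g (levelFunction p ν) v := by
  obtain ⟨hv1, hv0⟩ := (mem_energySurface_iff hP).1 hv
  have hn := cosphere_subset_nonzero g hv1
  have h1 := mfderiv_kappa_hamiltonianField (g := g) J hP hn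
  rw [kappa_eq_self g hv1] at h1
  rw [← h1]
  have h2 : (conorm g v • hamiltonianField p v : Phase) =
      hamiltonianField (ham g (levelFunction p ν)) v := by
    rw [hamiltonianField_eq, hamiltonianField_eq, der_ham g hP hn, hv0, zero_smul, add_zero,
      map_smul, der_levelFunction hP hn]
    rfl
  exact congrArg (mfderiv cotModel cotModel (kappa g) v) h2

theorem isTrajectory_iff (hP : IsSymbol (levelFunction p ν)) {γ : ℝ → Cotangent M} :
    IsTrajectory g p ν γ ↔
      IsNormCurve g (levelFunction p ν) γ ∧ ∀ t, levelFunction p ν (γ t) = 0 := by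
  constructor
  · rintro ⟨h1, h2⟩
    refine ⟨fun t => ⟨((mem_energySurface_iff hP).1 (h2 t)).1, ?_⟩,
      fun t => ((mem_energySurface_iff hP).1 (h2 t)).2⟩
    rw [← projectedField_eq J hP (h2 t)]
    exact h1 t
  · rintro ⟨h1, h2⟩
    have h3 := fun t => (mem_energySurface_iff (g := g) hP).2 ⟨(h1 t).1, h2 t⟩
    refine ⟨fun t => ?_, h3⟩
    rw [projectedField_eq J hP (h3 t)]
    exact (h1 t).2

theorem isClosedOrbitOf_iff (hP : IsSymbol (levelFunction p ν)) {C : Set (Cotangent M)}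
    {γ : ℝ → Cotangent M} {T : ℝ} :
    IsClosedOrbitOf g p ν C γ T ↔ IsCycle g (levelFunction p ν) γ T ∧ range γ = C :=
  ⟨fun h => ⟨⟨((isTrajectory_iff J hP).1 h.trajectory).1,
    ((isTrajectory_iff J hP).1 h.trajectory).2,
    h.pos, h.periodic, h.prime⟩, h.range_eq⟩,
  fun h => ⟨(isTrajectory_iff J hP).2 ⟨h.1.curve, h.1.symbol⟩, h.1.pos, h.1.periodic, h.1.prime,
    h.2⟩⟩

variable [CompactSpace M]

/-- The multiplier of a closed orbit is the inverse of the factor by which `|ξ|` grows over one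
period. -/
theorem HasMultiplier.exists_cycle (hP : IsSymbol (levelFunction p ν)) {C : Set (Cotangent M)}
    {c : ℝ} (h : HasMultiplier g p ν C c)
    (hX : ∀ z ∈ energySurface g p ν, projectedField g p z ≠ 0) :
    ∃ γ T, IsCycle g (levelFunction p ν) γ T ∧ range γ = C ∧
      (∀ t, normField g (levelFunction p ν) (γ t) ≠ 0) ∧
      Real.exp (logGrowth g (levelFunction p ν) γ T) * c = 1 := by
  obtain ⟨γ, T, ψ, hC, hψ, hmul⟩ := h
  obtain ⟨hγ, hr⟩ := (isClosedOrbitOf_iff J hP).1 hC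
  have hXγ : ∀ t, normField g (levelFunction p ν) (γ t) ≠ 0 := fun t => by
    rw [← projectedField_eq J hP (hC.trajectory.2 t)]
    exact hX _ (hC.trajectory.2 t)
  refine ⟨γ, T, hγ, hr, hXγ, ?_⟩
  obtain ⟨η, w, hη, hη0, hw, hw1⟩ :=
    exists_transversal_curve J hP (hγ.curve 0).1 (hγ.symbol 0) (hXγ 0)
  have hηs := fun s => (mem_energySurface_iff (g := g) hP).2 (hη s)
  obtain ⟨a, ha⟩ := hmul η hηs hη0 w hw
  have hψη : ∀ s, ψ 0 (η s) = η s ∧ IsNormCurve g (levelFunction p ν) (fun t => ψ t (η s)) :=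
    fun s => ⟨(hψ _ (hηs s)).1, ((isTrajectory_iff J hP).1 (hψ _ (hηs s)).2).1⟩
  rw [projectedField_eq J hP (hC.trajectory.2 0)] at ha
  have h1 := hγ.exp_logGrowth_mul J hP hη0 hw hψη ha
  rwa [hw1, mul_one] at h1

theorem IsAttractingCycle.exists_cycle (hP : IsSymbol (levelFunction p ν)) {C : Set (Cotangent M)}
    (h : IsAttractingCycle g p ν C)
    (hX : ∀ z ∈ energySurface g p ν, projectedField g p z ≠ 0) :
    ∃ γ T, IsCycle g (levelFunction p ν) γ T ∧ range γ = C ∧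
      (∀ t, normField g (levelFunction p ν) (γ t) ≠ 0) ∧
      0 < logGrowth g (levelFunction p ν) γ T := by
  obtain ⟨-, c, hc, hm⟩ := h
  obtain ⟨γ, T, hγ, hr, hXγ, hE⟩ := hm.exists_cycle J hP hX
  refine ⟨γ, T, hγ, hr, hXγ, ?_⟩
  by_contra! hneg
  have h1 := Real.exp_le_one_iff.2 hneg
  have h2 := congrArg abs hE
  rw [abs_mul, abs_of_pos (Real.exp_pos _), abs_one] at h2
  nlinarith [abs_nonneg c]

theorem IsRepellingCycle.exists_cycle (hP : IsSymbol (levelFunction p ν)) {C : Set (Cotangent M)}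
    (h : IsRepellingCycle g p ν C)
    (hX : ∀ z ∈ energySurface g p ν, projectedField g p z ≠ 0) :
    ∃ γ T, IsCycle g (levelFunction p ν) γ T ∧ range γ = C ∧
      (∀ t, normField g (levelFunction p ν) (γ t) ≠ 0) ∧
      logGrowth g (levelFunction p ν) γ T < 0 := by
  obtain ⟨-, c, hc, hm⟩ := h
  obtain ⟨γ, T, hγ, hr, hXγ, hE⟩ := hm.exists_cycle J hP hX
  refine ⟨γ, T, hγ, hr, hXγ, ?_⟩
  by_contra! hpos
  have h1 := Real.one_le_exp_iff.2 hpos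
  have h2 := congrArg abs hE
  rw [abs_mul, abs_of_pos (Real.exp_pos _), abs_one] at h2
  nlinarith [abs_nonneg c]

/-! ### Unions of closed orbits -/

theorem IsCycle.exists_eq_shift (hP : IsSymbol P) {γ : ℝ → Cotangent M} {T : ℝ}
    (hγ : IsCycle g P γ T)
    {η : ℝ → Cotangent M} (hη : IsNormCurve g P η) (h0 : η 0 ∈ range γ) :
    ∃ s, η = fun t => γ (t + s) := by
  obtain ⟨s, hs⟩ := h0
  exact ⟨s, J.isNormCurve_eq hP (t₀ := 0) hη (hγ.curve.shift s) (by rw [zero_add, hs])⟩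

theorem IsCycle.range_eq_of_mem (hP : IsSymbol P) {γ : ℝ → Cotangent M} {T : ℝ}
    (hγ : IsCycle g P γ T) {η : ℝ → Cotangent M} (hη : IsNormCurve g P η) (h0 : η 0 ∈ range γ) :
    range η = range γ := by
  obtain ⟨s, rfl⟩ := hγ.exists_eq_shift J hP hη h0
  exact (Equiv.addRight s).surjective.range_comp γ

omit [FiniteDimensional ℝ W] [CompactSpace M] in
theorem IsCycle.logGrowth_reverse (hP : IsSymbol P) {γ : ℝ → Cotangent M} {T : ℝ}
    (hγ : IsCycle g P γ T) :
    logGrowth g (fun v => -P v) (fun t => γ (-t)) T = -logGrowth g P γ T := by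
  have h1 : ∀ s, growth g (fun v => -P v) (γ (-s)) = -growth g P (γ (-s)) := fun s =>
    (normField_neg g hP (cosphere_subset_nonzero g (hγ.curve _).1)).2
  have h2 := hγ.logGrowth_int_mul J hP (-1)
  rw [logGrowth] at h2
  simp only [Int.cast_neg, Int.cast_one, neg_mul, one_mul] at h2
  rw [logGrowth]
  simp only [h1]
  rw [intervalIntegral.integral_neg, intervalIntegral.integral_comp_neg (fun s => growth g P (γ s)),
    neg_zero, intervalIntegral.integral_symm, h2, neg_neg]

/-- A finite union of closed orbits along which `|ξ|` decreases is a radial source. -/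
theorem isRadialSource_sUnion (hP : IsSymbol P) {S : Set (Set (Cotangent M))} (hS : S.Finite)
    (hne : S.Nonempty)
    (h : ∀ C ∈ S, ∃ γ T, IsCycle g P γ T ∧ range γ = C ∧ (∀ t, normField g P (γ t) ≠ 0) ∧
      logGrowth g P γ T < 0) : IsRadialSource g (ham g P) (⋃₀ S) := by
  refine isRadialSource_of_isBackwardAttracting J hP ?_ (hS.isCompact_sUnion ?_) ?_ ?_
    (isBackwardAttracting_sUnion hS ?_)
  · obtain ⟨C, hC⟩ := hne
    obtain ⟨γ, T, hγ, hr, -⟩ := h C hC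
    exact ⟨γ 0, C, hC, hr ▸ mem_range_self 0⟩
  · intro C hC
    obtain ⟨γ, T, hγ, rfl, -⟩ := h C hC
    exact hγ.isCompact_range
  · rintro v ⟨C, hC, hv⟩
    obtain ⟨γ, T, hγ, rfl, -⟩ := h C hC
    obtain ⟨t, rfl⟩ := hv
    exact ⟨(hγ.curve t).1, hγ.symbol t⟩
  · rintro η hη ⟨C, hC, hv⟩ t
    obtain ⟨γ, T, hγ, rfl, -⟩ := h C hC
    obtain ⟨s, rfl⟩ := hγ.exists_eq_shift J hP hη hv
    exact ⟨_, hC, mem_range_self _⟩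
  · intro C hC
    obtain ⟨γ, T, hγ, rfl, hX, hneg⟩ := h C hC
    exact hγ.isBackwardAttracting J hP hX hneg

/-! ### Existence of attracting and repelling cycles -/

omit [FiniteDimensional ℝ W] [CompactSpace M] in
/-- A trajectory with an ω-limit point in a backward attracting set lies in this set. -/
theorem IsBackwardAttracting.mem_of_mapClusterPt {L : Set (Cotangent M)}
    (hL : IsBackwardAttracting g P L) {γ : ℝ → Cotangent M}
    (hγ : IsNormCurve g P γ) {z : Cotangent M} (hz : z ∈ L) (h : MapClusterPt z atTop γ) :
    γ 0 ∈ L := by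
  have := J.t2Space
  obtain ⟨O, hO, hconv, -⟩ := hL
  by_contra h0
  obtain ⟨T, hT⟩ := hconv {γ 0}ᶜ
    (isOpen_compl_singleton.mem_nhdsSet.2 fun u hu hu0 => h0 (hu0 ▸ hu))
  have h1 := mapClusterPt_iff_frequently.1 h O (mem_nhdsSet_iff_forall.1 hO z hz)
  obtain ⟨t, ht, htO⟩ := frequently_atTop.1 h1 (-T)
  refine hT _ (hγ.shift t) (by rwa [zero_add]) (-t) (by linarith) ?_
  rw [neg_add_cancel]
  exact mem_singleton _

/-- Not all trajectories are closed: otherwise the points of a transversal curve near a closed orbit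
would belong to this orbit, because the other closed orbits are finitely many compact sets. But the
canonical one-form vanishes along the orbit and not along the transversal curve. -/
theorem exists_not_isClosedOrbit (hP : IsSymbol (levelFunction p ν))
    (hne : (energySurface g p ν).Nonempty)
    (hX : ∀ z ∈ energySurface g p ν, projectedField g p z ≠ 0)
    (hfin : {C | IsClosedOrbit g p ν C}.Finite) :
    ∃ γ, IsTrajectory g p ν γ ∧ ¬ IsClosedOrbit g p ν (range γ) := by
  by_contra! hall
  have := J.t2Space
  obtain ⟨ψ, hψ⟩ := J.exists_normCurves (g := g) hP
  have htraj : ∀ z ∈ energySurface g p ν, IsTrajectory g p ν (fun t => ψ t z) := by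
    intro z hz
    obtain ⟨hzS, hz0⟩ := (mem_energySurface_iff hP).1 hz
    obtain ⟨h0, hc⟩ := hψ z hzS
    refine (isTrajectory_iff J hP).2 ⟨hc, fun t => ?_⟩
    have h1 := hc.symbol_mul_exp J hP t
    rw [h0, hz0] at h1
    exact (mul_eq_zero.1 h1).resolve_right (Real.exp_pos _).ne'
  obtain ⟨z, hz⟩ := hne
  obtain ⟨γ, T, hC⟩ := hall _ (htraj z hz)
  obtain ⟨hγ, hr⟩ := (isClosedOrbitOf_iff J hP).1 hC
  have hXγ : ∀ t, normField g (levelFunction p ν) (γ t) ≠ 0 := fun t => by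
    rw [← projectedField_eq J hP (hC.trajectory.2 t)]
    exact hX _ (hC.trajectory.2 t)
  obtain ⟨η, w, hη, hη0, hw, hw1⟩ :=
    exists_transversal_curve J hP (hγ.curve 0).1 (hγ.symbol 0) (hXγ 0)
  -- the other closed orbits form a closed set, which does not contain the given point
  set S : Set (Set (Cotangent M)) := {C | IsClosedOrbit g p ν C} \ {range γ} with hS
  have hScl : IsClosed (⋃₀ S) := by
    refine ((hfin.subset sdiff_subset).isCompact_sUnion ?_).isClosed
    rintro C ⟨⟨γ', T', hC'⟩, -⟩
    obtain ⟨hγ', rfl⟩ := (isClosedOrbitOf_iff J hP).1 hC'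
    exact hγ'.isCompact_range
  have hz₀ : η 0 ∉ ⋃₀ S := by
    rintro ⟨C, ⟨⟨γ', T', hC'⟩, hne⟩, hzC⟩
    obtain ⟨hγ', rfl⟩ := (isClosedOrbitOf_iff J hP).1 hC'
    rw [hη0] at hzC
    exact hne (hγ'.range_eq_of_mem J hP hγ.curve hzC).symm
  have hev : ∀ᶠ s in 𝓝 0, η s ∈ range γ := by
    filter_upwards [hw.continuousAt.eventually (hScl.isOpen_compl.mem_nhds hz₀)] with s hs
    have hss := (mem_energySurface_iff (g := g) hP).2 (hη s)
    have hmem : η s ∈ range fun t => ψ t (η s) := ⟨0, (hψ _ (hη s).1).1⟩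
    by_contra hsγ
    exact hs ⟨_, ⟨hall _ (htraj _ hss), fun he => hsγ (he ▸ hmem)⟩, hmem⟩
  obtain ⟨K, hK, hact⟩ := hγ.exists_action_le J hP hXγ
  have h1' : HasDerivAt (J.emb ∘ η) (der J.emb (η 0) w) 0 :=
    hasDerivAt_comp_curve ((J.contMDiff_emb _).of_le (by simp)) hw
  have h1 : HasDerivAt (J.base ∘ η) (der J.base (γ 0) w) 0 := by
    rw [← hη0]
    exact hasDerivAt_comp_curve ((J.contMDiff_base _).of_le (by simp)) hw
  have h2 := (J.mom (γ 0)).hasFDerivAt.comp_hasDerivAt 0 (h1.sub_const (J.base (γ 0)))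
  have h3 := hasDerivAt_zero_of_abs_le_sq h1' (K := K) (k := fun s => J.action (γ 0) (η s))
    (hev.mono fun s hs => by
      have h4 := hact _ (mem_range_self 0) _ hs
      rw [Function.comp_apply, Function.comp_apply, hη0, norm_sub_rev]
      exact h4)
  have h5 := h2.unique h3
  rw [hw1] at h5
  exact one_ne_zero h5

/-- The ω-limit set of a trajectory which is not closed cannot be repelling, and its α-limit set
cannot be attracting. -/
theorem exists_limit_cycles (hP : IsSymbol (levelFunction p ν))
    (hne : (energySurface g p ν).Nonempty) (hMS : IsMorseSmale g p ν) :
    (∃ C, IsAttractingCycle g p ν C) ∧ ∃ C, IsRepellingCycle g p ν C := by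
  have := J.t2Space
  obtain ⟨γ, hγ, hnot⟩ := exists_not_isClosedOrbit J hP hne hMS.no_fixed_point hMS.finite
  obtain ⟨hα, hω⟩ := hMS.limit γ hγ hnot
  have hc := ((isTrajectory_iff J hP).1 hγ).1
  have hclosed : ∀ C, IsClosedOrbit g p ν C → γ 0 ∉ C := by
    rintro C ⟨γ', T', hC⟩ h0
    obtain ⟨hγ', rfl⟩ := (isClosedOrbitOf_iff J hP).1 hC
    refine hnot ?_
    rw [hγ'.range_eq_of_mem J hP hc h0]
    exact ⟨γ', T', hC⟩
  constructor
  · refine ⟨_, (hMS.hyperbolic _ hω).resolve_right fun h => ?_⟩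
    obtain ⟨γ', T', hγ', hr, hX', hneg⟩ := h.exists_cycle J hP hMS.no_fixed_point
    have h1 := hγ'.isBackwardAttracting J hP hX' hneg
    refine hclosed _ hω ?_
    have h2 : γ' 0 ∈ limitSet atTop γ := hr ▸ mem_range_self 0
    rw [← hr]
    exact h1.mem_of_mapClusterPt J hc (mem_range_self 0) h2
  · refine ⟨_, (hMS.hyperbolic _ hα).resolve_left fun h => ?_⟩
    obtain ⟨γ', T', hγ', hr, hX', hpos⟩ := h.exists_cycle J hP hMS.no_fixed_point
    have h0 := hγ'.reverse hP
    have hr' : range (fun t => γ' (-t)) = range γ' := neg_surjective.range_comp γ'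
    have h1 := h0.isBackwardAttracting J hP.neg (fun t => by
        rw [(normField_neg g hP (cosphere_subset_nonzero g (hγ'.curve _).1)).1]
        exact neg_ne_zero.2 (hX' _))
      (by rw [hγ'.logGrowth_reverse J hP]; linarith)
    refine hclosed _ hα ?_
    have h2 : MapClusterPt (γ' 0) atTop (fun t => γ (-t)) := by
      have h3 : γ' 0 ∈ limitSet atBot γ := hr ▸ mem_range_self 0
      have h4 : MapClusterPt (γ' 0) atBot γ := h3
      rw [MapClusterPt, ← map_neg_atTop, map_map] at h4
      exact h4
    have h5 := h1.mem_of_mapClusterPt J (hc.reverse hP)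
      (by rw [hr']; exact mem_range_self 0) h2
    rw [hr', hr, neg_zero] at h5
    exact h5

theorem isRadialSource_repeller (hP : IsSymbol (levelFunction p ν))
    (hne : (energySurface g p ν).Nonempty) (hMS : IsMorseSmale g p ν) :
    IsRadialSource g (fun v => conorm g v * (p v - ν)) (repeller g p ν) :=
  isRadialSource_sUnion J hP (hMS.finite.subset fun _ hC => hC.1)
    (exists_limit_cycles J hP hne hMS).2 fun _ hC =>
      IsRepellingCycle.exists_cycle J hP hC hMS.no_fixed_point

/-- The attracting cycles are the repelling ones of the reversed flow, that is of `-p`. -/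
theorem isRadialSink_attractor (hP : IsSymbol (levelFunction p ν))
    (hne : (energySurface g p ν).Nonempty) (hMS : IsMorseSmale g p ν) :
    IsRadialSink g (fun v => conorm g v * (p v - ν)) (attractor g p ν) := by
  have h1 : (fun v => -(conorm g v * (p v - ν))) = ham g fun v => -levelFunction p ν v :=
    funext fun v => (mul_neg _ _).symm
  rw [IsRadialSink, h1]
  refine isRadialSource_sUnion J hP.neg (hMS.finite.subset fun _ hC => hC.1)
    (exists_limit_cycles J hP hne hMS).1 fun C hC => ?_
  obtain ⟨γ, T, hγ, hr, hX, hpos⟩ := IsAttractingCycle.exists_cycle J hP hC hMS.no_fixed_point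
  refine ⟨_, T, hγ.reverse hP, (neg_surjective.range_comp γ).trans hr, fun t => ?_, ?_⟩
  · rw [(normField_neg g hP (cosphere_subset_nonzero g (hγ.curve _).1)).1]
    exact neg_ne_zero.2 (hX _)
  · rw [hγ.logGrowth_reverse J hP]
    linarith

end

end

section

/-! ### The cones over closed orbits -/

variable {g : Metric M} {P : Cotangent M → ℝ}

/-- Solutions of smooth differential equations are smooth: the velocity of the curve, in the exact
embedding, is a smooth function of its position. -/
theorem IsNormCurve.contMDiff [CompactSpace M] [FiniteDimensional ℝ W] (J : ExactEmbedding M W)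
    (hP : IsSymbol P) {γ : ℝ → Cotangent M} (h : IsNormCurve g P γ) :
    ContMDiff 𝓘(ℝ, ℝ) cotModel ∞ γ := by
  have hd : ∀ t, HasDerivAt (J.emb ∘ γ) (der J.emb (γ t) (normField g P (γ t))) t := fun t =>
    h.hasDerivAt (J.contMDiff_emb _)
  have hderiv : deriv (J.emb ∘ γ) = fun t => der J.emb (γ t) (normField g P (γ t)) :=
    funext fun t => (hd t).deriv
  have hn : ∀ n : ℕ, ContDiff ℝ n (J.emb ∘ γ) := by
    intro n
    induction n with
    | zero => exact contDiff_zero.2 (J.contMDiff_emb.continuous.comp h.continuous)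
    | succ n ih =>
      refine (contDiff_succ_iff_deriv (n := (n : WithTop ℕ∞))).2
        ⟨fun t => (hd t).differentiableAt, fun hω => absurd hω (by simp), ?_⟩
      rw [hderiv, contDiff_iff_contDiffAt]
      intro t
      have h1 : ContMDiffAt 𝓘(ℝ, ℝ) cotModel (n : ℕ∞) γ t :=
        J.contMDiffAt_of_emb h.continuous.continuousAt ih.contDiffAt
      have h2 := (J.contMDiffAt_der_emb_normField g hP
        (cosphere_subset_nonzero g (h t).1)).of_le (m := (n : ℕ∞)) (by exact_mod_cast le_top)
      exact (h2.comp t h1).contDiffAt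
  exact fun t => J.contMDiffAt_of_emb (n := ⊤) h.continuous.continuousAt
    (contDiff_infty.2 hn).contDiffAt

theorem hasFDerivAt_comp_proj {q : ℝ → V} {q' : V} {y : Plane} {i : Fin 2}
    (hq : HasDerivAt q q' (y i)) :
    HasFDerivAt (fun y : Plane => q (y i)) ((EuclideanSpace.proj i : CoPlane).smulRight q') y := by
  have h := hq.hasFDerivAt.comp (f := fun y : Plane => y i) y
    (EuclideanSpace.proj (𝕜 := ℝ) i : CoPlane).hasFDerivAt
  refine h.congr_fderiv ?_
  ext a
  simp

theorem hasFDerivAt_comp_map {E : Type*} [NormedAddCommGroup E] [NormedSpace ℝ E]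
    {k : Cotangent M → V} {f : E → Cotangent M} {y : E}
    (hk : ContMDiffAt cotModel 𝓘(ℝ, V) 1 k (f y)) (hf : MDifferentiableAt 𝓘(ℝ, E) cotModel f y) :
    HasFDerivAt (k ∘ f)
      ((der k (f y)).comp (show E →L[ℝ] Phase from mfderiv 𝓘(ℝ, E) cotModel f y)) y :=
  ((hk.mdifferentiableAt (by simp)).hasMFDerivAt.comp y hf.hasMFDerivAt).hasFDerivAt

/-- The parametrisation of the cone over the arc of `γ` between the times `-c π / 2` and
`c π / 2`: the first variable runs along the arc and the second one is a logarithm of `|ξ|`. -/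
def conePatch (γ : ℝ → Cotangent M) (ρ c : ℝ) (y : Plane) : Cotangent M :=
  scale (ρ * Real.exp (y 1)) (γ (c * Real.arctan (y 0)))

section

variable {γ : ℝ → Cotangent M} {ρ c : ℝ} (hρ : 0 < ρ) (hγ : IsNormCurve g P γ)

theorem contDiff_mul_exp : ContDiff ℝ ∞ fun y : Plane => ρ * Real.exp (y 1) := by
  fun_prop

theorem strictMono_mul_arctan (hc : 0 < c) : StrictMono fun x => c * Real.arctan x :=
  Real.arctan_strictMono.const_mul hc

theorem isEmbedding_of_strictMono {h : ℝ → ℝ} (h1 : StrictMono h) (h2 : Continuous h) :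
    IsEmbedding h :=
  h1.isEmbedding_of_ordConnected (isPreconnected_range h2).ordConnected

theorem abs_mul_arctan_lt (hc : 0 < c) (x : ℝ) : |c * Real.arctan x| < c * (Real.pi / 2) := by
  rw [abs_mul, abs_of_pos hc]
  exact mul_lt_mul_of_pos_left
    (abs_lt.2 ⟨Real.neg_pi_div_two_lt_arctan x, Real.arctan_lt_pi_div_two x⟩) hc

include hγ in
/-- The derivative of a function along the arc. -/
theorem hasFDerivAt_comp_arc {k : Cotangent M → V}
    (hk : ∀ u ∈ nonzero M, ContMDiffAt cotModel 𝓘(ℝ, V) ∞ k u) (y : Plane) :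
    HasFDerivAt (fun y : Plane => k (γ (c * Real.arctan (y 0))))
      ((EuclideanSpace.proj 0 : CoPlane).smulRight ((c * (1 / (1 + y 0 ^ 2))) •
        der k (γ (c * Real.arctan (y 0))) (normField g P (γ (c * Real.arctan (y 0)))))) y := by
  refine hasFDerivAt_comp_proj (q := fun x => k (γ (c * Real.arctan x))) ?_
  have h1 := hγ.hasDerivAt (hk _ (cosphere_subset_nonzero g (hγ (c * Real.arctan (y 0))).1))
  exact h1.scomp (y 0) ((Real.hasDerivAt_arctan (y 0)).const_mul c)

include hρ hγ

theorem conePatch_mem (y : Plane) : conePatch γ ρ c y ∈ nonzero M :=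
  scale_mem_nonzero (mul_pos hρ (Real.exp_pos _)).ne' (cosphere_subset_nonzero g (hγ _).1)

theorem conorm_conePatch (y : Plane) : conorm g (conePatch γ ρ c y) = ρ * Real.exp (y 1) := by
  rw [conePatch, conorm_scale g (mul_pos hρ (Real.exp_pos _)).le,
    show conorm g (γ _) = 1 from (hγ _).1, mul_one]

theorem kappa_conePatch (y : Plane) :
    kappa g (conePatch γ ρ c y) = γ (c * Real.arctan (y 0)) := by
  rw [conePatch, kappa_scale g (cosphere_subset_nonzero g (hγ _).1) (mul_pos hρ (Real.exp_pos _)),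
    kappa_eq_self g (hγ _).1]

variable [CompactSpace M] [FiniteDimensional ℝ W] (J : ExactEmbedding M W) (hP : IsSymbol P)
include J hP

omit hρ in
theorem contMDiff_conePatch : ContMDiff 𝓘(ℝ, Plane) cotModel ∞ (conePatch γ ρ c) := by
  intro y
  have h1 : ContDiff ℝ ∞ fun y : Plane => c * Real.arctan (y 0) :=
    contDiff_const.mul (Real.contDiff_arctan.comp (by fun_prop))
  exact contMDiffAt_scale contDiff_mul_exp.contMDiff.contMDiffAt
    ((hγ.contMDiff J hP _).comp y h1.contMDiff.contMDiffAt)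

theorem injective_mfderiv_conePatch (hc : 0 < c) (hX : ∀ t, normField g P (γ t) ≠ 0) (y : Plane) :
    Function.Injective (mfderiv 𝓘(ℝ, Plane) cotModel (conePatch γ ρ c) y) := by
  set f := conePatch γ ρ c with hf
  have hmd := (contMDiff_conePatch hγ (ρ := ρ) (c := c) J hP y).mdifferentiableAt (by simp)
  let D : Plane →L[ℝ] Phase := mfderiv 𝓘(ℝ, Plane) cotModel f y
  have hfy := conePatch_mem hρ hγ (c := c) y
  suffices h : ∀ a, D a = 0 → a = 0 from (injective_iff_map_eq_zero D).2 h
  intro a ha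
  have h1 := hasFDerivAt_comp_map ((contMDiffAt_conorm g hfy).of_le (m := 1) (by simp)) hmd
  have h1' : HasFDerivAt (conorm g ∘ f)
      ((EuclideanSpace.proj 1 : CoPlane).smulRight (ρ * Real.exp (y 1))) y := by
    have h2 : conorm g ∘ f = fun y : Plane => ρ * Real.exp (y 1) :=
      funext fun y => conorm_conePatch hρ hγ y
    rw [h2]
    exact hasFDerivAt_comp_proj (q := fun x => ρ * Real.exp x)
      ((Real.hasDerivAt_exp (y 1)).const_mul ρ)
  have h3 : der (conorm g) (f y) (D a) = a 1 * (ρ * Real.exp (y 1)) :=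
    congrArg (fun L : Plane →L[ℝ] ℝ => L a) (h1.unique h1')
  rw [ha, map_zero] at h3
  have ha1 : a 1 = 0 := (mul_eq_zero.1 h3.symm).resolve_right (mul_pos hρ (Real.exp_pos _)).ne'
  have hk : ∀ u ∈ nonzero M, ContMDiffAt cotModel 𝓘(ℝ, W × (W →L[ℝ] ℝ)) ∞
      (J.emb ∘ kappa g) u := fun u hu => (J.contMDiff_emb _).comp u (contMDiffAt_kappa g hu)
  have h4 := hasFDerivAt_comp_map ((hk _ hfy).of_le (m := 1) (by simp)) hmd
  have h4' : HasFDerivAt ((J.emb ∘ kappa g) ∘ f) _ y :=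
    (hasFDerivAt_comp_arc hγ (c := c) (fun u _ => J.contMDiff_emb u) y).congr_of_eventuallyEq
      (Eventually.of_forall fun y => congrArg J.emb (kappa_conePatch hρ hγ y))
  have h5 : der (J.emb ∘ kappa g) (f y) (D a) = a 0 • (c * (1 / (1 + y 0 ^ 2))) •
      der J.emb (γ (c * Real.arctan (y 0))) (normField g P (γ (c * Real.arctan (y 0)))) :=
    congrArg (fun L : Plane →L[ℝ] W × (W →L[ℝ] ℝ) => L a) (h4.unique h4')
  rw [ha, map_zero] at h5
  have h6 : der J.emb (γ (c * Real.arctan (y 0))) (normField g P (γ (c * Real.arctan (y 0)))) ≠ 0 :=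
    fun h => hX _ (J.injective_der_emb _ (by rw [h, map_zero]))
  have ha0 : a 0 = 0 := by
    refine (smul_eq_zero.1 h5.symm).resolve_right (smul_ne_zero ?_ h6)
    positivity
  ext i
  fin_cases i
  · exact ha0
  · exact ha1

omit hρ in
/-- The canonical one-form vanishes along the curve and in the radial direction, hence so does the
symplectic form on the cone. -/
theorem symplectic_conePatch (h0 : ∀ t, P (γ t) = 0) (y a b : Plane) :
    symplectic (conePatch γ ρ c y) (mfderiv 𝓘(ℝ, Plane) cotModel (conePatch γ ρ c) y a)
      (mfderiv 𝓘(ℝ, Plane) cotModel (conePatch γ ρ c) y b) = 0 := by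
  set f := conePatch γ ρ c with hf
  have hmd := (contMDiff_conePatch hγ (ρ := ρ) (c := c) J hP y).mdifferentiableAt (by simp)
  let D : Plane →L[ℝ] Phase := mfderiv 𝓘(ℝ, Plane) cotModel f y
  change (D a).2 (D b).1 - (D b).2 (D a).1 = 0
  rw [J.symplectic_eq (f y)]
  set h' := c * (1 / (1 + y 0 ^ 2)) with hh'
  set z := γ (c * Real.arctan (y 0)) with hz
  have hb := hasFDerivAt_comp_map ((J.contMDiff_base (f y)).of_le (m := 1) (by simp)) hmd
  have hb' : HasFDerivAt (J.base ∘ f) _ y :=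
    (hasFDerivAt_comp_arc hγ (c := c) (fun u _ => J.contMDiff_base u) y)
  have hm := hasFDerivAt_comp_map ((J.contMDiff_mom (f y)).of_le (m := 1) (by simp)) hmd
  have hm' : HasFDerivAt (J.mom ∘ f) _ y :=
    ((hasFDerivAt_comp_proj (q := fun x => ρ * Real.exp x) (i := 1) (y := y)
      ((Real.hasDerivAt_exp (y 1)).const_mul ρ)).smul
      (hasFDerivAt_comp_arc hγ (c := c) (fun u _ => J.contMDiff_mom u) y)).congr_of_eventuallyEq
      (Eventually.of_forall fun y => J.mom_scale _ _)
  have hbe : ∀ a, der J.base (f y) (D a) = (a 0 * h') • bracket (ham g P) J.base z := by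
    intro a
    have h1 : der J.base (f y) (D a) = a 0 • h' • der J.base z (normField g P z) :=
      congrArg (fun L : Plane →L[ℝ] W => L a) (hb.unique hb')
    rw [h1, J.der_base_normField, smul_smul]
  have hme : ∀ a, der J.mom (f y) (D a) = (ρ * Real.exp (y 1)) • (a 0 * h') •
      der J.mom z (normField g P z) + (a 1 * (ρ * Real.exp (y 1))) • J.mom z := by
    intro a
    have h1 := congrArg (fun L : Plane →L[ℝ] W →L[ℝ] ℝ => L a) (hm.unique hm')
    refine h1.trans ?_
    rw [← smul_smul (a 0) h']
    rfl
  have h2 : J.mom z (bracket (ham g P) J.base z) = 0 := by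
    rw [J.mom_bracket_base g hP (cosphere_subset_nonzero g (hγ _).1), ham, h0, mul_zero]
  rw [hme, hme, hbe, hbe]
  simp only [add_apply, smul_apply, map_smul, smul_eq_mul, h2]
  ring

end

namespace IsCycle

variable {γ : ℝ → Cotangent M} {T : ℝ} (hγ : IsCycle g P γ T)
variable [CompactSpace M] [FiniteDimensional ℝ W] (J : ExactEmbedding M W) (hP : IsSymbol P)
include hγ J hP

theorem isEmbedding_conePatch {ρ : ℝ} (hρ : 0 < ρ) :
    IsEmbedding (conePatch γ ρ (T / (2 * Real.pi))) := by
  have := J.t2Space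
  have hT := hγ.pos
  have hpi := Real.pi_pos
  set c := T / (2 * Real.pi) with hc
  have hc0 : 0 < c := by positivity
  have hcT : c * (Real.pi / 2) = T / 4 := by
    rw [hc]
    field_simp
    norm_num
  -- the arc is embedded since it is part of a compact arc without self-intersection
  have harc : IsEmbedding fun x => γ (c * Real.arctan x) := by
    have h1 : IsClosedEmbedding fun s : Icc (-(T / 4)) (T / 4) => γ s := by
      refine (hγ.curve.continuous.comp continuous_subtype_val).isClosedEmbedding ?_
      rintro ⟨s, hs⟩ ⟨s', hs'⟩ h
      obtain ⟨k, hk⟩ := hγ.eq_imp J hP h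
      have hk1 : (k : ℝ) < 1 := by
        by_contra! hk1
        nlinarith [hs.2, hs'.1]
      have hk2 : (-1 : ℝ) < k := by
        by_contra! hk2
        nlinarith [hs.1, hs'.2]
      have hk0 : k = 0 := by
        have h3 : k < 1 := by exact_mod_cast hk1
        have h4 : -1 < k := by exact_mod_cast hk2
        omega
      rw [hk0, Int.cast_zero, zero_mul] at hk
      exact Subtype.ext (sub_eq_zero.1 hk)
    have h2 : ∀ x, c * Real.arctan x ∈ Icc (-(T / 4)) (T / 4) := fun x =>
      abs_le.1 (hcT ▸ (abs_mul_arctan_lt hc0 x).le)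
    have hcont : Continuous fun x => c * Real.arctan x := by fun_prop
    have h3 : IsEmbedding fun x => (⟨c * Real.arctan x, h2 x⟩ : Icc (-(T / 4)) (T / 4)) :=
      IsEmbedding.of_comp (hcont.subtype_mk h2) continuous_subtype_val
        (isEmbedding_of_strictMono (strictMono_mul_arctan hc0) hcont)
    exact h1.isEmbedding.comp h3
  have hexp : IsEmbedding fun x => ρ * Real.exp x :=
    isEmbedding_of_strictMono (Real.exp_strictMono.const_mul hρ) (by fun_prop)
  have hmem := conePatch_mem hρ hγ.curve (c := c)
  have hcf := (contMDiff_conePatch hγ.curve (ρ := ρ) (c := c) J hP).continuous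
  have h4 : Continuous fun u : nonzero M => (kappa g u.1, conorm g u.1) :=
    continuous_iff_continuousAt.2 fun u =>
      ((contMDiffAt_kappa g u.2).continuousAt.prodMk (contMDiffAt_conorm g u.2).continuousAt).comp
        continuous_subtype_val.continuousAt
  have h5 : IsEmbedding fun y : Plane => (y 0, y 1) :=
    ((EuclideanSpace.equiv (Fin 2) ℝ).toHomeomorph.trans
      (Homeomorph.finTwoArrow (X := ℝ))).isEmbedding
  have h6 : IsEmbedding fun y => (⟨conePatch γ ρ c y, hmem y⟩ : nonzero M) := by
    refine IsEmbedding.of_comp (hcf.subtype_mk hmem) h4 ?_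
    have h7 : ((fun u : nonzero M => (kappa g u.1, conorm g u.1)) ∘
        fun y => (⟨conePatch γ ρ c y, hmem y⟩ : nonzero M)) =
        Prod.map (fun x => γ (c * Real.arctan x)) (fun x => ρ * Real.exp x) ∘
          fun y : Plane => (y 0, y 1) :=
      funext fun y => Prod.ext (kappa_conePatch hρ hγ.curve y) (conorm_conePatch hρ hγ.curve y)
    rw [h7]
    exact (harc.prodMap hexp).comp h5
  exact IsEmbedding.subtypeVal.comp h6

/-- The cone over a closed orbit is a Lagrangian surface away from a compact set disjoint from the
orbit through the given point. -/
theorem exists_lagrangian_patch (hX : ∀ t, normField g P (γ t) ≠ 0) {K : Set (Cotangent M)}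
    (hK : IsClosed K) (hKγ : Disjoint K (range γ)) {v : Cotangent M} (hv : v ∈ nonzero M)
    (hv0 : kappa g v = γ 0) :
    ∃ (U : Set (Cotangent M)) (f : Plane → Cotangent M),
      IsOpen U ∧ v ∈ U ∧ ContMDiff 𝓘(ℝ, Plane) cotModel ∞ f ∧
      (∀ y, Function.Injective (mfderiv 𝓘(ℝ, Plane) cotModel f y)) ∧ IsEmbedding f ∧
      range f = cone g (range γ ∪ K) ∩ U ∧
      ∀ y (a b : Plane), symplectic (f y) (mfderiv 𝓘(ℝ, Plane) cotModel f y a)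
        (mfderiv 𝓘(ℝ, Plane) cotModel f y b) = 0 := by
  have := J.t2Space
  have hT := hγ.pos
  have hpi := Real.pi_pos
  set c := T / (2 * Real.pi) with hc
  have hc0 : 0 < c := by positivity
  have hcT : c * (Real.pi / 2) = T / 4 := by
    rw [hc]
    field_simp
    norm_num
  have hρ := conorm_pos g hv
  set K' := K ∪ γ '' Icc (T / 4) (3 * T / 4) with hK'
  have hK'c : IsClosed K' := hK.union (isCompact_Icc.image hγ.curve.continuous).isClosed
  -- the short arc around time zero is disjoint from the complementary arc
  have harc : ∀ s, |s| < T / 4 → γ s ∉ K' := by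
    rintro s hs (h | ⟨t, ht, h⟩)
    · exact disjoint_left.1 hKγ h (mem_range_self s)
    · obtain ⟨k, hk⟩ := hγ.eq_imp J hP h
      have hs' := abs_lt.1 hs
      have hk1 : (k : ℝ) < 1 := by
        by_contra! hk1
        nlinarith [ht.2]
      have hk2 : (0 : ℝ) < k := by
        by_contra! hk2
        nlinarith [ht.1]
      have h3 : k < 1 := by exact_mod_cast hk1
      have h4 : 0 < k := by exact_mod_cast hk2
      omega
  refine ⟨nonzero M ∩ kappa g ⁻¹' K'ᶜ, conePatch γ (conorm g v) c, ?_, ⟨hv, ?_⟩,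
    contMDiff_conePatch hγ.curve J hP, injective_mfderiv_conePatch hρ hγ.curve J hP hc0 hX,
    hγ.isEmbedding_conePatch J hP hρ, ?_, symplectic_conePatch hγ.curve J hP hγ.symbol⟩
  · refine ContinuousOn.isOpen_inter_preimage (fun u hu => ?_) (isOpen_nonzero g)
      hK'c.isOpen_compl
    exact (contMDiffAt_kappa g hu).continuousAt.continuousWithinAt
  · change kappa g v ∉ K'
    rw [hv0]
    exact harc 0 (by rw [abs_zero]; positivity)
  · refine Subset.antisymm ?_ ?_
    · rintro _ ⟨y, rfl⟩
      have h1 := conePatch_mem hρ hγ.curve (c := c) y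
      have h2 := kappa_conePatch hρ hγ.curve (c := c) y
      refine ⟨⟨h1, ?_⟩, h1, ?_⟩
      · rw [h2]
        exact Or.inl (mem_range_self _)
      · change kappa g _ ∉ K'
        rw [h2]
        exact harc _ (hcT ▸ abs_mul_arctan_lt hc0 _)
    · rintro u ⟨⟨hu, huC⟩, -, huK⟩
      change kappa g u ∉ K' at huK
      obtain ⟨t, ht⟩ := huC.resolve_right fun h => huK (Or.inl h)
      obtain ⟨s, hs, hst⟩ := hγ.periodic.exists_mem_Ico hT t (-(T / 4))
      have hsu : γ s = kappa g u := by rw [← hst, ht]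
      have hs1 : s < T / 4 := by
        by_contra! h
        exact huK (Or.inr ⟨s, ⟨h, by linarith [hs.2]⟩, hsu⟩)
      have hs2 : -(T / 4) < s := by
        refine lt_of_le_of_ne hs.1 fun h => huK (Or.inr ⟨s + T, ⟨?_, ?_⟩, ?_⟩)
        · linarith
        · linarith
        · rw [hγ.periodic, hsu]
      have hatan : c * Real.arctan (Real.tan (s / c)) = s := by
        rw [Real.arctan_tan, mul_div_cancel₀ _ hc0.ne']
        · rw [lt_div_iff₀ hc0]
          linarith
        · rw [div_lt_iff₀ hc0]
          linarith
      refine ⟨!₂[Real.tan (s / c), Real.log (conorm g u / conorm g v)], ?_⟩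
      have hu0 := conorm_pos g hu
      change scale (conorm g v * Real.exp (Real.log (conorm g u / conorm g v)))
        (γ (c * Real.arctan (Real.tan (s / c)))) = u
      rw [hatan, Real.exp_log (div_pos hu0 hρ), mul_div_cancel₀ _ hρ.ne', hsu,
        scale_conorm_kappa g hu]

end IsCycle

/-- The cone over a finite union of closed orbits is a conic Lagrangian submanifold. -/
theorem isConicLagrangian_cone [CompactSpace M] [FiniteDimensional ℝ W] (J : ExactEmbedding M W)
    (hP : IsSymbol P) {S : Set (Set (Cotangent M))} (hS : S.Finite)
    (h : ∀ C ∈ S, ∃ γ T, IsCycle g P γ T ∧ range γ = C ∧ ∀ t, normField g P (γ t) ≠ 0) :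
    IsConicLagrangian (cone g (⋃₀ S)) where
  subset _ hv := hv.1
  conic v hv t ht :=
    ⟨scale_mem_nonzero ht.ne' hv.1, by rw [kappa_scale g hv.1 ht]; exact hv.2⟩
  lagrangian v hv := by
    have := J.t2Space
    obtain ⟨hvn, C, hC, hvC⟩ := hv
    obtain ⟨γ, T, hγ, rfl, hX⟩ := h C hC
    obtain ⟨s, hs⟩ := hvC
    have hrange : range (fun t => γ (t + s)) = range γ :=
      (Equiv.addRight s).surjective.range_comp γ
    have hKc : IsClosed (⋃₀ (S \ {range γ})) := by
      refine ((hS.subset sdiff_subset).isCompact_sUnion ?_).isClosed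
      rintro C' ⟨hC', -⟩
      obtain ⟨γ', T', hγ', rfl, -⟩ := h C' hC'
      exact hγ'.isCompact_range
    have hdisj : Disjoint (⋃₀ (S \ {range γ})) (range fun t => γ (t + s)) := by
      rw [hrange, disjoint_left]
      rintro _ ⟨C', ⟨hC', hne⟩, hu⟩ ⟨t, rfl⟩
      obtain ⟨γ', T', hγ', rfl, -⟩ := h C' hC'
      refine hne (((hγ'.range_eq_of_mem J hP (hγ.curve.shift t) (by rwa [zero_add])).symm).trans ?_)
      exact (Equiv.addRight t).surjective.range_comp γ
    have hL := (hγ.shift J hP s).exists_lagrangian_patch J hP (fun t => hX _) hKc hdisj hvn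
      (by rw [zero_add, hs])
    have hunion : range (fun t => γ (t + s)) ∪ ⋃₀ (S \ {range γ}) = ⋃₀ S := by
      rw [hrange, ← sUnion_insert, insert_sdiff_singleton, insert_eq_of_mem hC]
    rwa [hunion] at hL

end

end

end CotangentFlow

theorem lemmal {M : Type*} [TopologicalSpace M] [T2Space M] [CompactSpace M]
    [ChartedSpace Plane M] [IsManifold (𝓡 2) ∞ M] (g : CotangentFlow.Metric M)
    (p : Cotangent M → ℝ)
    (hp_smooth : ContMDiffOn cotModel 𝓘(ℝ, ℝ) ∞ p (nonzero M))
    (hp_homogeneous : ∀ v ∈ nonzero M, ∀ t : ℝ, 0 < t → p (scale t v) = p v)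
    (ν : ℝ)
    (h_regular : ∀ v ∈ nonzero M, p v = ν → mfderiv cotModel 𝓘(ℝ, ℝ) p v ≠ 0)
    (h_nonempty : (energySurface g p ν).Nonempty)
    (h_morseSmale : IsMorseSmale g p ν) :
    IsRadialSink g (fun v => conorm g v * (p v - ν)) (attractor g p ν) ∧
    IsRadialSource g (fun v => conorm g v * (p v - ν)) (repeller g p ν) ∧
    IsConicLagrangian (cone g (attractor g p ν)) ∧
    IsConicLagrangian (cone g (repeller g p ν)) := by
  obtain ⟨ι, _, ⟨J⟩⟩ := exists_exactEmbedding M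
  have hP := isSymbol_levelFunction g hp_smooth hp_homogeneous ν
  refine ⟨isRadialSink_attractor J hP h_nonempty h_morseSmale,
    isRadialSource_repeller J hP h_nonempty h_morseSmale,
    isConicLagrangian_cone J hP (h_morseSmale.finite.subset fun _ hC => hC.1) fun C hC => ?_,
    isConicLagrangian_cone J hP (h_morseSmale.finite.subset fun _ hC => hC.1) fun C hC => ?_⟩
  · obtain ⟨γ, T, hγ, hr, hX, -⟩ :=
      IsAttractingCycle.exists_cycle J hP hC h_morseSmale.no_fixed_point
    exact ⟨γ, T, hγ, hr, hX⟩
  · obtain ⟨γ, T, hγ, hr, hX, -⟩ :=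
      IsRepellingCycle.exists_cycle J hP hC h_morseSmale.no_fixed_point
    exact ⟨γ, T, hγ, hr, hX⟩
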